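/- **Setting.** A dictionary is a matrix with unit $\ell_2$-norm columns; $\mathcal D\subset\mathbb R^{m\times p}$ is the set of dictionaries, with the topology induced by $\mathbb R^{m\times p}$. For $\lambda\ge 0$ and signals $x^1,\dots,x^n\in\mathbb R^m$ let $$F_n(D)=\frac1n\sum_{i=1}^n\min_{\alpha\in\mathbb R^p}\Big[\tfrac12\|x^i-D\alpha\|_2^2+\lambda\|\alpha\|_1\Big].$$ For $D_0=[d_0^1,\dots,d_0^p]\in\mathcal D$ let $|||D_0|||_2$ be its spectral norm and $\mu_0=\max_{i\ne j}|\langle d_0^i,d_0^j\rangle|$ its coherence. **Signal model (no noise, bounded coefficients).** The signals are $x^i=D_0\alpha_0^i$, $i=1,\dots,n$, where $\alpha_0^1,\dots,\alpha_0^n$ are independent copies of a random vector $\alpha_0\in\mathbb R^p$ generated as follows. A random set $\mathrm J\subset\{1,\dots,p\}$ of size $k$ is drawn uniformly, or by any scheme such that $\Pr(j\in \mathrm J)=\frac kp$ for all $j$ and $\Pr(i,j\in \mathrm J)=\frac{k(k-1)}{p(p-1)}$ for all $i\neq j$; given $\mathrm J$, the entries of $\alpha_0$ in $\mathrm J$ are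 i.i.d. copies of a real random variable $\alpha$ and the other entries are $0$. The variable $\alpha$ is sub-Gaussian: $\mathbb E e^{s\alpha}\le e^{c^2s^2/2}$ for all $s\in\mathbb R$, for some $c>0$; $\sigma_\alpha$ denotes the smallest such $c$. Moreover $0<\underline\alpha\le|\alpha|\le\overline\alpha$ almost surely, and $\Pr(\alpha>0)=\Pr(\alpha<0)$. Put $$q_\alpha=\frac{\mathbb E[\alpha^2]}{\overline\alpha\,\mathbb E[|\alpha|]},\qquad \mathcal Q_\alpha=\frac{\mathbb E[\alpha^2]}{\sigma_\alpha\,\mathbb E[|\alpha|]} .$$ **Theorem.** Fix $\rho\in(0,1)$. There are constants $c_0,c_1,c_\lambda,c>0$, depending on $\rho$ only, such that the following holds for all $m,p$, all $n\ge2$, all $k$ with $1\le k\le\rho p$, all $D_0\in\mathcal D$ and all signal models as above. Let $$t=\frac{8c_1c_\lambda}{q_\alpha}\Big[k\,m\,p^3\,\frac{\log n}{n}\Big]^{1/2}.$$ If * (coherence) $\displaystyle |||D_0|||_2\cdot k^{3/2}\mu_0\le\frac{1}{c_0c_\lambda}\,q_\alpha$, and * (sample complexity) $\displaystyle \frac{\log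 n}{n}\le\frac{1}{k^2mp^3}\bigg[\frac{\mathbb E[\alpha^2]}{\overline\alpha^2}\cdot\frac{1}{9c_1c_\lambda^2}\cdot\min\Big\{\frac{\underline\alpha}{\sigma_\alpha},\ \frac{1}{5c_0}\cdot\frac{\mathcal Q_\alpha}{k\,|||D_0|||_2}\Big\}\bigg]^2,$ then, for the regularization parameter $\lambda=c\,\sqrt k\,\overline\alpha\,t$, with probability exceeding $1-\big(\tfrac{mpn}{9}\big)^{-mp/2}$ the function $F_n:\mathcal D\to\mathbb R$ has a local minimum in $\{D\in\mathcal D:\ \|D_0-D\|_{\mathrm F}<t\}$. -/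

import Mathlib

open MeasureTheory ProbabilityTheory
open scoped Matrix NNReal ENNReal

namespace SparseCoding

noncomputable section

/-! ### The sparse coding objective -/

/-- The set of dictionaries with unit `ℓ₂`-norm columns (the oblique manifold), with the topology
induced by the space of matrices. -/
def dictionaries (m p : ℕ) : Set (Matrix (Fin m) (Fin p) ℝ) :=
  {D | ∀ j, ∑ i, D i j ^ 2 = 1}

/-- The Lasso objective `½‖x - Dα‖₂² + lam ‖α‖₁`. -/
def lassoObjective {m p : ℕ} (lam : ℝ) (x : Fin m → ℝ) (D : Matrix (Fin m) (Fin p) ℝ)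
    (α : Fin p → ℝ) : ℝ :=
  (1 / 2) * ∑ i, (x i - (D *ᵥ α) i) ^ 2 + lam * ∑ j, |α j|

/-- The minimum of the Lasso objective over the coefficient vector (for `lam ≥ 0` the objective is
nonnegative, and the infimum is attained). -/
def lassoValue {m p : ℕ} (lam : ℝ) (x : Fin m → ℝ) (D : Matrix (Fin m) (Fin p) ℝ) : ℝ :=
  ⨅ α : Fin p → ℝ, lassoObjective lam x D α

/-- The sparse coding objective of the signals `X 0, …, X (n - 1)`. -/
def sparseCodingObjective {m p n : ℕ} (lam : ℝ) (X : Fin n → Fin m → ℝ)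
    (D : Matrix (Fin m) (Fin p) ℝ) : ℝ :=
  (1 / (n : ℝ)) * ∑ i, lassoValue lam (X i) D

/-! ### Norms and coherence of a dictionary -/

/-- The Frobenius norm. -/
def frobNorm {m p : ℕ} (A : Matrix (Fin m) (Fin p) ℝ) : ℝ :=
  Real.sqrt (∑ i, ∑ j, A i j ^ 2)

/-- The spectral norm: the operator norm between Euclidean spaces. -/
def spectralNorm {m p : ℕ} (A : Matrix (Fin m) (Fin p) ℝ) : ℝ :=
  ‖LinearMap.toContinuousLinearMap (Matrix.toEuclideanLin A)‖

/-- The mutual coherence: the largest `|⟨dⁱ, dʲ⟩|` over pairs of distinct columns. -/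
def coherence {m p : ℕ} (D : Matrix (Fin m) (Fin p) ℝ) : ℝ :=
  ⨆ q : {q : Fin p × Fin p // q.1 ≠ q.2}, |(Dᵀ * D) q.1.1 q.1.2|

/-! ### The signal model -/

/-- `J` is the law of a random support of size `k` in `Fin p` with the first and second order
inclusion probabilities of uniform sampling without replacement. -/
structure IsSupportLaw {p : ℕ} (k : ℕ) (J : PMF (Finset (Fin p))) : Prop where
  card_eq : ∀ S ∈ J.support, S.card = k
  inclusion : ∀ j : Fin p, ∑ S with j ∈ S, (J S).toReal = (k : ℝ) / p
  inclusion_pair : ∀ i j : Fin p, i ≠ j →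
    ∑ S with i ∈ S ∧ j ∈ S, (J S).toReal = ((k : ℝ) * (k - 1)) / (p * (p - 1))

/-- The law of a coefficient vector: a support `S` is drawn from `J`; given `S`, the entries in `S`
are i.i.d. with law `ν` and the other entries are zero. -/
def coeffLaw {p : ℕ} (J : PMF (Finset (Fin p))) (ν : Measure ℝ) : Measure (Fin p → ℝ) :=
  ∑ S : Finset (Fin p),
    J S • Measure.pi (fun j : Fin p => if j ∈ S then ν else Measure.dirac 0)

/-- The sub-Gaussian parameter `σ_α`: the smallest `c` such that `𝔼 exp (t α) ≤ exp (c² t² / 2)`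
for all real `t`. -/
def subGaussianParam (ν : Measure ℝ) : ℝ :=
  ((sInf {c : ℝ≥0 | HasSubgaussianMGF id (c ^ 2) ν} : ℝ≥0) : ℝ)

/-- The second moment `𝔼[α²]`. -/
def secondMoment (ν : Measure ℝ) : ℝ := ∫ a, a ^ 2 ∂ν

/-- The first absolute moment `𝔼[|α|]`. -/
def absMoment (ν : Measure ℝ) : ℝ := ∫ a, |a| ∂ν

/-- `q_α = 𝔼[α²] / (B 𝔼[|α|])`, where `B` is the almost sure bound on the coefficients. -/
def qParam (ν : Measure ℝ) (B : ℝ) : ℝ := secondMoment ν / (B * absMoment ν)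

/-- `𝒬_α = 𝔼[α²] / (σ_α 𝔼[|α|])`. -/
def bigQParam (ν : Measure ℝ) : ℝ := secondMoment ν / (subGaussianParam ν * absMoment ν)

/-- The radius `t = (8 c₁ c_λ / q_α) [k m p³ log n / n]^{1/2}`. -/
def radius (c₁ cl : ℝ) (m p n k : ℕ) (ν : Measure ℝ) (B : ℝ) : ℝ :=
  8 * c₁ * cl / qParam ν B * Real.sqrt ((k : ℝ) * m * (p : ℝ) ^ 3 * (Real.log n / n))

end

end SparseCoding

namespace SparseCoding

/-! ### Elementary facts on the Lasso value -/

/-! It is enough to show that, with the stated probability, the objective at every dictionary `D` on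
the sphere `frobNorm (D₀ - D) = t` exceeds its value at `D₀`. Compactness then places a local
minimum strictly inside (`exists_isLocalMinOn_of_sphere`).

Consider one signal `D₀ *ᵥ a`, with support `S` and signs `s`, and put `w = (D - D₀) *ᵥ a`. The
choice `lam = 2 * x`, `x = √k * hi * t`, gives `‖w‖ ≤ lam / 2`. At `D₀` the explicit sign-preserving
candidate bounds the Lasso value from above (`lassoValue_le_of_isBlockInverse`). At `D` a dual
vector bounds it from below (`le_lassoValue_of_isBlockInverse`), so no sign recovery is needed
there. The terms `lam * (s ⬝ᵥ a)` cancel, and what remains is a quadratic form in `(a, s)`,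
`gapForm`.

Given `S`, the entries are independent and both `α` and `sign α` are centred, so the mean of the
form is a sum of three traces over `S` (`integral_gapForm`). Averaged over `S`, the main trace is
about `½ 𝔼[α²] (k/p) t² (1 - k/p)`: the displacement of the atoms costs its energy, minus the part
that the selected atoms can reproduce, a fraction of about `k/p ≤ ρ`. The two terms carrying `lam`
involve either diagonal entries, of second order in `t` because columns have unit norm, or
off-diagonal ones that gain a factor of the coherence. The coherence condition makes them small, and
the mean is at least `(1 - ρ)/4 * 𝔼[α²] (k/p) t²` (`le_sum_gapMean`, `le_mean_of_small`).

The form is at most `4 k lam² = 16 k² hi² t²` in absolute value (`abs_gapForm_le`). The ratio of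
mean to size does not involve `t`, so Hoeffding's inequality at a fixed `D` has an exponent of order
`n (𝔼[α²]/hi²)² / (k p)²`. A union bound over a net of `(2 n⁵ + 1)^(m p)` dictionaries costs `m p
log n`, and the sample condition compares the two (`measure_not_forall_sphere_le`, `exponent_bound`,
`failure_bound`). -/

lemma lassoObjective_nonneg {m p : ℕ} {lam : ℝ} (hlam : 0 ≤ lam) (x : Fin m → ℝ)
    (D : Matrix (Fin m) (Fin p) ℝ) (α : Fin p → ℝ) : 0 ≤ lassoObjective lam x D α := by
  unfold lassoObjective
  have : 0 ≤ ∑ j, |α j| := Finset.sum_nonneg fun _ _ => abs_nonneg _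
  positivity

lemma lassoValue_le {m p : ℕ} {lam : ℝ} (hlam : 0 ≤ lam) (x : Fin m → ℝ)
    (D : Matrix (Fin m) (Fin p) ℝ) (α : Fin p → ℝ) :
    lassoValue lam x D ≤ lassoObjective lam x D α :=
  ciInf_le ⟨0, by rintro _ ⟨β, rfl⟩; exact lassoObjective_nonneg hlam x D β⟩ α

/-- Weak duality for the Lasso. -/
lemma le_lassoValue_of_dual {m p : ℕ} {lam : ℝ} (x u : Fin m → ℝ)
    (D : Matrix (Fin m) (Fin p) ℝ) (hu : ∀ j, |(Dᵀ *ᵥ u) j| ≤ lam) :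
    u ⬝ᵥ x - (1 / 2) * (u ⬝ᵥ u) ≤ lassoValue lam x D := by
  refine le_ciInf fun α => ?_
  have h1 : u ⬝ᵥ (D *ᵥ α) ≤ lam * ∑ j, |α j| := by
    rw [Matrix.dotProduct_mulVec, ← Matrix.mulVec_transpose, dotProduct, Finset.mul_sum]
    refine Finset.sum_le_sum fun j _ => (le_abs_self _).trans ?_
    rw [abs_mul]
    exact mul_le_mul_of_nonneg_right (hu j) (abs_nonneg _)
  have h2 : 0 ≤ ∑ i, (x i - (D *ᵥ α) i - u i) ^ 2 := Finset.sum_nonneg fun _ _ => sq_nonneg _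
  have h3 : ∑ i, (x i - (D *ᵥ α) i - u i) ^ 2
      = ∑ i, (x i - (D *ᵥ α) i) ^ 2 - 2 * (u ⬝ᵥ x) + 2 * (u ⬝ᵥ (D *ᵥ α)) + u ⬝ᵥ u := by
    simp only [dotProduct, Finset.mul_sum, ← Finset.sum_sub_distrib, ← Finset.sum_add_distrib]
    exact Finset.sum_congr rfl fun i _ => by ring
  unfold lassoObjective
  linarith

/-- An infimum of continuous functions is upper semicontinuous: its strict sublevel sets are unions
of open sets, so the uncountable index set does no harm. -/
lemma measurable_lassoValue {m p : ℕ} {lam : ℝ} (hlam : 0 ≤ lam) (D : Matrix (Fin m) (Fin p) ℝ) :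
    Measurable fun x : Fin m → ℝ => lassoValue lam x D := by
  refine measurable_of_Iio fun y => IsOpen.measurableSet ?_
  have : (fun x : Fin m → ℝ => lassoValue lam x D) ⁻¹' Set.Iio y
      = ⋃ α : Fin p → ℝ, {x | lassoObjective lam x D α < y} := by
    ext x
    simp only [Set.mem_preimage, Set.mem_Iio, Set.mem_iUnion, Set.mem_ofPred_eq]
    refine ⟨fun h => exists_lt_of_ciInf_lt h, ?_⟩
    rintro ⟨α, hα⟩
    exact (lassoValue_le hlam x D α).trans_lt hα
  rw [this]
  refine isOpen_iUnion fun α => isOpen_lt ?_ continuous_const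
  unfold lassoObjective
  fun_prop

/-- Quantitative continuity of the Lasso value in the dictionary. -/
lemma lassoValue_le_add {m p : ℕ} {lam V h : ℝ} (hlam : 0 < lam) (x : Fin m → ℝ)
    (D D' : Matrix (Fin m) (Fin p) ℝ) (hV : (1 / 2) * ∑ i, x i ^ 2 < V)
    (hD : ∀ i j, |D i j - D' i j| ≤ h) (h0 : 0 ≤ h) :
    lassoValue lam x D' ≤ lassoValue lam x D
      + m * ((1 / 2) * (h * (V / lam)) * (2 * Real.sqrt (2 * V) + h * (V / lam))) := by
  have hV0 : 0 < V := lt_of_le_of_lt (by positivity) hV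
  refine le_of_forall_pos_le_add fun ε hε => ?_
  -- The competitor `α = 0` has value below `V`. A near-minimiser may thus be taken below `V` as
  -- well, which bounds both its `ℓ₁` norm and its residual.
  have hlt : lassoValue lam x D < min (lassoValue lam x D + ε) V := by
    refine lt_min (by linarith) (lt_of_le_of_lt (lassoValue_le hlam.le x D 0) ?_)
    simpa [lassoObjective] using hV
  obtain ⟨α, hα⟩ := exists_lt_of_ciInf_lt hlt
  have hα1 := hα.trans_le (min_le_left _ _)
  have hα2 := hα.trans_le (min_le_right _ _)
  set r : Fin m → ℝ := fun i => x i - (D *ᵥ α) i with hr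
  set r' : Fin m → ℝ := fun i => x i - (D' *ᵥ α) i with hr'
  have hl1 : ∑ j, |α j| ≤ V / lam := by
    rw [le_div_iff₀ hlam]
    unfold lassoObjective at hα2
    have : 0 ≤ ∑ i, (x i - (D *ᵥ α) i) ^ 2 := Finset.sum_nonneg fun _ _ => sq_nonneg _
    linarith
  have hdiff : ∀ i, |r' i - r i| ≤ h * (V / lam) := by
    intro i
    have : r' i - r i = ∑ j, (D i j - D' i j) * α j := by
      simp only [hr, hr', Matrix.mulVec, dotProduct, sub_mul, Finset.sum_sub_distrib]
      ring
    rw [this]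
    calc |∑ j, (D i j - D' i j) * α j| ≤ ∑ j, |(D i j - D' i j) * α j| :=
          Finset.abs_sum_le_sum_abs _ _
      _ ≤ ∑ j, h * |α j| := Finset.sum_le_sum fun j _ => by
          rw [abs_mul]; exact mul_le_mul_of_nonneg_right (hD i j) (abs_nonneg _)
      _ = h * ∑ j, |α j| := by rw [Finset.mul_sum]
      _ ≤ h * (V / lam) := mul_le_mul_of_nonneg_left hl1 h0
  have hri : ∀ i, |r i| ≤ Real.sqrt (2 * V) := by
    intro i
    refine Real.abs_le_sqrt ?_
    have h1 : r i ^ 2 ≤ ∑ i, r i ^ 2 :=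
      Finset.single_le_sum (f := fun i => r i ^ 2) (fun _ _ => sq_nonneg _) (Finset.mem_univ i)
    have h2 : 0 ≤ lam * ∑ j, |α j| :=
      mul_nonneg hlam.le (Finset.sum_nonneg fun _ _ => abs_nonneg _)
    unfold lassoObjective at hα2
    simp only [hr] at h1 ⊢
    linarith
  have hsum : (1 / 2) * ∑ i, r' i ^ 2 ≤ (1 / 2) * ∑ i, r i ^ 2
      + m * ((1 / 2) * (h * (V / lam)) * (2 * Real.sqrt (2 * V) + h * (V / lam))) := by
    have : (m : ℝ) * ((1 / 2) * (h * (V / lam)) * (2 * Real.sqrt (2 * V) + h * (V / lam)))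
        = ∑ _i : Fin m, ((1 / 2) * (h * (V / lam)) * (2 * Real.sqrt (2 * V) + h * (V / lam))) := by
      simp
    rw [this, Finset.mul_sum, Finset.mul_sum, ← Finset.sum_add_distrib]
    refine Finset.sum_le_sum fun i _ => ?_
    have e : r' i ^ 2 - r i ^ 2 = (r' i - r i) * (2 * r i + (r' i - r i)) := by ring
    have b : |(r' i - r i) * (2 * r i + (r' i - r i))|
        ≤ (h * (V / lam)) * (2 * Real.sqrt (2 * V) + h * (V / lam)) := by
      rw [abs_mul]
      refine mul_le_mul (hdiff i) ((abs_add_le _ _).trans ?_) (abs_nonneg _)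
        (by positivity)
      rw [abs_mul, abs_two]
      linarith [hri i, hdiff i]
    linarith [le_abs_self ((r' i - r i) * (2 * r i + (r' i - r i)))]
  have := lassoValue_le hlam.le x D' α
  unfold lassoObjective at this hα1
  simp only [hr, hr'] at hsum
  linarith

lemma continuous_lassoValue {m p : ℕ} {lam : ℝ} (hlam : 0 < lam) (x : Fin m → ℝ) :
    Continuous fun D : Matrix (Fin m) (Fin p) ℝ => lassoValue lam x D := by
  -- `V` depends on the signal only, so the same modulus `ω` serves both directions of the estimate;
  -- the summand 1 makes the bound strict.
  set V : ℝ := (1 / 2) * ∑ i, x i ^ 2 + 1 with hVdef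
  have hV : (1 / 2) * ∑ i, x i ^ 2 < V := by linarith
  set ω : ℝ → ℝ := fun h =>
    m * ((1 / 2) * (h * (V / lam)) * (2 * Real.sqrt (2 * V) + h * (V / lam))) with hω
  have hω0 : Filter.Tendsto ω (nhds 0) (nhds 0) := by
    have : Continuous ω := by fun_prop
    simpa [hω] using this.tendsto 0
  refine continuous_iff_continuousAt.2 fun D => ?_
  set g : Matrix (Fin m) (Fin p) ℝ → ℝ := fun D' => ∑ i, ∑ j, |D i j - D' i j| with hg
  have hg0 : Filter.Tendsto g (nhds D) (nhds 0) := by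
    have : Continuous g := by
      refine continuous_finsetSum _ fun i _ => continuous_finsetSum _ fun j _ => ?_
      exact (continuous_const.sub (continuous_id.matrix_elem i j)).abs
    simpa [hg] using this.tendsto D
  have hle : ∀ D' i j, |D i j - D' i j| ≤ g D' := by
    intro D' i j
    refine (Finset.single_le_sum (f := fun j => |D i j - D' i j|) (fun _ _ => abs_nonneg _)
      (Finset.mem_univ j)).trans ?_
    exact Finset.single_le_sum (f := fun i => ∑ j, |D i j - D' i j|)
      (fun _ _ => Finset.sum_nonneg fun _ _ => abs_nonneg _) (Finset.mem_univ i)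
  have hgn : ∀ D', 0 ≤ g D' := fun D' =>
    Finset.sum_nonneg fun _ _ => Finset.sum_nonneg fun _ _ => abs_nonneg _
  refine tendsto_iff_dist_tendsto_zero.2 ?_
  refine squeeze_zero (fun _ => dist_nonneg) (g := fun D' => ω (g D')) (fun D' => ?_)
    (hω0.comp hg0)
  rw [Real.dist_eq, abs_le]
  constructor
  · have := lassoValue_le_add hlam x D' D hV (fun i j => by
      rw [abs_sub_comm]; exact hle D' i j) (hgn D')
    simp only [hω]; linarith
  · have := lassoValue_le_add hlam x D D' hV (hle D') (hgn D')
    simp only [hω]; linarith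

lemma continuous_sparseCodingObjective {m p n : ℕ} {lam : ℝ} (hlam : 0 < lam)
    (X : Fin n → Fin m → ℝ) :
    Continuous fun D : Matrix (Fin m) (Fin p) ℝ => sparseCodingObjective lam X D := by
  unfold sparseCodingObjective
  exact continuous_const.mul (continuous_finsetSum _ fun i _ => continuous_lassoValue hlam (X i))

/-! ### A local minimum from a lower bound on a sphere -/

lemma continuous_frobNorm {m p : ℕ} :
    Continuous fun A : Matrix (Fin m) (Fin p) ℝ => frobNorm A := by
  unfold frobNorm
  refine Real.continuous_sqrt.comp ?_
  exact continuous_finsetSum _ fun i _ => continuous_finsetSum _ fun j _ =>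
    (continuous_id.matrix_elem i j).pow 2

lemma isCompact_dictionaries (m p : ℕ) : IsCompact (dictionaries m p) := by
  have hsub : dictionaries m p ⊆
      Set.pi Set.univ fun _ : Fin m => Set.pi Set.univ fun _ : Fin p => Set.Icc (-1 : ℝ) 1 := by
    intro D hD i _ j _
    have h1 : D i j ^ 2 ≤ 1 := (hD j) ▸
      Finset.single_le_sum (f := fun i => D i j ^ 2) (fun _ _ => sq_nonneg _) (Finset.mem_univ i)
    exact abs_le.1 (abs_le_one_iff_mul_self_le_one.2 (by nlinarith))
  refine IsCompact.of_isClosed_subset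
    (isCompact_univ_pi fun _ => isCompact_univ_pi fun _ => isCompact_Icc) ?_ hsub
  have : dictionaries m p = ⋂ j, {D : Matrix (Fin m) (Fin p) ℝ | ∑ i, D i j ^ 2 = 1} := by
    ext; simp [dictionaries]
  rw [this]
  refine isClosed_iInter fun j => isClosed_eq ?_ continuous_const
  exact continuous_finsetSum _ fun i _ => (continuous_id.matrix_elem i j).pow 2

/-- The minimiser over the compact closed ball cannot lie on the sphere, where the values exceed the
one at the centre. It therefore lies in the relatively open ball. -/
lemma exists_isLocalMinOn_of_sphere {m p : ℕ} {F : Matrix (Fin m) (Fin p) ℝ → ℝ}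
    (hF : Continuous F) {D₀ : Matrix (Fin m) (Fin p) ℝ} (hD₀ : D₀ ∈ dictionaries m p) {t : ℝ}
    (ht : 0 < t) (h : ∀ D ∈ dictionaries m p, frobNorm (D₀ - D) = t → F D₀ < F D) :
    ∃ D ∈ dictionaries m p, frobNorm (D₀ - D) < t ∧ IsLocalMinOn F (dictionaries m p) D := by
  have hc : Continuous fun D : Matrix (Fin m) (Fin p) ℝ => frobNorm (D₀ - D) :=
    continuous_frobNorm.comp (continuous_const.sub continuous_id)
  have hK : IsCompact (dictionaries m p ∩ {D | frobNorm (D₀ - D) ≤ t}) :=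
    (isCompact_dictionaries m p).inter_right (isClosed_le hc continuous_const)
  have h0 : D₀ ∈ dictionaries m p ∩ {D | frobNorm (D₀ - D) ≤ t} :=
    ⟨hD₀, by simp [frobNorm, ht.le]⟩
  obtain ⟨D, hD, hmin⟩ := hK.exists_isMinOn ⟨D₀, h0⟩ hF.continuousOn
  have hlt : frobNorm (D₀ - D) < t := by
    refine lt_of_le_of_ne hD.2 fun he => ?_
    exact absurd (hmin h0) (not_le.2 (h D hD.1 he))
  refine ⟨D, hD.1, hlt, ?_⟩
  have hopen : ∀ᶠ D' in nhdsWithin D (dictionaries m p), frobNorm (D₀ - D') < t :=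
    nhdsWithin_le_nhds ((isOpen_lt hc continuous_const).mem_nhds hlt)
  filter_upwards [hopen, self_mem_nhdsWithin] with D' h1 h2
  exact hmin ⟨h2, h1.le⟩

/-! ### Inverses of principal blocks of a Gram matrix -/

/-- `M`, extended by zero, is the inverse of the principal block of `G` indexed by `S`, and it
differs entrywise from the identity by at most `2 * μ`. -/
structure IsBlockInverse {p : ℕ} (G : Matrix (Fin p) (Fin p) ℝ) (S : Finset (Fin p)) (μ : ℝ)
    (M : Matrix (Fin p) (Fin p) ℝ) : Prop where
  symm : Mᵀ = M
  eq_zero : ∀ i, i ∉ S → ∀ j, M i j = 0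
  mul_eq : ∀ i ∈ S, ∀ j ∈ S, (G * M) i j = if i = j then 1 else 0
  abs_sub_le : ∀ i ∈ S, ∀ j ∈ S, |M i j - if i = j then 1 else 0| ≤ 2 * μ

/-- The diagonal indicator matrix of `S`. -/
noncomputable def blockOne {p : ℕ} (S : Finset (Fin p)) : Matrix (Fin p) (Fin p) ℝ :=
  Matrix.diagonal fun i => if i ∈ S then 1 else 0

lemma blockOne_mul_self {p : ℕ} (S : Finset (Fin p)) : blockOne S * blockOne S = blockOne S := by
  rw [blockOne, Matrix.diagonal_mul_diagonal]
  congr 1; ext i; split_ifs <;> simp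

lemma blockOne_mul_apply {p : ℕ} {S : Finset (Fin p)} (N : Matrix (Fin p) (Fin p) ℝ) {i : Fin p}
    (hi : i ∈ S) (j : Fin p) : (blockOne S * N) i j = N i j := by
  simp [blockOne, Matrix.diagonal_mul, hi]

lemma sum_abs_block_le {p k : ℕ} {S : Finset (Fin p)} (hS : S.card ≤ k) {μ : ℝ}
    {v : Fin p → ℝ} (hv : ∀ j ∈ S, |v j| ≤ μ) (hμ : 0 ≤ μ) : ∑ j ∈ S, |v j| ≤ k * μ :=
  (Finset.sum_le_card_nsmul _ _ _ hv).trans (by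
    rw [nsmul_eq_mul]; exact mul_le_mul_of_nonneg_right (by exact_mod_cast hS) hμ)

/-- The matrix `A = 1 + E (G - 1) E` agrees with `G` on the block and with the identity elsewhere.
Its off-diagonal row sums are at most `k μ ≤ 1/4`, so it is invertible by diagonal dominance. It
commutes with `E`, and `E * A⁻¹` is the required inverse. -/
lemma exists_isBlockInverse {p k : ℕ} {G : Matrix (Fin p) (Fin p) ℝ} {μ : ℝ} (hμ : 0 ≤ μ)
    (hsymm : Gᵀ = G) (hdiag : ∀ i, G i i = 1) (hoff : ∀ i j, i ≠ j → |G i j| ≤ μ)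
    {S : Finset (Fin p)} (hS : S.card ≤ k) (hk : k * μ ≤ 1 / 4) :
    ∃ M, IsBlockInverse G S μ M := by
  set E := blockOne S with hE
  have hEE : E * E = E := blockOne_mul_self S
  have hET : Eᵀ = E := by simp [hE, blockOne]
  set N : Matrix (Fin p) (Fin p) ℝ := E * (G - 1) * E with hN
  set A : Matrix (Fin p) (Fin p) ℝ := 1 + N with hA
  have hNe : ∀ i j, N i j = if i ∈ S ∧ j ∈ S then G i j - (if i = j then 1 else 0) else 0 := by
    intro i j
    simp only [hN, hE, blockOne, Matrix.mul_diagonal, Matrix.diagonal_mul, Matrix.sub_apply,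
      Matrix.one_apply]
    by_cases h1 : i ∈ S <;> by_cases h2 : j ∈ S <;> simp [h1, h2]
  have hNb : ∀ i j, |N i j| ≤ if j ∈ S then μ else 0 := by
    intro i j
    rw [hNe]
    by_cases h2 : j ∈ S
    · by_cases h1 : i ∈ S
      · by_cases h : i = j
        · subst h; simp [h1, hdiag, hμ]
        · simpa [h1, h2, h] using hoff i j h
      · simp [h1, h2, hμ]
    · simp [h2]
  have hNd : ∀ i, N i i = 0 := by intro i; rw [hNe]; simp [hdiag]
  have hrow : ∀ i, ∑ j, |N i j| ≤ k * μ := by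
    intro i
    calc ∑ j, |N i j| ≤ ∑ j, if j ∈ S then μ else 0 := Finset.sum_le_sum fun j _ => hNb i j
      _ = S.card * μ := by simp [Finset.sum_ite_mem]
      _ ≤ k * μ := mul_le_mul_of_nonneg_right (by exact_mod_cast hS) hμ
  have hdet : A.det ≠ 0 := by
    refine det_ne_zero_of_sum_row_lt_diag fun i => ?_
    have h1 : ∑ j ∈ Finset.univ.erase i, ‖A i j‖ ≤ ∑ j, |N i j| := by
      calc ∑ j ∈ Finset.univ.erase i, ‖A i j‖ = ∑ j ∈ Finset.univ.erase i, |N i j| := by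
            refine Finset.sum_congr rfl fun j hj => ?_
            have : i ≠ j := fun h => (Finset.ne_of_mem_erase hj) h.symm
            simp [hA, Matrix.one_apply_ne this]
        _ ≤ _ := Finset.sum_le_sum_of_subset_of_nonneg (Finset.erase_subset _ _)
            fun _ _ _ => abs_nonneg _
    have h2 : ‖A i i‖ = 1 := by simp [hA, hNd]
    rw [h2]
    linarith [hrow i]
  have hu : IsUnit A.det := hdet.isUnit
  have hAA : A * A⁻¹ = 1 := Matrix.mul_nonsing_inv _ hu
  have hAA' : A⁻¹ * A = 1 := Matrix.nonsing_inv_mul _ hu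
  have hEA : E * A = A * E := by
    simp only [hA, hN, mul_add, add_mul, mul_one, one_mul]
    rw [mul_assoc (E * (G - 1)) E E, hEE, mul_assoc E, ← mul_assoc E E, hEE]
  have hEAi : E * A⁻¹ = A⁻¹ * E := by
    calc E * A⁻¹ = A⁻¹ * A * E * A⁻¹ := by rw [hAA', one_mul]
      _ = A⁻¹ * (E * A) * A⁻¹ := by rw [hEA]; simp only [mul_assoc]
      _ = A⁻¹ * E := by rw [mul_assoc, mul_assoc, hAA, mul_one]
  have hAT : Aᵀ = A := by
    simp only [hA, hN, Matrix.transpose_add, Matrix.transpose_one, Matrix.transpose_mul,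
      Matrix.transpose_sub, hsymm, hET, mul_assoc]
  have hAM : A * (E * A⁻¹) = E := by rw [← mul_assoc, ← hEA, mul_assoc, hAA, mul_one]
  have hEGE : E * G * (E * A⁻¹) = E := by
    have : E * G * E = E * A := by
      simp only [hA, hN, mul_add, mul_one, mul_sub, sub_mul, hEE, ← mul_assoc]
      abel
    rw [← mul_assoc, this, mul_assoc, hAA, mul_one]
  have hEap : ∀ i j, E i j = if i ∈ S then (if i = j then 1 else 0) else 0 := by
    intro i j
    simp only [hE, blockOne, Matrix.diagonal_apply]
    by_cases h : i = j <;> simp [h]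
  refine ⟨E * A⁻¹, ?_, ?_, ?_, ?_⟩
  · rw [Matrix.transpose_mul, Matrix.transpose_nonsing_inv, hAT, hET, hEAi]
  · intro i hi j
    simp [hE, blockOne, Matrix.diagonal_mul, hi]
  · intro i hi j hj
    have h1 := congrFun (congrFun hEGE i) j
    rw [hEap, mul_assoc, blockOne_mul_apply _ hi, if_pos hi] at h1
    exact h1
  · intro i hi j hj
    set M := E * A⁻¹ with hM
    have hX : ∀ i, M i j - E i j = - ∑ l, N i l * M l j := by
      intro i
      have h1 := congrFun (congrFun hAM i) j
      rw [hA, add_mul, one_mul, Matrix.add_apply, Matrix.mul_apply] at h1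
      linarith
    have hMz : ∀ l, l ∉ S → M l j = 0 := by
      intro l hl; simp [hM, hE, blockOne, Matrix.diagonal_mul, hl]
    have hEs : ∑ l ∈ S, |E l j| = 1 := by
      rw [Finset.sum_eq_single j]
      · simp [hEap, hj]
      · intro b _ hb; simp [hEap, hb]
      · exact fun h => absurd hj h
    -- A bootstrap on column `j`: `M - E = -N M` bounds each entry of the error by `μ (1 + s)`.
    -- Summing over `S` gives `s ≤ (1 + s) / 4`, so `s ≤ 1` and each entry is at most `2 μ`.
    set s := ∑ l ∈ S, |M l j - E l j| with hs
    have hMs : ∑ l ∈ S, |M l j| ≤ 1 + s := by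
      rw [← hEs, hs, ← Finset.sum_add_distrib]
      refine Finset.sum_le_sum fun l _ => ?_
      have := abs_add_le (E l j) (M l j - E l j)
      simpa using this
    have hXb : ∀ i, |M i j - E i j| ≤ μ * (1 + s) := by
      intro i
      rw [hX, abs_neg]
      calc |∑ l, N i l * M l j| ≤ ∑ l, |N i l * M l j| := Finset.abs_sum_le_sum_abs _ _
        _ ≤ ∑ l, if l ∈ S then μ * |M l j| else 0 := Finset.sum_le_sum fun l _ => by
            rw [abs_mul]
            by_cases hl : l ∈ S
            · have := hNb i l
              simp only [hl, if_true] at this ⊢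
              exact mul_le_mul_of_nonneg_right this (abs_nonneg _)
            · simp [hMz l hl, hl]
        _ = μ * ∑ l ∈ S, |M l j| := by rw [Finset.mul_sum, Finset.sum_ite_mem]; simp
        _ ≤ _ := mul_le_mul_of_nonneg_left hMs hμ
    have hs0 : 0 ≤ s := Finset.sum_nonneg fun _ _ => abs_nonneg _
    have hsb : s ≤ k * (μ * (1 + s)) := sum_abs_block_le hS (fun l _ => hXb l) (by positivity)
    have hs1 : s ≤ 1 := by nlinarith
    have := hXb i
    rw [hEap] at this
    simp only [hi, if_true] at this
    nlinarith

namespace IsBlockInverse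

variable {p k : ℕ} {G M : Matrix (Fin p) (Fin p) ℝ} {S : Finset (Fin p)} {μ : ℝ}

lemma eq_zero_right (h : IsBlockInverse G S μ M) (i j : Fin p) (hj : j ∉ S) : M i j = 0 := by
  rw [← h.symm, Matrix.transpose_apply]; exact h.eq_zero j hj i

lemma abs_sub_blockOne_le (h : IsBlockInverse G S μ M) (i j : Fin p) :
    |M i j - blockOne S i j| ≤ if i ∈ S ∧ j ∈ S then 2 * μ else 0 := by
  by_cases hi : i ∈ S
  · by_cases hj : j ∈ S
    · have := h.abs_sub_le i hi j hj
      simp only [blockOne, Matrix.diagonal_apply, hi, hj, if_true, and_self]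
      exact this
    · have hij : i ≠ j := fun e => hj (e ▸ hi)
      simp [blockOne, hj, hij, h.eq_zero_right i j hj]
  · simp [blockOne, Matrix.diagonal_apply, hi, h.eq_zero i hi j]

lemma mulVec_eq_zero (h : IsBlockInverse G S μ M) (v : Fin p → ℝ) {i : Fin p} (hi : i ∉ S) :
    (M *ᵥ v) i = 0 := by
  simp [Matrix.mulVec, dotProduct, h.eq_zero i hi]

/-- On `S` the Gram matrix inverts `M`. -/
lemma gram_mulVec (h : IsBlockInverse G S μ M) (v : Fin p → ℝ) {i : Fin p} (hi : i ∈ S) :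
    (G *ᵥ (M *ᵥ v)) i = v i := by
  rw [Matrix.mulVec_mulVec, Matrix.mulVec, dotProduct, Finset.sum_eq_single i]
  · rw [h.mul_eq i hi i hi]; simp
  · intro j _ hj
    by_cases hjS : j ∈ S
    · rw [h.mul_eq i hi j hjS, if_neg (Ne.symm hj), zero_mul]
    · have : (G * M) i j = 0 := by
        rw [Matrix.mul_apply]
        exact Finset.sum_eq_zero fun l _ => by rw [h.eq_zero_right l j hjS, mul_zero]
      rw [this, zero_mul]
  · exact fun hh => absurd (Finset.mem_univ i) hh

lemma dotProduct_gram (h : IsBlockInverse G S μ M) (v w : Fin p → ℝ) :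
    (M *ᵥ v) ⬝ᵥ (G *ᵥ (M *ᵥ w)) = (M *ᵥ v) ⬝ᵥ w := by
  refine Finset.sum_congr rfl fun i _ => ?_
  by_cases hi : i ∈ S
  · rw [h.gram_mulVec w hi]
  · rw [h.mulVec_eq_zero v hi, zero_mul, zero_mul]

lemma dotProduct_comm (h : IsBlockInverse G S μ M) (v w : Fin p → ℝ) :
    v ⬝ᵥ (M *ᵥ w) = w ⬝ᵥ (M *ᵥ v) := by
  rw [Matrix.dotProduct_mulVec, ← Matrix.mulVec_transpose, h.symm, _root_.dotProduct_comm]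

lemma abs_mulVec_sub_le (h : IsBlockInverse G S μ M) (v : Fin p → ℝ) {i : Fin p}
    (hi : i ∈ S) : |(M *ᵥ v) i - v i| ≤ 2 * μ * ∑ j ∈ S, |v j| := by
  have h1 : v i = (blockOne S *ᵥ v) i := by
    simp [blockOne, Matrix.mulVec_diagonal, hi]
  rw [h1, ← Pi.sub_apply, ← Matrix.sub_mulVec, Matrix.mulVec, dotProduct]
  calc |∑ j, (M - blockOne S) i j * v j| ≤ ∑ j, |(M - blockOne S) i j * v j| :=
        Finset.abs_sum_le_sum_abs _ _
    _ ≤ ∑ j, if j ∈ S then 2 * μ * |v j| else 0 := Finset.sum_le_sum fun j _ => by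
        have := h.abs_sub_blockOne_le i j
        rw [abs_mul, Matrix.sub_apply]
        by_cases hj : j ∈ S
        · simp only [hi, hj, and_self, if_true] at this ⊢
          exact mul_le_mul_of_nonneg_right this (abs_nonneg _)
        · simp only [hj, and_false, if_false] at this ⊢
          have := le_antisymm this (abs_nonneg _)
          rw [this, zero_mul]
    _ = _ := by rw [Finset.mul_sum, Finset.sum_ite_mem]; simp

/-- The quadratic form of the block inverse is close to the identity form. -/
lemma abs_quadForm_sub_le (h : IsBlockInverse G S μ M) (v w : Fin p → ℝ) :
    |v ⬝ᵥ (M *ᵥ w) - ∑ i ∈ S, v i * w i| ≤ 2 * μ * ((∑ i ∈ S, |v i|) * ∑ i ∈ S, |w i|) := by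
  have h1 : v ⬝ᵥ (M *ᵥ w) = ∑ i ∈ S, v i * (M *ᵥ w) i := by
    rw [dotProduct]
    refine (Finset.sum_subset (Finset.subset_univ S) fun i _ hi => ?_).symm
    rw [h.mulVec_eq_zero w hi, mul_zero]
  rw [h1, ← Finset.sum_sub_distrib]
  calc |∑ i ∈ S, (v i * (M *ᵥ w) i - v i * w i)| ≤ ∑ i ∈ S, |v i * (M *ᵥ w) i - v i * w i| :=
        Finset.abs_sum_le_sum_abs _ _
    _ ≤ ∑ i ∈ S, |v i| * (2 * μ * ∑ j ∈ S, |w j|) := Finset.sum_le_sum fun i hi => by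
        rw [← mul_sub, abs_mul]
        exact mul_le_mul_of_nonneg_left (h.abs_mulVec_sub_le w hi) (abs_nonneg _)
    _ = _ := by rw [← Finset.sum_mul]; ring

lemma sq_sum_abs_le (hS : S.card ≤ k) (v : Fin p → ℝ) :
    (∑ i ∈ S, |v i|) * (∑ i ∈ S, |v i|) ≤ k * ∑ i ∈ S, v i ^ 2 := by
  have := sq_sum_le_card_mul_sum_sq (s := S) (f := fun i => |v i|)
  simp only [sq_abs] at this
  rw [← sq]
  refine this.trans (mul_le_mul_of_nonneg_right (by exact_mod_cast hS) ?_)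
  exact Finset.sum_nonneg fun _ _ => sq_nonneg _

lemma quadForm_le (h : IsBlockInverse G S μ M) (hμ : 0 ≤ μ) (hS : S.card ≤ k) (v : Fin p → ℝ) :
    v ⬝ᵥ (M *ᵥ v) ≤ (1 + 2 * (k * μ)) * ∑ i ∈ S, v i ^ 2 := by
  have h1 := (abs_le.1 (h.abs_quadForm_sub_le v v)).2
  have h2 := mul_le_mul_of_nonneg_left (sq_sum_abs_le hS v) (by positivity : 0 ≤ 2 * μ)
  simp only [← sq] at h1 h2
  linarith

/-- Bound on `M *ᵥ v` for `v` bounded by one. -/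
lemma abs_mulVec_le_two (h : IsBlockInverse G S μ M) (hμ : 0 ≤ μ) (hS : S.card ≤ k)
    (hk : k * μ ≤ 1 / 4) {v : Fin p → ℝ} (hv : ∀ i, |v i| ≤ 1) (i : Fin p) :
    |(M *ᵥ v) i| ≤ 2 := by
  by_cases hi : i ∈ S
  · have h1 := h.abs_mulVec_sub_le v hi
    have h2 : ∑ j ∈ S, |v j| ≤ k * 1 := sum_abs_block_le hS (fun j _ => hv j) zero_le_one
    have h3 := abs_add_le (v i) ((M *ᵥ v) i - v i)
    rw [add_sub_cancel] at h3
    nlinarith [hv i]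
  · rw [h.mulVec_eq_zero v hi]; simp

end IsBlockInverse

/-! ### Deterministic bounds on the Lasso value -/

lemma dotProduct_self_nonneg' {n : ℕ} (v : Fin n → ℝ) : 0 ≤ v ⬝ᵥ v :=
  Finset.sum_nonneg fun _ _ => mul_self_nonneg _

lemma dotProduct_sq_le {n : ℕ} (v w : Fin n → ℝ) : (v ⬝ᵥ w) ^ 2 ≤ (v ⬝ᵥ v) * (w ⬝ᵥ w) := by
  have := Finset.sum_mul_sq_le_sq_mul_sq Finset.univ v w
  simpa [dotProduct, sq] using this

lemma transpose_mulVec_dotProduct {m p : ℕ} (D : Matrix (Fin m) (Fin p) ℝ) (u : Fin m → ℝ)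
    (v : Fin p → ℝ) : (Dᵀ *ᵥ u) ⬝ᵥ v = u ⬝ᵥ (D *ᵥ v) := by
  rw [Matrix.dotProduct_mulVec, Matrix.mulVec_transpose]

lemma mulVec_dotProduct_mulVec {m p : ℕ} (D : Matrix (Fin m) (Fin p) ℝ) (v w : Fin p → ℝ) :
    (D *ᵥ v) ⬝ᵥ (D *ᵥ w) = v ⬝ᵥ ((Dᵀ * D) *ᵥ w) := by
  rw [← Matrix.mulVec_mulVec, _root_.dotProduct_comm v, transpose_mulVec_dotProduct,
    _root_.dotProduct_comm]

lemma sq_transpose_mulVec_le {m p : ℕ} {D : Matrix (Fin m) (Fin p) ℝ} (hD : D ∈ dictionaries m p)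
    (v : Fin m → ℝ) (j : Fin p) : ((Dᵀ *ᵥ v) j) ^ 2 ≤ v ⬝ᵥ v := by
  have h := dotProduct_sq_le (fun i => D i j) v
  have h1 : (fun i => D i j) ⬝ᵥ (fun i => D i j) = 1 := by
    rw [← hD j]; simp [dotProduct, sq]
  rw [h1, one_mul] at h
  exact h

variable {m p k : ℕ} {D D₀ : Matrix (Fin m) (Fin p) ℝ} {M M₀ : Matrix (Fin p) (Fin p) ℝ}
  {S : Finset (Fin p)} {μ lam : ℝ}

/-- Lower bound on the Lasso value at a dictionary `D`, by the dual certificate whose correlations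
with the atoms in `S` are `lam * s`. -/
lemma le_lassoValue_of_isBlockInverse (hD : D ∈ dictionaries m p)
    (hM : IsBlockInverse (Dᵀ * D) S μ M) (hμ : 0 ≤ μ) (hS : S.card ≤ k) (hk : k * μ ≤ 1 / 4)
    (hoff : ∀ i j, i ≠ j → |(Dᵀ * D) i j| ≤ μ) (hlam : 0 ≤ lam)
    {a s : Fin p → ℝ} {w : Fin m → ℝ} (ha : ∀ i, i ∉ S → a i = 0) (hs : ∀ i, |s i| ≤ 1)
    (hw : w = (D - D₀) *ᵥ a) (hwl : w ⬝ᵥ w ≤ (lam / 2) ^ 2) :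
    lam * (s ⬝ᵥ a) + (1 / 2) * (w ⬝ᵥ w)
        - (1 / 2) * ((Dᵀ *ᵥ w + lam • s) ⬝ᵥ (M *ᵥ (Dᵀ *ᵥ w + lam • s)))
      ≤ lassoValue lam (D₀ *ᵥ a) D := by
  set y := Dᵀ *ᵥ w with hy
  set z := y + lam • s with hz
  set u := D *ᵥ (M *ᵥ z) - w with hu
  have hx : D₀ *ᵥ a = D *ᵥ a - w := by rw [hw, Matrix.sub_mulVec]; abel
  have hDu : Dᵀ *ᵥ u = (Dᵀ * D) *ᵥ (M *ᵥ z) - y := by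
    rw [hu, Matrix.mulVec_sub, Matrix.mulVec_mulVec _ Dᵀ]
  have hDuS : ∀ i ∈ S, (Dᵀ *ᵥ u) i = lam * s i := by
    intro i hi
    rw [hDu, Pi.sub_apply, hM.gram_mulVec z hi, hz]
    simp
  have huDa : u ⬝ᵥ (D *ᵥ a) = lam * (s ⬝ᵥ a) := by
    rw [← transpose_mulVec_dotProduct, dotProduct, dotProduct, Finset.mul_sum]
    refine Finset.sum_congr rfl fun i _ => ?_
    by_cases hi : i ∈ S
    · rw [hDuS i hi]; ring
    · rw [ha i hi]; ring
  have hwM : ∀ v, w ⬝ᵥ (D *ᵥ (M *ᵥ v)) = y ⬝ᵥ (M *ᵥ v) := fun v => by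
    rw [hy, transpose_mulVec_dotProduct]
  have hMM : ∀ v, (D *ᵥ (M *ᵥ v)) ⬝ᵥ (D *ᵥ (M *ᵥ v)) = v ⬝ᵥ (M *ᵥ v) := fun v => by
    rw [mulVec_dotProduct_mulVec, hM.dotProduct_gram, _root_.dotProduct_comm]
  have huu : u ⬝ᵥ u = z ⬝ᵥ (M *ᵥ z) - 2 * (y ⬝ᵥ (M *ᵥ z)) + w ⬝ᵥ w := by
    rw [hu, sub_dotProduct, dotProduct_sub, dotProduct_sub, hMM, hwM,
      _root_.dotProduct_comm (D *ᵥ (M *ᵥ z)) w, hwM]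
    ring
  have huw : u ⬝ᵥ w = y ⬝ᵥ (M *ᵥ z) - w ⬝ᵥ w := by
    rw [hu, sub_dotProduct, _root_.dotProduct_comm (D *ᵥ (M *ᵥ z)) w, hwM]
  have hfeas : ∀ j, |(Dᵀ *ᵥ u) j| ≤ lam := by
    intro j
    by_cases hj : j ∈ S
    · rw [hDuS j hj, abs_mul, abs_of_nonneg hlam]
      nlinarith [hs j]
    -- `q` is the component of `w` orthogonal to the atoms in `S`, and `u = lam • (D *ᵥ (M *ᵥ s)) -
    -- q`. Off `S` the budget `lam` is shared equally: `‖q‖ ≤ ‖w‖ ≤ lam / 2` controls one part, and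
    -- incoherence gives `2 k μ ≤ 1/2` for the other.
    · set q := w - D *ᵥ (M *ᵥ y) with hq
      have hqq : q ⬝ᵥ q ≤ (lam / 2) ^ 2 := by
        have : q ⬝ᵥ q = w ⬝ᵥ w - (D *ᵥ (M *ᵥ y)) ⬝ᵥ (D *ᵥ (M *ᵥ y)) := by
          rw [hq, sub_dotProduct, dotProduct_sub, dotProduct_sub, hMM, hwM,
            _root_.dotProduct_comm (D *ᵥ (M *ᵥ y)) w, hwM]
          ring
        rw [this]
        linarith [dotProduct_self_nonneg' (D *ᵥ (M *ᵥ y))]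
      have h1 : |(Dᵀ *ᵥ q) j| ≤ lam / 2 :=
        abs_le_of_sq_le_sq ((sq_transpose_mulVec_le hD q j).trans hqq) (by positivity)
      have h2 : |((Dᵀ * D) *ᵥ (M *ᵥ s)) j| ≤ 1 / 2 := by
        rw [Matrix.mulVec, dotProduct]
        calc |∑ i, (Dᵀ * D) j i * (M *ᵥ s) i| ≤ ∑ i, |(Dᵀ * D) j i * (M *ᵥ s) i| :=
              Finset.abs_sum_le_sum_abs _ _
          _ ≤ ∑ i, if i ∈ S then μ * 2 else 0 := Finset.sum_le_sum fun i _ => by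
              by_cases hi : i ∈ S
              · rw [if_pos hi, abs_mul]
                exact mul_le_mul (hoff j i fun e => hj (e ▸ hi))
                  (hM.abs_mulVec_le_two hμ hS hk hs i) (abs_nonneg _) hμ
              · rw [if_neg hi, hM.mulVec_eq_zero s hi]; simp
          _ = S.card * (μ * 2) := by simp [Finset.sum_ite_mem]
          _ ≤ k * (μ * 2) := mul_le_mul_of_nonneg_right (by exact_mod_cast hS) (by positivity)
          _ ≤ 1 / 2 := by linarith
      have h3 : (Dᵀ *ᵥ u) j = lam * ((Dᵀ * D) *ᵥ (M *ᵥ s)) j - (Dᵀ *ᵥ q) j := by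
        have : u = lam • (D *ᵥ (M *ᵥ s)) - q := by
          rw [hu, hq, hz, Matrix.mulVec_add, Matrix.mulVec_add, Matrix.mulVec_smul,
            Matrix.mulVec_smul]
          abel
        rw [this, Matrix.mulVec_sub, Matrix.mulVec_smul, Matrix.mulVec_mulVec _ Dᵀ]
        simp
      rw [h3]
      refine (abs_sub _ _).trans ?_
      rw [abs_mul, abs_of_nonneg hlam]
      nlinarith
  refine le_trans (le_of_eq ?_) (le_lassoValue_of_dual _ u D hfeas)
  rw [hx, dotProduct_sub, huDa, huw, huu]
  ring

/-- Upper bound on the Lasso value at the reference dictionary. -/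
lemma lassoValue_le_of_isBlockInverse (hM : IsBlockInverse (D₀ᵀ * D₀) S μ M₀) (hμ : 0 ≤ μ)
    (hS : S.card ≤ k) (hk : k * μ ≤ 1 / 4) (hlam : 0 ≤ lam) {a s : Fin p → ℝ}
    (ha : ∀ i, i ∉ S → a i = 0) (hs : ∀ i, |s i| ≤ 1) (hs1 : ∀ i ∈ S, s i * s i = 1)
    (hsa : ∀ i, s i * a i = |a i|) (hlo : ∀ i ∈ S, 2 * lam ≤ |a i|) :
    lassoValue lam (D₀ *ᵥ a) D₀ ≤ lam * (s ⬝ᵥ a) - (1 / 2) * lam ^ 2 * (s ⬝ᵥ (M₀ *ᵥ s)) := by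
  -- This candidate solves the stationarity equations on `S` with signs `s`. The entries of `M₀ *ᵥ
  -- s` are at most 2, so `2 * lam ≤ |a i|` keeps the signs and the `ℓ₁` norm is linear there.
  refine (lassoValue_le hlam _ _ (a - lam • (M₀ *ᵥ s))).trans (le_of_eq ?_)
  have h1 : ∑ i, ((D₀ *ᵥ a) i - (D₀ *ᵥ (a - lam • (M₀ *ᵥ s))) i) ^ 2
      = lam ^ 2 * (s ⬝ᵥ (M₀ *ᵥ s)) := by
    have : ∀ i, (D₀ *ᵥ a) i - (D₀ *ᵥ (a - lam • (M₀ *ᵥ s))) i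
        = lam * (D₀ *ᵥ (M₀ *ᵥ s)) i := by
      intro i
      rw [Matrix.mulVec_sub, Matrix.mulVec_smul]
      simp
    simp only [this, mul_pow]
    rw [← Finset.mul_sum]
    congr 1
    rw [_root_.dotProduct_comm, ← hM.dotProduct_gram, ← mulVec_dotProduct_mulVec]
    simp [dotProduct, sq]
  have h2 : ∑ j, |(a - lam • (M₀ *ᵥ s)) j| = s ⬝ᵥ a - lam * (s ⬝ᵥ (M₀ *ᵥ s)) := by
    rw [dotProduct, dotProduct, Finset.mul_sum, ← Finset.sum_sub_distrib]
    refine Finset.sum_congr rfl fun j _ => ?_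
    simp only [Pi.sub_apply, Pi.smul_apply, smul_eq_mul]
    by_cases hj : j ∈ S
    · have hb := hM.abs_mulVec_le_two hμ hS hk hs j
      have e : |a j - lam * (M₀ *ᵥ s) j| = |s j * (a j - lam * (M₀ *ᵥ s) j)| := by
        rw [abs_mul]
        have : |s j| = 1 := by
          have := hs1 j hj
          rw [← abs_mul_abs_self] at this
          nlinarith [abs_nonneg (s j)]
        rw [this, one_mul]
      rw [e, abs_of_nonneg]
      · ring
      · rw [mul_sub, hsa j]
        have hc : s j * (lam * (M₀ *ᵥ s) j) ≤ 2 * lam := by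
          refine (le_abs_self _).trans ?_
          rw [abs_mul, abs_mul, abs_of_nonneg hlam]
          calc |s j| * (lam * |(M₀ *ᵥ s) j|) ≤ 1 * (lam * 2) :=
                mul_le_mul (hs j) (mul_le_mul_of_nonneg_left hb hlam) (by positivity) zero_le_one
            _ = 2 * lam := by ring
        linarith [hlo j hj]
    · rw [ha j hj, hM.mulVec_eq_zero s hj]; simp
  rw [lassoObjective, h1, h2]
  ring

/-- The lower bound on the increase of the Lasso value, for signals with support `S`, coefficients
`a` and signs `s`. -/
noncomputable def gapForm (D D₀ : Matrix (Fin m) (Fin p) ℝ) (M M₀ : Matrix (Fin p) (Fin p) ℝ)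
    (lam : ℝ) (a s : Fin p → ℝ) : ℝ :=
  a ⬝ᵥ (((1 / 2 : ℝ) • ((D - D₀)ᵀ * (D - D₀)
      - (Dᵀ * (D - D₀))ᵀ * (M * (Dᵀ * (D - D₀))))) *ᵥ a)
    + s ⬝ᵥ (((-lam) • (M * (Dᵀ * (D - D₀)))) *ᵥ a)
    + s ⬝ᵥ (((-((1 / 2) * lam ^ 2)) • (M - M₀)) *ᵥ s)

lemma gapForm_eq (hM : IsBlockInverse (Dᵀ * D) S μ M) (a s : Fin p → ℝ) {w : Fin m → ℝ}
    (hw : w = (D - D₀) *ᵥ a) :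
    gapForm D D₀ M M₀ lam a s = (1 / 2) * (w ⬝ᵥ w)
        - (1 / 2) * ((Dᵀ *ᵥ w + lam • s) ⬝ᵥ (M *ᵥ (Dᵀ *ᵥ w + lam • s)))
        + (1 / 2) * lam ^ 2 * (s ⬝ᵥ (M₀ *ᵥ s)) := by
  have hy : (Dᵀ * (D - D₀)) *ᵥ a = Dᵀ *ᵥ w := by rw [hw, Matrix.mulVec_mulVec]
  have e1 : a ⬝ᵥ (((D - D₀)ᵀ * (D - D₀)) *ᵥ a) = w ⬝ᵥ w := by
    rw [← mulVec_dotProduct_mulVec, hw]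
  have e2 : a ⬝ᵥ (((Dᵀ * (D - D₀))ᵀ * (M * (Dᵀ * (D - D₀)))) *ᵥ a)
      = (Dᵀ *ᵥ w) ⬝ᵥ (M *ᵥ (Dᵀ *ᵥ w)) := by
    rw [← Matrix.mulVec_mulVec, _root_.dotProduct_comm, transpose_mulVec_dotProduct, hy,
      ← Matrix.mulVec_mulVec, hy, _root_.dotProduct_comm]
  have e3 : s ⬝ᵥ ((M * (Dᵀ * (D - D₀))) *ᵥ a) = s ⬝ᵥ (M *ᵥ (Dᵀ *ᵥ w)) := by
    rw [← Matrix.mulVec_mulVec, hy]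
  simp only [gapForm, Matrix.smul_mulVec, Matrix.sub_mulVec, dotProduct_smul, dotProduct_sub,
    smul_eq_mul, e1, e2, e3, Matrix.mulVec_add, dotProduct_add, add_dotProduct,
    Matrix.mulVec_smul, smul_dotProduct, hM.dotProduct_comm (Dᵀ *ᵥ w) s]
  ring

/-- The increase of the Lasso value from `D₀` to `D` on a noiseless signal. -/
lemma gapForm_le_lassoValue_sub (hD : D ∈ dictionaries m p)
    (hM : IsBlockInverse (Dᵀ * D) S μ M) (hM₀ : IsBlockInverse (D₀ᵀ * D₀) S μ M₀)
    (hμ : 0 ≤ μ) (hS : S.card ≤ k) (hk : k * μ ≤ 1 / 4)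
    (hoff : ∀ i j, i ≠ j → |(Dᵀ * D) i j| ≤ μ) (hlam : 0 ≤ lam) {a s : Fin p → ℝ}
    (ha : ∀ i, i ∉ S → a i = 0) (hs : ∀ i, |s i| ≤ 1) (hs1 : ∀ i ∈ S, s i * s i = 1)
    (hsa : ∀ i, s i * a i = |a i|) (hlo : ∀ i ∈ S, 2 * lam ≤ |a i|)
    (hwl : ((D - D₀) *ᵥ a) ⬝ᵥ ((D - D₀) *ᵥ a) ≤ (lam / 2) ^ 2) :
    gapForm D D₀ M M₀ lam a s ≤ lassoValue lam (D₀ *ᵥ a) D - lassoValue lam (D₀ *ᵥ a) D₀ := by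
  have h1 := le_lassoValue_of_isBlockInverse (D₀ := D₀) hD hM hμ hS hk hoff hlam ha hs
    rfl hwl
  have h2 := lassoValue_le_of_isBlockInverse hM₀ hμ hS hk hlam ha hs hs1 hsa hlo
  rw [gapForm_eq hM a s rfl]
  linarith

section Gap

variable {m p k : ℕ} {D D₀ : Matrix (Fin m) (Fin p) ℝ} {M M₀ : Matrix (Fin p) (Fin p) ℝ}
  {S : Finset (Fin p)} {μ lam : ℝ}

/-! ### Size and mean of the lower bound -/

lemma IsBlockInverse.abs_quadForm_self_le {G : Matrix (Fin p) (Fin p) ℝ}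
    (hM : IsBlockInverse G S μ M) (hμ : 0 ≤ μ) (hS : S.card ≤ k) (hk : k * μ ≤ 1 / 4)
    {v : Fin p → ℝ} {c : ℝ} (hc : 0 ≤ c) (hv : ∀ i, v i ^ 2 ≤ c) :
    |v ⬝ᵥ (M *ᵥ v)| ≤ 2 * (k * c) := by
  have h1 := hM.abs_quadForm_sub_le v v
  have h2 := mul_le_mul_of_nonneg_left (IsBlockInverse.sq_sum_abs_le hS v)
    (by positivity : 0 ≤ 2 * μ)
  have h3 : ∑ i ∈ S, v i ^ 2 ≤ k * c := by
    refine (Finset.sum_le_card_nsmul _ _ _ fun i _ => hv i).trans ?_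
    rw [nsmul_eq_mul]
    exact mul_le_mul_of_nonneg_right (by exact_mod_cast hS) hc
  have h4 : 0 ≤ ∑ i ∈ S, v i ^ 2 := Finset.sum_nonneg fun _ _ => sq_nonneg _
  simp only [← sq] at h1 h2
  rw [abs_le] at h1 ⊢
  constructor <;> nlinarith

/-- This is the range used in Hoeffding's inequality. The entries of `Dᵀ *ᵥ w + lam • s` are at most
`3/2 * lam`, and a block inverse at most doubles the bound `k c` on a squared norm over `S`. -/
lemma abs_gapForm_le (hD : D ∈ dictionaries m p)
    (hM : IsBlockInverse (Dᵀ * D) S μ M) (hM₀ : IsBlockInverse (D₀ᵀ * D₀) S μ M₀)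
    (hμ : 0 ≤ μ) (hS : S.card ≤ k) (hk1 : 1 ≤ k) (hk : k * μ ≤ 1 / 4) (hlam : 0 ≤ lam)
    {a s : Fin p → ℝ} (hs : ∀ i, |s i| ≤ 1)
    (hwl : ((D - D₀) *ᵥ a) ⬝ᵥ ((D - D₀) *ᵥ a) ≤ (lam / 2) ^ 2) :
    |gapForm D D₀ M M₀ lam a s| ≤ 4 * k * lam ^ 2 := by
  rw [gapForm_eq hM a s rfl]
  set w := (D - D₀) *ᵥ a
  set z := Dᵀ *ᵥ w + lam • s with hz
  have hk1' : (1 : ℝ) ≤ k := by exact_mod_cast hk1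
  have hyi : ∀ i, |(Dᵀ *ᵥ w) i| ≤ lam / 2 := fun i =>
    abs_le_of_sq_le_sq ((sq_transpose_mulVec_le hD w i).trans hwl) (by positivity)
  have hz2 : ∀ i, z i ^ 2 ≤ (3 / 2 * lam) ^ 2 := by
    intro i
    rw [sq_le_sq, abs_of_nonneg (by positivity : 0 ≤ 3 / 2 * lam)]
    refine (abs_add_le _ _).trans ?_
    have : |(lam • s) i| ≤ lam := by
      rw [Pi.smul_apply, smul_eq_mul, abs_mul, abs_of_nonneg hlam]
      nlinarith [hs i]
    linarith [hyi i]
  have hs2 : ∀ i, s i ^ 2 ≤ 1 := fun i => (sq_le_one_iff_abs_le_one _).2 (hs i)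
  have b1 := abs_le.1 (hM.abs_quadForm_self_le hμ hS hk (sq_nonneg _) hz2)
  have b2 := abs_le.1 (hM₀.abs_quadForm_self_le hμ hS hk zero_le_one hs2)
  have b3 := dotProduct_self_nonneg' w
  have b4 := mul_le_mul_of_nonneg_left b2.1 (sq_nonneg lam)
  have b5 := mul_le_mul_of_nonneg_left b2.2 (sq_nonneg lam)
  have b6 : lam ^ 2 ≤ k * lam ^ 2 := le_mul_of_one_le_left (sq_nonneg _) hk1'
  rw [abs_le]
  constructor <;> nlinarith

/-- The squared norm of column `j`. -/
def colSq (A : Matrix (Fin m) (Fin p) ℝ) (j : Fin p) : ℝ := ∑ i, A i j ^ 2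

lemma colSq_nonneg (A : Matrix (Fin m) (Fin p) ℝ) (j : Fin p) : 0 ≤ colSq A j :=
  Finset.sum_nonneg fun _ _ => sq_nonneg _

/-- Polarisation with both columns of unit norm. The diagonal of `Dᵀ (D - D₀)` is thus of second
order in the displacement, which keeps the diagonal contributions to the mean small. -/
lemma gram_sub_apply_self (hD : D ∈ dictionaries m p) (hD₀ : D₀ ∈ dictionaries m p) (j : Fin p) :
    (Dᵀ * (D - D₀)) j j = (1 / 2) * colSq (D - D₀) j := by
  have h1 := hD j
  have h2 := hD₀ j
  have : colSq (D - D₀) j = 2 * (Dᵀ * (D - D₀)) j j - ∑ i, D i j ^ 2 + ∑ i, D₀ i j ^ 2 := by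
    simp only [colSq, Matrix.mul_apply, Finset.mul_sum, ← Finset.sum_sub_distrib,
      ← Finset.sum_add_distrib, Matrix.sub_apply, Matrix.transpose_apply]
    exact Finset.sum_congr rfl fun i _ => by ring
  rw [this, h1, h2]; ring

lemma gram_apply_self (hD : D ∈ dictionaries m p) (j : Fin p) : (Dᵀ * D) j j = 1 := by
  rw [Matrix.mul_apply, ← hD j]
  exact Finset.sum_congr rfl fun i _ => by rw [Matrix.transpose_apply, sq]

/-! ### Trace estimates for block inverses -/

namespace IsBlockInverse

variable {G G₀ : Matrix (Fin p) (Fin p) ℝ}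

lemma sum_diag_conj_le (hM : IsBlockInverse G S μ M) (hμ : 0 ≤ μ) (hS : S.card ≤ k)
    (C : Matrix (Fin p) (Fin p) ℝ) :
    ∑ j ∈ S, (Cᵀ * (M * C)) j j ≤ (1 + 2 * (k * μ)) * ∑ i ∈ S, ∑ j ∈ S, C i j ^ 2 := by
  rw [Finset.sum_comm, Finset.mul_sum]
  refine Finset.sum_le_sum fun j _ => ?_
  have h1 : (Cᵀ * (M * C)) j j = (fun i => C i j) ⬝ᵥ (M *ᵥ fun i => C i j) := by
    simp [Matrix.mul_apply, dotProduct, Matrix.mulVec]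
  rw [h1]
  exact hM.quadForm_le hμ hS _

lemma sum_diag_mul_le (hM : IsBlockInverse G S μ M) (C : Matrix (Fin p) (Fin p) ℝ) :
    ∑ j ∈ S, (M * C) j j ≤ ∑ j ∈ S, C j j + 2 * μ * ∑ i ∈ S, ∑ j ∈ S, |C i j| := by
  rw [Finset.sum_comm, Finset.mul_sum, ← Finset.sum_add_distrib]
  refine Finset.sum_le_sum fun j hj => ?_
  have h1 : (M * C) j j = (M *ᵥ fun i => C i j) j := by
    simp [Matrix.mul_apply, dotProduct, Matrix.mulVec]
  rw [h1]
  have := (abs_le.1 (hM.abs_mulVec_sub_le (fun i => C i j) hj)).2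
  linarith

lemma sum_abs_col_le (hM : IsBlockInverse G S μ M) (hμ : 0 ≤ μ) (hS : S.card ≤ k)
    {i : Fin p} (hi : i ∈ S) : ∑ j ∈ S, |M j i| ≤ 1 + k * (2 * μ) := by
  have h1 : ∀ j ∈ S, |M j i| ≤ (if j = i then 1 else 0) + 2 * μ := by
    intro j hj
    have h2 := hM.abs_sub_le j hj i hi
    have h3 := abs_add_le (if j = i then (1 : ℝ) else 0) (M j i - if j = i then (1 : ℝ) else 0)
    rw [add_sub_cancel] at h3
    have h4 : |if j = i then (1 : ℝ) else 0| = if j = i then 1 else 0 := by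
      split_ifs <;> simp
    linarith
  refine (Finset.sum_le_sum h1).trans ?_
  rw [Finset.sum_add_distrib, Finset.sum_ite_eq' S i, if_pos hi, Finset.sum_const, nsmul_eq_mul]
  have : (S.card : ℝ) * (2 * μ) ≤ k * (2 * μ) :=
    mul_le_mul_of_nonneg_right (by exact_mod_cast hS) (by positivity)
  linarith

lemma mul_gram_mul (hM : IsBlockInverse G S μ M) {N : Matrix (Fin p) (Fin p) ℝ}
    (hN : ∀ i j, j ∉ S → N i j = 0) : N * (G * M) = N := by
  ext i l
  by_cases hl : l ∈ S
  · rw [Matrix.mul_apply, Finset.sum_eq_single l]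
    · rw [hM.mul_eq l hl l hl, if_pos rfl, mul_one]
    · intro j _ hj
      by_cases hjS : j ∈ S
      · rw [hM.mul_eq j hjS l hl, if_neg hj, mul_zero]
      · rw [hN i j hjS, zero_mul]
    · exact fun h => absurd (Finset.mem_univ l) h
  · rw [hN i l hl, Matrix.mul_apply]
    refine Finset.sum_eq_zero fun j _ => ?_
    have : (G * M) j l = 0 := by
      rw [Matrix.mul_apply]
      exact Finset.sum_eq_zero fun r _ => by rw [hM.eq_zero_right r l hl, mul_zero]
    rw [this, mul_zero]

/-- The resolvent identity. The products with the Gram matrices are the identity on the block only,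
which suffices because `M` and `M₀` vanish outside it. -/
lemma sub_eq (hM : IsBlockInverse G S μ M) (hM₀ : IsBlockInverse G₀ S μ M₀) (hG : Gᵀ = G) :
    M - M₀ = M * (G₀ - G) * M₀ := by
  have h1 : M * (G₀ * M₀) = M := hM₀.mul_gram_mul hM.eq_zero_right
  have h2 : M * G * M₀ = M₀ := by
    have := congrArg Matrix.transpose (hM.mul_gram_mul hM₀.eq_zero_right)
    rwa [Matrix.transpose_mul, Matrix.transpose_mul, hM.symm, hM₀.symm, hG] at this
  rw [mul_sub, sub_mul, mul_assoc, h1, h2]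

/-- By the resolvent identity and cyclicity the trace is that of `(G₀ - G) M₀ M`. The diagonals of
`G` and `G₀` agree, so only off-diagonal entries of `M₀ M` count, and these are at most `2 μ + 2 μ
(1 + 2 k μ) ≤ 5 μ`. The factor `μ` is what makes the term in `lam²` harmless. -/
lemma sum_diag_sub_le (hM : IsBlockInverse G S μ M) (hM₀ : IsBlockInverse G₀ S μ M₀)
    (hG : Gᵀ = G) (hd : ∀ i, G i i = G₀ i i) (hμ : 0 ≤ μ) (hS : S.card ≤ k)
    (hk : k * μ ≤ 1 / 4) :
    ∑ j ∈ S, (M - M₀) j j ≤ 5 * μ * ∑ i ∈ S, ∑ j ∈ S, |G i j - G₀ i j| := by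
  have h0 : ∑ j ∈ S, (M - M₀) j j = Matrix.trace (M - M₀) := by
    rw [Matrix.trace]
    refine Finset.sum_subset (Finset.subset_univ S) fun i _ hi => ?_
    rw [Matrix.sub_apply, hM.eq_zero i hi, hM₀.eq_zero i hi, sub_zero]
  have hz : ∀ i j, i ∉ S ∨ j ∉ S → (M₀ * M) i j = 0 := by
    rintro i j (h | h)
    · rw [Matrix.mul_apply]
      exact Finset.sum_eq_zero fun r _ => by rw [hM₀.eq_zero i h r, zero_mul]
    · rw [Matrix.mul_apply]
      exact Finset.sum_eq_zero fun r _ => by rw [hM.eq_zero_right r j h, mul_zero]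
  have hb : ∀ i ∈ S, ∀ j ∈ S, i ≠ j → |(M₀ * M) i j| ≤ 5 * μ := by
    intro i hi j hj hij
    have h1 : (M₀ * M) i j = (M₀ *ᵥ fun l => M l j) i := by
      simp [Matrix.mul_apply, dotProduct, Matrix.mulVec]
    have h2 := hM₀.abs_mulVec_sub_le (fun l => M l j) hi
    have h3 := hM.sum_abs_col_le hμ hS hj
    have h4 := hM.abs_sub_le i hi j hj
    rw [if_neg hij, sub_zero] at h4
    have h5 := abs_add_le (M i j) ((M₀ * M) i j - M i j)
    rw [add_sub_cancel] at h5
    rw [← h1] at h2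
    nlinarith
  rw [h0, hM.sub_eq hM₀ hG, mul_assoc, Matrix.trace_mul_comm, mul_assoc, Matrix.trace,
    Finset.mul_sum]
  have h6 : ∀ i, ((G₀ - G) * (M₀ * M)).diag i
      ≤ if i ∈ S then 5 * μ * ∑ j ∈ S, |G i j - G₀ i j| else 0 := by
    intro i
    rw [Matrix.diag_apply, Matrix.mul_apply]
    by_cases hi : i ∈ S
    · rw [if_pos hi, Finset.mul_sum]
      calc ∑ j, (G₀ - G) i j * (M₀ * M) j i
          ≤ ∑ j, if j ∈ S then 5 * μ * |G i j - G₀ i j| else 0 := Finset.sum_le_sum fun j _ => by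
            by_cases hj : j ∈ S
            · rw [if_pos hj]
              by_cases hij : j = i
              · subst hij; simp [hd]
              · refine (le_abs_self _).trans ?_
                rw [abs_mul, mul_comm, Matrix.sub_apply, abs_sub_comm]
                exact mul_le_mul_of_nonneg_right (hb j hj i hi hij) (abs_nonneg _)
            · rw [hz j i (Or.inl hj), if_neg hj, mul_zero]
        _ = _ := by rw [Finset.sum_ite_mem]; simp
    · rw [if_neg hi]
      exact (Finset.sum_eq_zero fun j _ => by rw [hz j i (Or.inr hi), mul_zero]).le
  refine (Finset.sum_le_sum fun i _ => h6 i).trans (le_of_eq ?_)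
  rw [Finset.sum_ite_mem]; simp

end IsBlockInverse

/-- The conditional mean, given the support `S`, of `gapForm`, for coefficients with second moment
`e₂` and first absolute moment `e₁`. -/
noncomputable def gapMean (D D₀ : Matrix (Fin m) (Fin p) ℝ) (M M₀ : Matrix (Fin p) (Fin p) ℝ)
    (lam e₁ e₂ : ℝ) (S : Finset (Fin p)) : ℝ :=
  e₂ * ∑ j ∈ S, ((1 / 2 : ℝ) • ((D - D₀)ᵀ * (D - D₀)
      - (Dᵀ * (D - D₀))ᵀ * (M * (Dᵀ * (D - D₀))))) j j
    + e₁ * ∑ j ∈ S, ((-lam) • (M * (Dᵀ * (D - D₀)))) j j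
    + 1 * ∑ j ∈ S, ((-((1 / 2) * lam ^ 2)) • (M - M₀)) j j

/-- Each trace is compared with its value at `M` = identity on `S`. The unit columns turn the
diagonal of `Dᵀ (D - D₀)` into half the squared displacement. -/
lemma le_gapMean (hD : D ∈ dictionaries m p) (hD₀ : D₀ ∈ dictionaries m p)
    (hM : IsBlockInverse (Dᵀ * D) S μ M) (hM₀ : IsBlockInverse (D₀ᵀ * D₀) S μ M₀)
    (hμ : 0 ≤ μ) (hS : S.card ≤ k) (hk : k * μ ≤ 1 / 4) (hlam : 0 ≤ lam) {e₁ e₂ : ℝ}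
    (he₁ : 0 ≤ e₁) (he₂ : 0 ≤ e₂) :
    (1 / 2) * e₂ * (∑ j ∈ S, colSq (D - D₀) j
        - (1 + 2 * (k * μ)) * ∑ i ∈ S, ∑ j ∈ S, (Dᵀ * (D - D₀)) i j ^ 2)
      - lam * e₁ * ((1 / 2) * ∑ j ∈ S, colSq (D - D₀) j
        + 2 * μ * ∑ i ∈ S, ∑ j ∈ S, |(Dᵀ * (D - D₀)) i j|)
      - (1 / 2) * lam ^ 2 * (5 * μ * ∑ i ∈ S, ∑ j ∈ S, |(Dᵀ * D) i j - (D₀ᵀ * D₀) i j|)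
      ≤ gapMean D D₀ M M₀ lam e₁ e₂ S := by
  have h1 := hM.sum_diag_conj_le hμ hS (Dᵀ * (D - D₀))
  have h2 := hM.sum_diag_mul_le (Dᵀ * (D - D₀))
  have h3 := hM.sum_diag_sub_le hM₀ (by simp) (fun i => by
    rw [gram_apply_self hD, gram_apply_self hD₀]) hμ hS hk
  have h4 : ∑ j ∈ S, (Dᵀ * (D - D₀)) j j = (1 / 2) * ∑ j ∈ S, colSq (D - D₀) j := by
    rw [Finset.mul_sum]
    exact Finset.sum_congr rfl fun j _ => gram_sub_apply_self hD hD₀ j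
  have h5 : ∑ j ∈ S, ((D - D₀)ᵀ * (D - D₀)) j j = ∑ j ∈ S, colSq (D - D₀) j := by
    refine Finset.sum_congr rfl fun j _ => ?_
    rw [Matrix.mul_apply, colSq]
    exact Finset.sum_congr rfl fun i _ => by rw [Matrix.transpose_apply, sq]
  rw [h4] at h2
  simp only [gapMean, Matrix.smul_apply, smul_eq_mul, ← Finset.mul_sum]
  have h6 : ∑ j ∈ S, ((D - D₀)ᵀ * (D - D₀)
      - (Dᵀ * (D - D₀))ᵀ * (M * (Dᵀ * (D - D₀)))) j j
      = ∑ j ∈ S, colSq (D - D₀) j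
        - ∑ j ∈ S, ((Dᵀ * (D - D₀))ᵀ * (M * (Dᵀ * (D - D₀)))) j j := by
    rw [← h5, ← Finset.sum_sub_distrib]; rfl
  rw [h6]
  have k1 := mul_le_mul_of_nonneg_left h1 (by positivity : 0 ≤ (1 / 2) * e₂)
  have k2 := mul_le_mul_of_nonneg_left h2 (by positivity : 0 ≤ lam * e₁)
  have k3 := mul_le_mul_of_nonneg_left h3 (by positivity : 0 ≤ (1 / 2) * lam ^ 2)
  linarith

end Gap

/-! ### Averages over the support -/

section Support

variable {p k : ℕ} {J : PMF (Finset (Fin p))}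

lemma IsSupportLaw.sum_mul_sum (hJ : IsSupportLaw k J) (v : Fin p → ℝ) :
    ∑ S, (J S).toReal * ∑ j ∈ S, v j = (k : ℝ) / p * ∑ j, v j := by
  have h1 : ∀ S : Finset (Fin p), (J S).toReal * ∑ j ∈ S, v j
      = ∑ j, if j ∈ S then (J S).toReal * v j else 0 := by
    intro S
    rw [Finset.sum_ite_mem, Finset.mul_sum]; simp
  simp only [h1]
  rw [Finset.sum_comm, Finset.mul_sum]
  refine Finset.sum_congr rfl fun j _ => ?_
  rw [← hJ.inclusion j, Finset.sum_mul, Finset.sum_filter]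

/-- Pairs of distinct indices are included with probability `k (k - 1) / (p (p - 1)) ≤ (k/p)²`, as
`k ≤ p`; only the diagonal carries the larger weight `k/p`. -/
lemma IsSupportLaw.sum_mul_sum_sum_le (hJ : IsSupportLaw k J) (hkp : k ≤ p) (hp : 2 ≤ p)
    (hk : 1 ≤ k) {v : Fin p → Fin p → ℝ} (hv : ∀ i j, 0 ≤ v i j) :
    ∑ S, (J S).toReal * ∑ i ∈ S, ∑ j ∈ S, v i j
      ≤ (k : ℝ) / p * ∑ j, v j j + ((k : ℝ) / p) ^ 2 * ∑ i, ∑ j, v i j := by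
  have h1 : ∀ S : Finset (Fin p), (J S).toReal * ∑ i ∈ S, ∑ j ∈ S, v i j
      = ∑ i, ∑ j, if i ∈ S ∧ j ∈ S then (J S).toReal * v i j else 0 := by
    intro S
    have h2 : ∀ i, ∑ j, (if i ∈ S ∧ j ∈ S then (J S).toReal * v i j else 0)
        = if i ∈ S then (J S).toReal * ∑ j ∈ S, v i j else 0 := by
      intro i
      by_cases hi : i ∈ S
      · simp only [hi, true_and, if_true]
        rw [Finset.sum_ite_mem, Finset.mul_sum]; simp
      · simp [hi]
    simp only [h2]
    rw [Finset.sum_ite_mem, Finset.mul_sum]; simp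
  simp only [h1]
  rw [Finset.sum_comm]
  have h3 : ∀ i, ∑ S, ∑ j, (if i ∈ S ∧ j ∈ S then (J S).toReal * v i j else 0)
      = ∑ j, v i j * ∑ S with i ∈ S ∧ j ∈ S, (J S).toReal := by
    intro i
    rw [Finset.sum_comm]
    refine Finset.sum_congr rfl fun j _ => ?_
    rw [Finset.mul_sum, Finset.sum_filter]
    exact Finset.sum_congr rfl fun S _ => by split_ifs <;> ring
  simp only [h3]
  rw [Finset.mul_sum, Finset.mul_sum, ← Finset.sum_add_distrib]
  refine Finset.sum_le_sum fun i _ => ?_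
  have hp' : (2 : ℝ) ≤ p := by exact_mod_cast hp
  have hk' : (1 : ℝ) ≤ k := by exact_mod_cast hk
  have hkp' : (k : ℝ) ≤ p := by exact_mod_cast hkp
  have h4 : ∀ j, v i j * ∑ S with i ∈ S ∧ j ∈ S, (J S).toReal
      ≤ (if j = i then (k : ℝ) / p * v i i else 0) + ((k : ℝ) / p) ^ 2 * v i j := by
    intro j
    by_cases hij : j = i
    · subst hij
      rw [if_pos rfl]
      simp only [and_self]
      rw [hJ.inclusion j]
      have := mul_nonneg (sq_nonneg ((k : ℝ) / p)) (hv j j)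
      linarith
    · rw [if_neg hij, zero_add, hJ.inclusion_pair i j (Ne.symm hij), mul_comm]
      refine mul_le_mul_of_nonneg_right ?_ (hv i j)
      rw [div_pow, div_le_div_iff₀ (by nlinarith) (by positivity)]
      have : 0 ≤ (k : ℝ) * p * (p - k) := by
        have : 0 ≤ (p : ℝ) - k := by linarith
        positivity
      nlinarith
  refine (Finset.sum_le_sum fun j _ => h4 j).trans (le_of_eq ?_)
  rw [Finset.sum_add_distrib, Finset.sum_ite_eq', if_pos (Finset.mem_univ _), Finset.mul_sum]

end Support

section Norms

variable {m p k : ℕ} {D D₀ : Matrix (Fin m) (Fin p) ℝ} {μ : ℝ}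

/-! ### Norm bounds -/

lemma transpose_mulVec_sq_le {A : Matrix (Fin m) (Fin p) ℝ} {c : ℝ} (hc : 0 ≤ c)
    (h : ∀ w, (A *ᵥ w) ⬝ᵥ (A *ᵥ w) ≤ c * (w ⬝ᵥ w)) (v : Fin m → ℝ) :
    (Aᵀ *ᵥ v) ⬝ᵥ (Aᵀ *ᵥ v) ≤ c * (v ⬝ᵥ v) := by
  set x := Aᵀ *ᵥ v with hx
  have h1 : x ⬝ᵥ x = v ⬝ᵥ (A *ᵥ x) := by
    conv_lhs => rw [hx]
    rw [transpose_mulVec_dotProduct]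
  have h2 := dotProduct_sq_le v (A *ᵥ x)
  rw [← h1] at h2
  have h3 := mul_le_mul_of_nonneg_left (h x) (dotProduct_self_nonneg' v)
  rcases (dotProduct_self_nonneg' x).eq_or_lt with h0 | h0
  · rw [← h0]
    exact mul_nonneg hc (dotProduct_self_nonneg' v)
  · nlinarith

/-- Used in place of the spectral norm for the quadratic term: with weight `(k/p)²`, the factor `1 +
p μ` yields `(k/p) (k/p + k μ)`, which stays below `k/p` when `k/p ≤ ρ < 1` and `k μ` is small. A
factor `L²` need not. -/
lemma mulVec_sq_le_of_coherence (hD : D ∈ dictionaries m p) (hμ : 0 ≤ μ)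
    (hoff : ∀ i j, i ≠ j → |(Dᵀ * D) i j| ≤ μ) (w : Fin p → ℝ) :
    (D *ᵥ w) ⬝ᵥ (D *ᵥ w) ≤ (1 + p * μ) * (w ⬝ᵥ w) := by
  rw [mulVec_dotProduct_mulVec]
  have h1 : ∀ i, w i * ((Dᵀ * D) *ᵥ w) i ≤ w i * w i + μ * (|w i| * ∑ j, |w j|) := by
    intro i
    have h0 : w i * w i = ∑ j, if j = i then w i * w i else 0 := by simp
    rw [Matrix.mulVec, dotProduct, Finset.mul_sum, Finset.mul_sum, Finset.mul_sum, h0,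
      ← Finset.sum_add_distrib]
    refine Finset.sum_le_sum fun j _ => ?_
    by_cases hij : j = i
    · subst hij
      rw [if_pos rfl, gram_apply_self hD, one_mul]
      have : 0 ≤ μ * (|w j| * |w j|) := by positivity
      linarith
    · rw [if_neg hij, zero_add]
      refine (le_abs_self _).trans ?_
      rw [abs_mul, abs_mul]
      have := mul_le_mul_of_nonneg_right (hoff i j (Ne.symm hij))
        (by positivity : 0 ≤ |w i| * |w j|)
      linarith
  have h2 := Finset.sum_le_sum fun i (_ : i ∈ Finset.univ) => h1 i
  rw [Finset.sum_add_distrib, ← Finset.mul_sum, ← Finset.sum_mul] at h2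
  have h3 := IsBlockInverse.sq_sum_abs_le (S := (Finset.univ : Finset (Fin p))) (k := p)
    (by simp) w
  have h4 : ∑ i, w i ^ 2 = w ⬝ᵥ w := by simp [dotProduct, sq]
  rw [h4] at h3
  have h5 := mul_le_mul_of_nonneg_left h3 hμ
  change w ⬝ᵥ ((Dᵀ * D) *ᵥ w) ≤ w ⬝ᵥ w + _ at h2
  linarith

lemma mulVec_sq_le_spectralNorm (A : Matrix (Fin m) (Fin p) ℝ) (w : Fin p → ℝ) :
    (A *ᵥ w) ⬝ᵥ (A *ᵥ w) ≤ SparseCoding.spectralNorm A ^ 2 * (w ⬝ᵥ w) := by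
  have h := (LinearMap.toContinuousLinearMap (Matrix.toEuclideanLin A)).le_opNorm (WithLp.toLp 2 w)
  have h2 := pow_le_pow_left₀ (norm_nonneg _) h 2
  rw [mul_pow, EuclideanSpace.norm_sq_eq, EuclideanSpace.norm_sq_eq] at h2
  simpa [SparseCoding.spectralNorm, dotProduct, sq] using h2

lemma one_le_spectralNorm (hD : D ∈ dictionaries m p) (hp : 0 < p) :
    1 ≤ SparseCoding.spectralNorm D := by
  have h := mulVec_sq_le_spectralNorm D (Pi.single ⟨0, hp⟩ 1)
  have h1 : (D *ᵥ Pi.single ⟨0, hp⟩ 1) ⬝ᵥ (D *ᵥ Pi.single ⟨0, hp⟩ 1) = 1 := by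
    rw [Matrix.mulVec_single_one]
    refine Eq.trans ?_ (hD ⟨0, hp⟩)
    exact Finset.sum_congr rfl fun i _ => by rw [sq]; rfl
  have h0 : 0 ≤ SparseCoding.spectralNorm D := norm_nonneg _
  rw [h1, single_dotProduct, Pi.single_eq_same] at h
  nlinarith

lemma sum_colSq (A : Matrix (Fin m) (Fin p) ℝ) : ∑ j, colSq A j = frobNorm A ^ 2 := by
  have h : 0 ≤ ∑ i, ∑ j, A i j ^ 2 :=
    Finset.sum_nonneg fun _ _ => Finset.sum_nonneg fun _ _ => sq_nonneg _
  rw [frobNorm, Real.sq_sqrt h, Finset.sum_comm]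
  rfl

lemma frobNorm_sub_comm (A B : Matrix (Fin m) (Fin p) ℝ) : frobNorm (A - B) = frobNorm (B - A) := by
  unfold frobNorm
  congr 1
  exact Finset.sum_congr rfl fun i _ => Finset.sum_congr rfl fun j _ => by
    rw [Matrix.sub_apply, Matrix.sub_apply]; ring

lemma mulVec_sq_le_frobNorm (A : Matrix (Fin m) (Fin p) ℝ) (w : Fin p → ℝ) :
    (A *ᵥ w) ⬝ᵥ (A *ᵥ w) ≤ frobNorm A ^ 2 * (w ⬝ᵥ w) := by
  rw [← sum_colSq]
  simp only [colSq]
  rw [Finset.sum_comm, Finset.sum_mul]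
  refine Finset.sum_le_sum fun i _ => ?_
  have := dotProduct_sq_le (A i) w
  rw [← sq]
  refine this.trans (le_of_eq ?_)
  simp [dotProduct, sq]

lemma sum_sq_transpose_mul_le {A B : Matrix (Fin m) (Fin p) ℝ} {c : ℝ} (hc : 0 ≤ c)
    (h : ∀ w, (A *ᵥ w) ⬝ᵥ (A *ᵥ w) ≤ c * (w ⬝ᵥ w)) :
    ∑ i, ∑ j, (Aᵀ * B) i j ^ 2 ≤ c * frobNorm B ^ 2 := by
  rw [Finset.sum_comm, ← sum_colSq, Finset.mul_sum]
  refine Finset.sum_le_sum fun j _ => ?_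
  have h1 := transpose_mulVec_sq_le hc h (fun i => B i j)
  have h2 : ∀ i, (Aᵀ * B) i j = (Aᵀ *ᵥ fun i => B i j) i := fun i => by
    simp [Matrix.mul_apply, dotProduct, Matrix.mulVec]
  simp only [h2]
  simpa [dotProduct, sq, colSq] using h1

lemma sum_abs_transpose_mul_le {A B : Matrix (Fin m) (Fin p) ℝ} {c : ℝ} (hc : 0 ≤ c)
    (h : ∀ w, (A *ᵥ w) ⬝ᵥ (A *ᵥ w) ≤ c ^ 2 * (w ⬝ᵥ w)) :
    ∑ i, ∑ j, |(Aᵀ * B) i j| ≤ p * (c * frobNorm B) := by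
  have h1 := sum_sq_transpose_mul_le (B := B) (sq_nonneg c) h
  have hf : 0 ≤ frobNorm B := Real.sqrt_nonneg _
  rw [← Finset.sum_product'] at h1 ⊢
  have h2 := sq_sum_le_card_mul_sum_sq (s := (Finset.univ ×ˢ Finset.univ : Finset (Fin p × Fin p)))
    (f := fun q => |(Aᵀ * B) q.1 q.2|)
  simp only [sq_abs, Finset.card_product, Finset.card_univ, Fintype.card_fin] at h2
  refine abs_le_of_sq_le_sq' ?_ (by positivity) |>.2
  refine h2.trans ?_
  push_cast
  nlinarith [mul_le_mul_of_nonneg_left h1 (by positivity : (0 : ℝ) ≤ p * p)]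

lemma mulVec_sq_le_two_mul {L t : ℝ}
    (hL : ∀ w, (D₀ *ᵥ w) ⬝ᵥ (D₀ *ᵥ w) ≤ L ^ 2 * (w ⬝ᵥ w)) (ht : frobNorm (D - D₀) = t)
    (ht0 : 0 ≤ t) (htL : t ≤ L) (w : Fin p → ℝ) :
    (D *ᵥ w) ⬝ᵥ (D *ᵥ w) ≤ (2 * L) ^ 2 * (w ⬝ᵥ w) := by
  have h1 := mulVec_sq_le_frobNorm (D - D₀) w
  rw [ht] at h1
  have h2 : D *ᵥ w = D₀ *ᵥ w + (D - D₀) *ᵥ w := by rw [Matrix.sub_mulVec]; abel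
  have h3 : (D *ᵥ w) ⬝ᵥ (D *ᵥ w)
      ≤ 2 * ((D₀ *ᵥ w) ⬝ᵥ (D₀ *ᵥ w)) + 2 * (((D - D₀) *ᵥ w) ⬝ᵥ ((D - D₀) *ᵥ w)) := by
    have := dotProduct_self_nonneg' (D₀ *ᵥ w - (D - D₀) *ᵥ w)
    simp only [sub_dotProduct, dotProduct_sub] at this
    rw [h2]
    simp only [add_dotProduct, dotProduct_add]
    linarith
  have h4 : t ^ 2 * (w ⬝ᵥ w) ≤ L ^ 2 * (w ⬝ᵥ w) :=
    mul_le_mul_of_nonneg_right (by gcongr) (dotProduct_self_nonneg' w)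
  linarith [hL w]

lemma gram_sub_gram (D D₀ : Matrix (Fin m) (Fin p) ℝ) (i j : Fin p) :
    (Dᵀ * D) i j - (D₀ᵀ * D₀) i j = (Dᵀ * (D - D₀)) i j + (D₀ᵀ * (D - D₀)) j i := by
  simp only [Matrix.mul_apply, Matrix.transpose_apply, Matrix.sub_apply,
    ← Finset.sum_sub_distrib, ← Finset.sum_add_distrib]
  exact Finset.sum_congr rfl fun r _ => by ring

lemma abs_transpose_mul_le (hD : D ∈ dictionaries m p) (B : Matrix (Fin m) (Fin p) ℝ)
    (i j : Fin p) : |(Dᵀ * B) i j| ≤ frobNorm B := by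
  have h1 : (Dᵀ * B) i j = (Dᵀ *ᵥ fun r => B r j) i := by
    simp [Matrix.mul_apply, dotProduct, Matrix.mulVec]
  rw [h1]
  refine abs_le_of_sq_le_sq ((sq_transpose_mulVec_le hD _ i).trans ?_) (Real.sqrt_nonneg _)
  rw [← sum_colSq]
  refine le_trans (le_of_eq ?_)
    (Finset.single_le_sum (fun j _ => colSq_nonneg B j) (Finset.mem_univ j))
  simp [dotProduct, colSq, sq]

/-- Gives every dictionary on the sphere of radius `t` the common coherence bound `μ₀ + 2 t`, the
`μ` of all later estimates. -/
lemma abs_gram_le (hD : D ∈ dictionaries m p) (hD₀ : D₀ ∈ dictionaries m p) {μ₀ : ℝ}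
    (h₀ : ∀ i j, i ≠ j → |(D₀ᵀ * D₀) i j| ≤ μ₀) (i j : Fin p) (hij : i ≠ j) :
    |(Dᵀ * D) i j| ≤ μ₀ + 2 * frobNorm (D - D₀) := by
  have h1 := gram_sub_gram D D₀ i j
  have h2 := abs_transpose_mul_le hD (D - D₀) i j
  have h3 := abs_transpose_mul_le hD₀ (D - D₀) j i
  have h4 : (Dᵀ * D) i j = (D₀ᵀ * D₀) i j + ((Dᵀ * (D - D₀)) i j + (D₀ᵀ * (D - D₀)) j i) := by
    linarith
  rw [h4]
  have h5 := abs_add_le ((D₀ᵀ * D₀) i j) ((Dᵀ * (D - D₀)) i j + (D₀ᵀ * (D - D₀)) j i)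
  have h6 := abs_add_le ((Dᵀ * (D - D₀)) i j) ((D₀ᵀ * (D - D₀)) j i)
  linarith [h₀ i j hij]

lemma abs_gram_le_coherence (D : Matrix (Fin m) (Fin p) ℝ) (i j : Fin p) (hij : i ≠ j) :
    |(Dᵀ * D) i j| ≤ coherence D := by
  unfold coherence
  exact le_ciSup (f := fun q : {q : Fin p × Fin p // q.1 ≠ q.2} => |(Dᵀ * D) q.1.1 q.1.2|)
    (Set.finite_range _).bddAbove ⟨(i, j), hij⟩

lemma coherence_nonneg (D : Matrix (Fin m) (Fin p) ℝ) : 0 ≤ coherence D :=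
  Real.iSup_nonneg fun _ => abs_nonneg _

/-! ### The mean of the lower bound -/

/-- Averaging weights the diagonal of each double sum by `k/p` and bounds the rest with weight
`(k/p)²`. The diagonals are at most `t⁴/4`, `t²/2` and 0. The squared entries are summed through `1
+ p μ`; the sums of absolute values use Cauchy-Schwarz over `p²` entries and the spectral bound `L`,
doubled for `D`. -/
lemma le_sum_gapMean (hD : D ∈ dictionaries m p) (hD₀ : D₀ ∈ dictionaries m p)
    {J : PMF (Finset (Fin p))} (hJ : IsSupportLaw k J) (hkp : k ≤ p) (hp : 2 ≤ p) (hk1 : 1 ≤ k)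
    {M M₀ : Finset (Fin p) → Matrix (Fin p) (Fin p) ℝ}
    (hM : ∀ S, S.card = k → IsBlockInverse (Dᵀ * D) S μ (M S))
    (hM₀ : ∀ S, S.card = k → IsBlockInverse (D₀ᵀ * D₀) S μ (M₀ S))
    (hμ : 0 ≤ μ) (hk : k * μ ≤ 1 / 4) (hoff : ∀ i j, i ≠ j → |(Dᵀ * D) i j| ≤ μ)
    {L t lam e₁ e₂ : ℝ} (hL : ∀ w, (D₀ *ᵥ w) ⬝ᵥ (D₀ *ᵥ w) ≤ L ^ 2 * (w ⬝ᵥ w))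
    (ht : frobNorm (D - D₀) = t) (ht0 : 0 ≤ t) (htL : t ≤ L) (hlam : 0 ≤ lam)
    (he₁ : 0 ≤ e₁) (he₂ : 0 ≤ e₂) :
    (1 / 2) * e₂ * ((k : ℝ) / p * t ^ 2 - (1 + 2 * (k * μ)) * ((k : ℝ) / p * ((1 / 4) * t ^ 4)
          + ((k : ℝ) / p) ^ 2 * ((1 + p * μ) * t ^ 2)))
      - lam * e₁ * ((1 / 2) * ((k : ℝ) / p * t ^ 2)
        + 2 * μ * ((k : ℝ) / p * ((1 / 2) * t ^ 2) + ((k : ℝ) / p) ^ 2 * (p * (2 * L * t))))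
      - (1 / 2) * lam ^ 2 * (5 * μ * (((k : ℝ) / p) ^ 2 * (3 * (p * (L * t)))))
      ≤ ∑ S, (J S).toReal * gapMean D D₀ (M S) (M₀ S) lam e₁ e₂ S := by
  have hL0 : 0 ≤ L := ht0.trans htL
  have h2L := mulVec_sq_le_two_mul hL ht ht0 htL
  have hdiag : ∀ j, (Dᵀ * (D - D₀)) j j = (1 / 2) * colSq (D - D₀) j :=
    gram_sub_apply_self hD hD₀
  have hT : ∑ j, colSq (D - D₀) j = t ^ 2 := by rw [sum_colSq, ht]
  have hle : ∀ S, (J S).toReal * ((1 / 2) * e₂ * (∑ j ∈ S, colSq (D - D₀) j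
        - (1 + 2 * (k * μ)) * ∑ i ∈ S, ∑ j ∈ S, (Dᵀ * (D - D₀)) i j ^ 2)
      - lam * e₁ * ((1 / 2) * ∑ j ∈ S, colSq (D - D₀) j
        + 2 * μ * ∑ i ∈ S, ∑ j ∈ S, |(Dᵀ * (D - D₀)) i j|)
      - (1 / 2) * lam ^ 2 * (5 * μ * ∑ i ∈ S, ∑ j ∈ S, |(Dᵀ * D) i j - (D₀ᵀ * D₀) i j|))
      ≤ (J S).toReal * gapMean D D₀ (M S) (M₀ S) lam e₁ e₂ S := by
    intro S
    by_cases hS : S ∈ J.support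
    · have hc := hJ.card_eq S hS
      exact mul_le_mul_of_nonneg_left (le_gapMean hD hD₀ (hM S hc) (hM₀ S hc) hμ hc.le hk hlam
        he₁ he₂) ENNReal.toReal_nonneg
    · have : J S = 0 := by rwa [PMF.mem_support_iff, not_not] at hS
      simp [this]
  refine le_trans ?_ (Finset.sum_le_sum fun S _ => hle S)
  have hsplit : ∀ S, (J S).toReal * ((1 / 2) * e₂ * (∑ j ∈ S, colSq (D - D₀) j
        - (1 + 2 * (k * μ)) * ∑ i ∈ S, ∑ j ∈ S, (Dᵀ * (D - D₀)) i j ^ 2)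
      - lam * e₁ * ((1 / 2) * ∑ j ∈ S, colSq (D - D₀) j
        + 2 * μ * ∑ i ∈ S, ∑ j ∈ S, |(Dᵀ * (D - D₀)) i j|)
      - (1 / 2) * lam ^ 2 * (5 * μ * ∑ i ∈ S, ∑ j ∈ S, |(Dᵀ * D) i j - (D₀ᵀ * D₀) i j|))
      = ((1 / 2) * e₂ - (1 / 2) * (lam * e₁)) * ((J S).toReal * ∑ j ∈ S, colSq (D - D₀) j)
      - (1 / 2) * e₂ * (1 + 2 * (k * μ)) *
        ((J S).toReal * ∑ i ∈ S, ∑ j ∈ S, (Dᵀ * (D - D₀)) i j ^ 2)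
      - lam * e₁ * (2 * μ) * ((J S).toReal * ∑ i ∈ S, ∑ j ∈ S, |(Dᵀ * (D - D₀)) i j|)
      - (1 / 2) * lam ^ 2 * (5 * μ) *
        ((J S).toReal * ∑ i ∈ S, ∑ j ∈ S, |(Dᵀ * D) i j - (D₀ᵀ * D₀) i j|) := fun S => by ring
  simp only [hsplit]
  rw [Finset.sum_sub_distrib, Finset.sum_sub_distrib, Finset.sum_sub_distrib, ← Finset.mul_sum,
    ← Finset.mul_sum, ← Finset.mul_sum, ← Finset.mul_sum, hJ.sum_mul_sum, hT]
  have a1 := hJ.sum_mul_sum_sum_le hkp hp hk1 (v := fun i j => (Dᵀ * (D - D₀)) i j ^ 2)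
    fun _ _ => sq_nonneg _
  have a2 := hJ.sum_mul_sum_sum_le hkp hp hk1 (v := fun i j => |(Dᵀ * (D - D₀)) i j|)
    fun _ _ => abs_nonneg _
  have a3 := hJ.sum_mul_sum_sum_le hkp hp hk1
    (v := fun i j => |(Dᵀ * D) i j - (D₀ᵀ * D₀) i j|) fun _ _ => abs_nonneg _
  have r0 : 0 ≤ (k : ℝ) / p := by positivity
  have b1 : ∑ j, (Dᵀ * (D - D₀)) j j ^ 2 ≤ (1 / 4) * t ^ 4 := by
    simp only [hdiag, mul_pow]
    rw [← Finset.mul_sum]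
    have := Finset.sum_sq_le_sq_sum_of_nonneg (s := Finset.univ)
      (f := colSq (D - D₀)) fun j _ => colSq_nonneg _ j
    rw [hT] at this
    linarith
  have b2 : ∑ j, |(Dᵀ * (D - D₀)) j j| = (1 / 2) * t ^ 2 := by
    rw [← hT, Finset.mul_sum]
    refine Finset.sum_congr rfl fun j _ => ?_
    rw [hdiag, abs_of_nonneg (by have := colSq_nonneg (D - D₀) j; positivity)]
  have b3 : ∑ j, |(Dᵀ * D) j j - (D₀ᵀ * D₀) j j| = 0 :=
    Finset.sum_eq_zero fun j _ => by
      rw [gram_apply_self hD, gram_apply_self hD₀, sub_self, abs_zero]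
  have c1 : ∑ i, ∑ j, (Dᵀ * (D - D₀)) i j ^ 2 ≤ (1 + p * μ) * t ^ 2 := by
    rw [← ht]
    exact sum_sq_transpose_mul_le (by positivity) (mulVec_sq_le_of_coherence hD hμ hoff)
  have c2 : ∑ i, ∑ j, |(Dᵀ * (D - D₀)) i j| ≤ p * (2 * L * t) := by
    rw [← ht]
    exact sum_abs_transpose_mul_le (by positivity) h2L
  have c2' : ∑ i, ∑ j, |(D₀ᵀ * (D - D₀)) i j| ≤ p * (L * t) := by
    rw [← ht]
    exact sum_abs_transpose_mul_le hL0 hL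
  have c3 : ∑ i, ∑ j, |(Dᵀ * D) i j - (D₀ᵀ * D₀) i j| ≤ 3 * (p * (L * t)) := by
    have : ∑ i, ∑ j, |(Dᵀ * D) i j - (D₀ᵀ * D₀) i j|
        ≤ ∑ i, ∑ j, (|(Dᵀ * (D - D₀)) i j| + |(D₀ᵀ * (D - D₀)) j i|) :=
      Finset.sum_le_sum fun i _ => Finset.sum_le_sum fun j _ => by
        rw [gram_sub_gram]; exact abs_add_le _ _
    simp only [Finset.sum_add_distrib] at this
    rw [Finset.sum_comm (f := fun i j => |(D₀ᵀ * (D - D₀)) j i|)] at this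
    linarith
  have d1 := a1.trans (add_le_add (mul_le_mul_of_nonneg_left b1 r0)
    (mul_le_mul_of_nonneg_left c1 (sq_nonneg _)))
  have d2 := a2.trans (add_le_add (mul_le_mul_of_nonneg_left b2.le r0)
    (mul_le_mul_of_nonneg_left c2 (sq_nonneg _)))
  have d3 := a3.trans (add_le_add (mul_le_mul_of_nonneg_left b3.le r0)
    (mul_le_mul_of_nonneg_left c3 (sq_nonneg _)))
  have f1 := mul_le_mul_of_nonneg_left d1 (by positivity : 0 ≤ (1 / 2) * e₂ * (1 + 2 * (k * μ)))
  have f2 := mul_le_mul_of_nonneg_left d2 (by positivity : 0 ≤ lam * e₁ * (2 * μ))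
  have f3 := mul_le_mul_of_nonneg_left d3 (by positivity : 0 ≤ (1 / 2) * lam ^ 2 * (5 * μ))
  linarith

/-- The mean of the lower bound is a fraction of `e₂ * (k / p) * t ^ 2`. -/
lemma le_mean_of_small {r κ B L t x e₁ e₂ ρ b a : ℝ} {p k μ : ℝ} (hp : 0 < p) (hr : r = k / p)
    (hκ : κ = k * μ) (hB : B = k * L * μ) (hk : 0 ≤ k) (hμ : 0 ≤ μ)
    (hrρ : r ≤ ρ) (hρ0 : 0 < ρ) (hρ1 : ρ < 1) (hκb : κ ≤ b) (hμb : μ ≤ 1 / 2) (ht0 : 0 ≤ t)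
    (htb : t ^ 2 ≤ b) (hx0 : 0 ≤ x) (hxa : x ≤ a * e₁) (he₁ : 0 ≤ e₁)
    (he : e₁ ^ 2 ≤ e₂) (hxB : x * e₁ * B ≤ b * e₂ * t) (ha0 : 0 ≤ a) (ha : a ≤ (1 - ρ) / 200)
    (hb0 : 0 ≤ b) (hb : b ≤ (1 - ρ) / 200) :
    (1 - ρ) / 4 * (e₂ * r * t ^ 2) ≤
    (1 / 2) * e₂ * (r * t ^ 2 - (1 + 2 * κ) * (r * ((1 / 4) * t ^ 4)
          + r ^ 2 * ((1 + p * μ) * t ^ 2)))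
      - (2 * x) * e₁ * ((1 / 2) * (r * t ^ 2)
        + 2 * μ * (r * ((1 / 2) * t ^ 2) + r ^ 2 * (p * (2 * L * t))))
      - (1 / 2) * (2 * x) ^ 2 * (5 * μ * (r ^ 2 * (3 * (p * (L * t))))) := by
  have hr0 : 0 ≤ r := by rw [hr]; positivity
  have hrp : r * p = k := by rw [hr]; field_simp
  have he₂ : 0 ≤ e₂ := (sq_nonneg _).trans he
  have hκ0 : 0 ≤ κ := by rw [hκ]; positivity
  set θ := e₂ * r * t ^ 2 with hθ
  have hθ0 : 0 ≤ θ := by positivity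
  -- the quadratic term
  have q1 : (1 + 2 * κ) * ((1 / 4) * t ^ 2 + r + κ) ≤ ρ + 6 * b := by
    have h1 : (1 / 4) * t ^ 2 + r + κ ≤ ρ + 2 * b := by linarith
    have h2 : (1 + 2 * κ) * ((1 / 4) * t ^ 2 + r + κ) ≤ (1 + 2 * b) * (ρ + 2 * b) :=
      mul_le_mul (by linarith) h1 (by positivity) (by linarith)
    nlinarith
  have e1 : (1 / 2) * e₂ * (r * t ^ 2 - (1 + 2 * κ) * (r * ((1 / 4) * t ^ 4)
          + r ^ 2 * ((1 + p * μ) * t ^ 2)))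
      = (1 / 2) * θ * (1 - (1 + 2 * κ) * ((1 / 4) * t ^ 2 + r + κ)) := by
    have : r ^ 2 * ((1 + p * μ) * t ^ 2) = r * (r + κ) * t ^ 2 := by
      rw [hκ, ← hrp]; ring
    rw [this, hθ]; ring
  have g1 : (1 / 2) * θ * (1 - (ρ + 6 * b))
      ≤ (1 / 2) * θ * (1 - (1 + 2 * κ) * ((1 / 4) * t ^ 2 + r + κ)) :=
    mul_le_mul_of_nonneg_left (by linarith) (by positivity)
  -- the bilinear term
  have e2' : (2 * x) * e₁ * ((1 / 2) * (r * t ^ 2)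
        + 2 * μ * (r * ((1 / 2) * t ^ 2) + r ^ 2 * (p * (2 * L * t))))
      = x * e₁ * (r * t ^ 2) * (1 + 2 * μ) + 8 * (x * e₁ * B) * (r * t) := by
    have : r ^ 2 * (p * (2 * L * t)) = r * (2 * (k * L) * t) := by rw [← hrp]; ring
    rw [this, hB]; ring
  have hxe : x * e₁ ≤ a * e₂ := by nlinarith
  have g2 : x * e₁ * (r * t ^ 2) * (1 + 2 * μ) ≤ 2 * a * θ := by
    have h1 : x * e₁ * (r * t ^ 2) ≤ a * e₂ * (r * t ^ 2) :=
      mul_le_mul_of_nonneg_right hxe (by positivity)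
    have h2 : x * e₁ * (r * t ^ 2) * (1 + 2 * μ) ≤ a * e₂ * (r * t ^ 2) * 2 :=
      mul_le_mul h1 (by linarith) (by positivity) (by positivity)
    rw [hθ]; linarith
  have g3 : 8 * (x * e₁ * B) * (r * t) ≤ 8 * b * θ := by
    have := mul_le_mul_of_nonneg_right hxB (by positivity : 0 ≤ r * t)
    rw [hθ]; linarith
  -- the sign term
  have e3 : (1 / 2) * (2 * x) ^ 2 * (5 * μ * (r ^ 2 * (3 * (p * (L * t)))))
      = 30 * (x * (x * B)) * (r * t) := by
    have : r ^ 2 * (3 * (p * (L * t))) = 3 * r * (k * L * t) := by rw [← hrp]; ring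
    rw [this, hB]; ring
  have g4 : 30 * (x * (x * B)) * (r * t) ≤ 30 * a * b * θ := by
    have hrt : 0 ≤ r * t := by positivity
    -- No sign is assumed for `L`, hence none for `B`.
    rcases le_total 0 (x * B) with h0 | h0
    · have h1 : x * (x * B) ≤ a * e₁ * (x * B) := mul_le_mul_of_nonneg_right hxa h0
      have h2 : a * e₁ * (x * B) ≤ a * (b * e₂ * t) := by
        have := mul_le_mul_of_nonneg_left hxB ha0
        linarith
      have := mul_le_mul_of_nonneg_right (h1.trans h2) hrt
      rw [hθ]; linarith
    · have h1 : x * (x * B) ≤ 0 := mul_nonpos_of_nonneg_of_nonpos hx0 h0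
      have h2 : x * (x * B) * (r * t) ≤ 0 := mul_nonpos_of_nonpos_of_nonneg h1 hrt
      have h3 : 0 ≤ a * b * θ := by positivity
      linarith
  rw [e1, e2', e3]
  -- With tolerances `(1 - ρ) / 200` the losses `3 b + 2 a + 8 b + 30 a b` are at most `43 (1 - ρ) /
  -- 200`. More than a quarter of `1 - ρ` survives from the initial half.
  have hab : a * b ≤ (1 - ρ) / 200 := by nlinarith
  have hfin : (1 - ρ) / 4 * θ ≤ ((1 / 2) * (1 - (ρ + 6 * b)) - 2 * a - 8 * b - 30 * (a * b)) * θ :=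
    mul_le_mul_of_nonneg_right (by linarith) hθ0
  linarith

end Norms

/-! ### Moments of a sub-Gaussian law -/

section Subgaussian

variable {ν : Measure ℝ} [IsProbabilityMeasure ν]

/-- From `1 + t 𝔼[α] ≤ 𝔼 exp (t α) ≤ exp (c t² / 2)`, the difference of the outer terms is
nonnegative and vanishes at `t = 0`, so its derivative there, `-𝔼[α]`, is zero. -/
lemma integral_id_eq_zero_of_subgaussian {c : ℝ≥0} (h : HasSubgaussianMGF id c ν) :
    ∫ a, a ∂ν = 0 := by
  set e := ∫ a, a ∂ν with he
  have hint : Integrable (fun a : ℝ => a) ν := h.integrable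
  have key : ∀ t : ℝ, 0 ≤ Real.exp (c * t ^ 2 / 2) - 1 - t * e := by
    intro t
    have h1 : ∫ a, (t * a + 1) ∂ν ≤ mgf id ν t :=
      integral_mono ((hint.const_mul t).add (integrable_const 1)) (h.integrable_exp_mul t)
        fun a => Real.add_one_le_exp _
    rw [integral_add (hint.const_mul t) (integrable_const 1), integral_const_mul] at h1
    have h2 := h.mgf_le t
    simp only [integral_const, probReal_univ, smul_eq_mul, mul_one] at h1
    linarith
  have hd : HasDerivAt (fun t : ℝ => Real.exp (c * t ^ 2 / 2) - 1 - t * e)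
      (Real.exp (c * 0 ^ 2 / 2) * (c * (2 * 0 ^ 1) / 2) - 1 * e) 0 := by
    refine ((HasDerivAt.exp ?_).sub_const 1).sub ((hasDerivAt_id 0).mul_const e)
    exact (((hasDerivAt_pow 2 (0 : ℝ)).const_mul (c : ℝ)).div_const 2)
  have hmin : IsLocalMin (fun t : ℝ => Real.exp (c * t ^ 2 / 2) - 1 - t * e) 0 :=
    Filter.Eventually.of_forall fun t => by simpa using key t
  have := hmin.hasDerivAt_eq_zero hd
  simp at this
  linarith

lemma one_add_sq_div_two_le_cosh (y : ℝ) : 1 + y ^ 2 / 2 ≤ Real.cosh y := by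
  have h1 : Real.cosh y = 1 + 2 * Real.sinh (y / 2) ^ 2 := by
    have h := Real.cosh_two_mul (y / 2)
    rw [Real.cosh_sq, mul_div_cancel₀ y two_ne_zero] at h
    linarith
  have h2 : (y / 2) ^ 2 ≤ Real.sinh (y / 2) ^ 2 := by
    rcases le_total 0 (y / 2) with h0 | h0
    · exact pow_le_pow_left₀ h0 (Real.self_le_sinh_iff.2 h0) 2
    · have := Real.sinh_le_self_iff.2 h0
      nlinarith
  rw [h1]; linarith

/-- Averaging the bounds at `t` and `-t` gives `1 + t² e / 2 ≤ 𝔼 cosh (t α) ≤ exp (c t² / 2)`;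
compare the coefficients of `t²`. Instead of a limit, if `e > c`, the explicit value `t² = (e - c) /
(1 + c e)` already contradicts this. -/
lemma secondMoment_le_of_subgaussian {c : ℝ≥0} (h : HasSubgaussianMGF id c ν)
    (h2 : Integrable (fun a : ℝ => a ^ 2) ν) : secondMoment ν ≤ c := by
  set e := secondMoment ν with he
  have he0 : 0 ≤ e := integral_nonneg fun a => sq_nonneg a
  have key : ∀ t : ℝ, 1 + t ^ 2 / 2 * e ≤ Real.exp (c * t ^ 2 / 2) := by
    intro t
    have i1 := h.integrable_exp_mul t
    have i2 := h.integrable_exp_mul (-t)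
    simp only [id] at i1 i2
    have h1 : ∫ a, (1 + t ^ 2 / 2 * a ^ 2) ∂ν
        ≤ ∫ a, (1 / 2 * Real.exp (t * a) + 1 / 2 * Real.exp (-t * a)) ∂ν := by
      refine integral_mono ((integrable_const 1).add (h2.const_mul _))
        ((i1.const_mul _).add (i2.const_mul _)) fun a => ?_
      have := one_add_sq_div_two_le_cosh (t * a)
      rw [Real.cosh_eq] at this
      simp only [neg_mul]
      linarith
    rw [integral_add (integrable_const 1) (h2.const_mul _), integral_const_mul,
      integral_add (i1.const_mul _) (i2.const_mul _), integral_const_mul, integral_const_mul] at h1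
    have h3 := h.mgf_le t
    have h4 := h.mgf_le (-t)
    simp only [mgf, id, neg_sq] at h3 h4
    simp only [integral_const, probReal_univ, smul_eq_mul, mul_one] at h1
    change 1 + t ^ 2 / 2 * e ≤ _ at h1
    linarith
  by_contra hlt
  push Not at hlt
  have hc : (0 : ℝ) ≤ c := c.2
  -- evaluate at a small argument
  set y : ℝ := (e - c) / (1 + c * e) with hy
  have hy0 : 0 < y := by
    have : 0 < e - c := by linarith
    positivity
  have hyy : y * (1 + c * e) = e - c := by rw [hy]; field_simp
  have h1 := key (Real.sqrt y)
  rw [Real.sq_sqrt hy0.le] at h1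
  have hcy : c * y / 2 < 1 := by
    by_contra hge
    push Not at hge
    nlinarith [mul_pos hy0 (lt_of_le_of_lt hc hlt)]
  have h3 := Real.add_one_le_exp (-(c * y / 2))
  have h4 : Real.exp (c * y / 2) * Real.exp (-(c * y / 2)) = 1 := by
    rw [← Real.exp_add]; simp
  have h5 : (1 + y / 2 * e) * (-(c * y / 2) + 1) ≤ 1 := by
    exact (mul_le_mul h1 h3 (by linarith) (Real.exp_pos _).le).trans_eq h4
  nlinarith

lemma secondMoment_le_sq_subGaussianParam (h : ∃ b : ℝ≥0, HasSubgaussianMGF id b ν)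
    (h2 : Integrable (fun a : ℝ => a ^ 2) ν) : secondMoment ν ≤ subGaussianParam ν ^ 2 := by
  obtain ⟨b, hb⟩ := h
  have h1 : (Real.sqrt (secondMoment ν)).toNNReal
      ≤ sInf {c : ℝ≥0 | HasSubgaussianMGF id (c ^ 2) ν} := by
    -- The set must be nonempty, since the infimum of the empty set is 0 in `ℝ≥0`.
    refine le_csInf ⟨NNReal.sqrt b, by simpa using hb⟩ fun c hc => ?_
    rw [Real.toNNReal_le_iff_le_coe]
    refine Real.sqrt_le_iff.2 ⟨c.2, ?_⟩
    simpa using secondMoment_le_of_subgaussian hc h2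
  have h3 : Real.sqrt (secondMoment ν) ≤ subGaussianParam ν := by
    rwa [Real.toNNReal_le_iff_le_coe] at h1
  exact (Real.sqrt_le_left ((Real.sqrt_nonneg _).trans h3)).1 h3

end Subgaussian

/-! ### Moments of bounded symmetric coefficients -/

section Moments

variable {ν : Measure ℝ} [IsProbabilityMeasure ν] {p : ℕ}

lemma measurable_realSign : Measurable Real.sign := by
  unfold Real.sign
  exact Measurable.ite measurableSet_Iio measurable_const
    (Measurable.ite measurableSet_Ioi measurable_const measurable_const)

lemma abs_realSign_le (x : ℝ) : |Real.sign x| ≤ 1 := by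
  rcases Real.sign_apply_eq x with h | h | h <;> simp [h]

lemma integral_realSign_eq_zero (h : ν (Set.Ioi 0) = ν (Set.Iio 0)) :
    ∫ a, Real.sign a ∂ν = 0 := by
  have h1 : Real.sign = fun x => (Set.Ioi (0 : ℝ)).indicator (fun _ => (1 : ℝ)) x
      - (Set.Iio (0 : ℝ)).indicator (fun _ => (1 : ℝ)) x := by
    ext x
    rcases lt_trichotomy x 0 with hx | hx | hx
    · simp [Real.sign_of_neg hx, hx, hx.le]
    · simp [hx]
    · simp [Real.sign_of_pos hx, hx, hx.le]
  rw [h1, integral_sub, integral_indicator_const _ measurableSet_Ioi,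
    integral_indicator_const _ measurableSet_Iio, Measure.real, Measure.real, h, sub_self]
  · exact (integrable_const 1).indicator measurableSet_Ioi
  · exact (integrable_const 1).indicator measurableSet_Iio

lemma realSign_mul_self_of_ne {x : ℝ} (h : x ≠ 0) : Real.sign x * Real.sign x = 1 := by
  rcases Real.sign_apply_eq_of_ne_zero x h with h | h <;> simp [h]

lemma realSign_mul_eq_abs (x : ℝ) : Real.sign x * x = |x| := by
  rcases lt_trichotomy x 0 with hx | hx | hx
  · rw [Real.sign_of_neg hx, abs_of_neg hx]; ring
  · simp [hx]
  · rw [Real.sign_of_pos hx, abs_of_pos hx]; ring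

/-- The law of the coefficients given the support `S`. -/
noncomputable abbrev condLaw (ν : Measure ℝ) (S : Finset (Fin p)) : Measure (Fin p → ℝ) :=
  Measure.pi fun j : Fin p => if j ∈ S then ν else Measure.dirac 0

instance instIsProbabilityMeasureIte (S : Finset (Fin p)) (j : Fin p) :
    IsProbabilityMeasure (if j ∈ S then ν else Measure.dirac 0) := by
  split_ifs <;> infer_instance

omit [IsProbabilityMeasure ν] in
lemma integrable_condLaw_marginal {f : ℝ → ℝ} (hf : Integrable f ν) (S : Finset (Fin p))
    (j : Fin p) : Integrable f (if j ∈ S then ν else Measure.dirac 0) := by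
  split_ifs
  · exact hf
  · exact integrable_dirac (by finiteness)

lemma integrable_condLaw_comp {f : ℝ → ℝ} (hf : Integrable f ν) (S : Finset (Fin p))
    (j : Fin p) : Integrable (fun a : Fin p → ℝ => f (a j)) (condLaw ν S) :=
  integrable_comp_eval (μ := fun j : Fin p => if j ∈ S then ν else Measure.dirac 0) (i := j)
    (integrable_condLaw_marginal hf S j)

lemma integral_condLaw_comp {f : ℝ → ℝ} (hf : Integrable f ν) (hf0 : f 0 = 0)
    (S : Finset (Fin p)) (j : Fin p) :
    ∫ a, f (a j) ∂(condLaw ν S) = if j ∈ S then ∫ x, f x ∂ν else 0 := by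
  rw [condLaw, integral_comp_eval (μ := fun j : Fin p => if j ∈ S then ν else Measure.dirac 0)
    (i := j) (integrable_condLaw_marginal hf S j).aestronglyMeasurable]
  split_ifs
  · rfl
  · rw [integral_dirac, hf0]

/-- Independence kills the off-diagonal terms as soon as `g` is centred; `h` need not be. Since `g 0
= 0`, indices outside `S` contribute nothing. -/
lemma integral_quadForm_condLaw {g h : ℝ → ℝ} (hgm : Measurable g) (hhm : Measurable h)
    (hg : Integrable g ν) (hh : Integrable h ν)
    (hgh : Integrable (fun x => g x * h x) ν) (hg0 : g 0 = 0)
    (hgi : ∫ x, g x ∂ν = 0) (A : Matrix (Fin p) (Fin p) ℝ) (S : Finset (Fin p)) :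
    Integrable (fun a : Fin p → ℝ => (fun j => g (a j)) ⬝ᵥ (A *ᵥ fun j => h (a j)))
        (condLaw ν S) ∧
      ∫ a, (fun j => g (a j)) ⬝ᵥ (A *ᵥ fun j => h (a j)) ∂(condLaw ν S)
        = (∫ x, g x * h x ∂ν) * ∑ j ∈ S, A j j := by
  have hexp : (fun a : Fin p → ℝ => (fun j => g (a j)) ⬝ᵥ (A *ᵥ fun j => h (a j)))
      = fun a => ∑ i, ∑ j, A i j * (g (a i) * h (a j)) := by
    ext a
    simp only [dotProduct, Matrix.mulVec, Finset.mul_sum]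
    exact Finset.sum_congr rfl fun i _ => Finset.sum_congr rfl fun j _ => by ring
  have hi : ∀ i j, Integrable (fun a : Fin p → ℝ => g (a i) * h (a j)) (condLaw ν S) ∧
      ∫ a, g (a i) * h (a j) ∂(condLaw ν S)
        = if j = i then (if i ∈ S then ∫ x, g x * h x ∂ν else 0) else 0 := by
    intro i j
    by_cases hij : j = i
    · subst hij
      rw [if_pos rfl]
      exact ⟨integrable_condLaw_comp hgh S j,
        integral_condLaw_comp hgh (by rw [hg0, zero_mul]) S j⟩
    · rw [if_neg hij]
      have hind : IndepFun (fun a : Fin p → ℝ => a i) (fun a => a j) (condLaw ν S) :=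
        (iIndepFun_pi (μ := fun j : Fin p => if j ∈ S then ν else Measure.dirac 0)
          (X := fun _ x => x) fun _ => aemeasurable_id).indepFun (Ne.symm hij)
      have hind' : IndepFun (fun a : Fin p → ℝ => g (a i)) (fun a => h (a j)) (condLaw ν S) :=
        hind.comp hgm hhm
      have g1 := integrable_condLaw_comp hg S i
      have h1 := integrable_condLaw_comp hh S j
      refine ⟨hind'.integrable_mul g1 h1, ?_⟩
      rw [hind'.integral_fun_mul_eq_mul_integral g1.aestronglyMeasurable h1.aestronglyMeasurable,
        integral_condLaw_comp hg hg0, hgi]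
      simp
  rw [hexp]
  refine ⟨integrable_finsetSum _ fun i _ => integrable_finsetSum _ fun j _ =>
    (hi i j).1.const_mul _, ?_⟩
  refine (integral_finsetSum _ fun i _ => integrable_finsetSum _ fun j _ =>
    (hi i j).1.const_mul _).trans ?_
  have : ∀ i, ∫ a, ∑ j, A i j * (g (a i) * h (a j)) ∂(condLaw ν S)
      = if i ∈ S then A i i * ∫ x, g x * h x ∂ν else 0 := by
    intro i
    refine (integral_finsetSum _ fun j _ => (hi i j).1.const_mul _).trans ?_
    simp only [integral_const_mul, (hi i _).2, mul_ite, mul_zero]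
    rw [Finset.sum_ite_eq' Finset.univ i, if_pos (Finset.mem_univ i)]
  simp only [this]
  rw [Finset.sum_ite_mem, Finset.univ_inter, Finset.mul_sum]
  exact Finset.sum_congr rfl fun i _ => by ring

variable {m k : ℕ} {D D₀ : Matrix (Fin m) (Fin p) ℝ} {lo hi : ℝ}

/-- The three forms pair `(α, α)`, `(sign α, α)` and `(sign α, sign α)`, with moments `𝔼[α²]`,
`𝔼[|α|]` and 1, the last because `α ≠ 0` almost surely. -/
lemma integral_gapForm (hsub : ∃ b : ℝ≥0, HasSubgaussianMGF id b ν) (hlo : 0 < lo)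
    (hνlo : ∀ᵐ a ∂ν, lo ≤ |a|) (hνhi : ∀ᵐ a ∂ν, |a| ≤ hi)
    (hsymm : ν (Set.Ioi 0) = ν (Set.Iio 0)) (M M₀ : Matrix (Fin p) (Fin p) ℝ) (lam : ℝ)
    (S : Finset (Fin p)) :
    Integrable (fun a => gapForm D D₀ M M₀ lam a fun j => Real.sign (a j)) (condLaw ν S) ∧
      ∫ a, gapForm D D₀ M M₀ lam a (fun j => Real.sign (a j)) ∂(condLaw ν S)
        = gapMean D D₀ M M₀ lam (absMoment ν) (secondMoment ν) S := by
  obtain ⟨b, hb⟩ := hsub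
  have i1 : Integrable (fun a : ℝ => a) ν := hb.integrable
  have i2 : Integrable Real.sign ν :=
    Integrable.of_bound measurable_realSign.aestronglyMeasurable 1
      (Filter.Eventually.of_forall fun x => abs_realSign_le x)
  have i3 : Integrable (fun a : ℝ => a * a) ν := by
    refine Integrable.of_bound (by fun_prop) (hi * hi) ?_
    filter_upwards [hνhi] with a ha
    rw [Real.norm_eq_abs, abs_mul]
    exact mul_le_mul ha ha (abs_nonneg _) ((abs_nonneg _).trans ha)
  have i4 : Integrable (fun a : ℝ => Real.sign a * a) ν := by
    simp only [realSign_mul_eq_abs]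
    exact i1.abs
  have i5 : Integrable (fun a : ℝ => Real.sign a * Real.sign a) ν := by
    refine Integrable.of_bound (measurable_realSign.mul measurable_realSign).aestronglyMeasurable 1
      (Filter.Eventually.of_forall fun x => ?_)
    rw [Real.norm_eq_abs, abs_mul]
    exact mul_le_one₀ (abs_realSign_le x) (abs_nonneg _) (abs_realSign_le x)
  have e1 := integral_id_eq_zero_of_subgaussian hb
  have e2 := integral_realSign_eq_zero hsymm
  have f1 := integral_quadForm_condLaw (g := fun x => x) (h := fun x => x) measurable_id
    measurable_id i1 i1 i3 rfl e1 ((1 / 2 : ℝ) • ((D - D₀)ᵀ * (D - D₀)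
      - (Dᵀ * (D - D₀))ᵀ * (M * (Dᵀ * (D - D₀))))) S
  have f2 := integral_quadForm_condLaw (g := Real.sign) (h := fun x => x) measurable_realSign
    measurable_id i2 i1 i4 Real.sign_zero e2 ((-lam) • (M * (Dᵀ * (D - D₀)))) S
  have f3 := integral_quadForm_condLaw (g := Real.sign) (h := Real.sign) measurable_realSign
    measurable_realSign i2 i2 i5 Real.sign_zero e2 ((-((1 / 2) * lam ^ 2)) • (M - M₀)) S
  have m1 : ∫ x, x * x ∂ν = secondMoment ν := by simp only [secondMoment, sq]
  have m2 : ∫ x, Real.sign x * x ∂ν = absMoment ν := by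
    simp only [realSign_mul_eq_abs, absMoment]
  have m3 : ∫ x, Real.sign x * Real.sign x ∂ν = 1 := by
    have : ∀ᵐ a ∂ν, Real.sign a * Real.sign a = 1 := by
      filter_upwards [hνlo] with a ha
      exact realSign_mul_self_of_ne (abs_pos.1 (hlo.trans_le ha))
    rw [integral_congr_ae this]; simp
  rw [m1] at f1
  rw [m2] at f2
  rw [m3] at f3
  unfold gapForm
  refine ⟨(f1.1.add f2.1).add f3.1, ?_⟩
  rw [gapMean, ← f1.2, ← f2.2, ← f3.2]
  exact (integral_add (f1.1.add f2.1) f3.1).trans (congrArg (· + _) (integral_add f1.1 f2.1))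

/-- The almost sure properties of coefficients with support `S`. -/
def IsCoeff (S : Finset (Fin p)) (lo hi : ℝ) (a : Fin p → ℝ) : Prop :=
  (∀ j, j ∉ S → a j = 0) ∧ ∀ j ∈ S, lo ≤ |a j| ∧ |a j| ≤ hi

lemma ae_isCoeff_condLaw (hνlo : ∀ᵐ a ∂ν, lo ≤ |a|) (hνhi : ∀ᵐ a ∂ν, |a| ≤ hi)
    (S : Finset (Fin p)) : ∀ᵐ a ∂(condLaw ν S), IsCoeff S lo hi a := by
  have h : ∀ j : Fin p, ∀ᵐ a ∂(condLaw ν S),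
      (j ∉ S → a j = 0) ∧ (j ∈ S → lo ≤ |a j| ∧ |a j| ≤ hi) := by
    intro j
    have hq := Measure.quasiMeasurePreserving_eval
      (fun j : Fin p => if j ∈ S then ν else Measure.dirac 0) j
    have h1 : ∀ᵐ x ∂(if j ∈ S then ν else Measure.dirac 0),
        (j ∉ S → x = 0) ∧ (j ∈ S → lo ≤ |x| ∧ |x| ≤ hi) := by
      by_cases hj : j ∈ S
      · simp only [hj, not_true_eq_false, false_imp_iff, true_and, true_imp_iff, if_true]
        filter_upwards [hνlo, hνhi] with x h1 h2 using ⟨h1, h2⟩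
      · simp only [hj, not_false_eq_true, true_imp_iff, false_imp_iff, and_true, if_false]
        rw [ae_dirac_eq]; exact rfl
    exact hq.ae h1
  filter_upwards [ae_all_iff.2 h] with a ha
  exact ⟨fun j => (ha j).1, fun j => (ha j).2⟩

omit [IsProbabilityMeasure ν] in
lemma ae_coeffLaw {J : PMF (Finset (Fin p))} {q : (Fin p → ℝ) → Prop}
    (h : ∀ S ∈ J.support, ∀ᵐ a ∂(condLaw ν S), q a) : ∀ᵐ a ∂(coeffLaw J ν), q a := by
  rw [ae_iff, coeffLaw, Measure.coe_finsetSum, Finset.sum_apply]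
  refine Finset.sum_eq_zero fun S _ => ?_
  rw [Measure.smul_apply]
  by_cases hS : S ∈ J.support
  · rw [ae_iff.1 (h S hS), smul_zero]
  · rw [PMF.mem_support_iff, not_not] at hS
    rw [hS, zero_smul]

lemma ae_isCoeff_coeffLaw {J : PMF (Finset (Fin p))} (hJ : IsSupportLaw k J)
    (hνlo : ∀ᵐ a ∂ν, lo ≤ |a|) (hνhi : ∀ᵐ a ∂ν, |a| ≤ hi) :
    ∀ᵐ a ∂(coeffLaw J ν), ∃ S : Finset (Fin p), S.card = k ∧ IsCoeff S lo hi a :=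
  ae_coeffLaw fun S hS => by
    filter_upwards [ae_isCoeff_condLaw hνlo hνhi S] with a ha using ⟨S, hJ.card_eq S hS, ha⟩

lemma sum_le_integral_coeffLaw {J : PMF (Finset (Fin p))} {Z : (Fin p → ℝ) → ℝ} {R : ℝ}
    {c : Finset (Fin p) → ℝ} (hZ : Measurable Z)
    (hb : ∀ S ∈ J.support, ∀ᵐ a ∂(condLaw ν S), |Z a| ≤ R)
    (hc : ∀ S ∈ J.support, c S ≤ ∫ a, Z a ∂(condLaw ν S)) :
    ∑ S, (J S).toReal * c S ≤ ∫ a, Z a ∂(coeffLaw J ν) := by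
  have hint : ∀ S, Integrable Z (J S • condLaw ν S) := by
    intro S
    by_cases hS : S ∈ J.support
    · exact (Integrable.of_bound hZ.aestronglyMeasurable R (hb S hS)).smul_measure
        (J.apply_ne_top S)
    · rw [PMF.mem_support_iff, not_not] at hS
      rw [hS, zero_smul]; exact integrable_zero_measure
  rw [coeffLaw, integral_finsetSum_measure fun S _ => hint S]
  refine Finset.sum_le_sum fun S _ => ?_
  rw [integral_smul_measure, smul_eq_mul]
  by_cases hS : S ∈ J.support
  · exact mul_le_mul_of_nonneg_left (hc S hS) ENNReal.toReal_nonneg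
  · rw [PMF.mem_support_iff, not_not] at hS
    simp [hS]

end Moments

/-! ### Concentration at a fixed dictionary -/

/-- Hoeffding's inequality for the centred variables `-Z`, with values in an interval of length `2
R`. -/
lemma measureReal_sum_le_exp {Ω E : Type*} [MeasurableSpace Ω] [MeasurableSpace E]
    {P : Measure Ω} [IsProbabilityMeasure P] {n : ℕ} (hn : 0 < n) {α : Fin n → Ω → E}
    (hα : ∀ i, Measurable (α i)) (hind : iIndepFun α P) {Q : Measure E}
    (hlaw : ∀ i, P.map (α i) = Q) {Z : E → ℝ} (hZ : Measurable Z) {R e η : ℝ} (hR : 0 < R)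
    (hb : ∀ᵐ a ∂Q, |Z a| ≤ R) (he : e ≤ ∫ a, Z a ∂Q) (hη : 0 ≤ η) :
    P.real {ω | ∑ i, Z (α i ω) ≤ n * (e - η)} ≤ Real.exp (-(n * η ^ 2 / (2 * R ^ 2))) := by
  set Y : Fin n → Ω → ℝ := fun i ω => -Z (α i ω) with hY
  have hYm : ∀ i, Measurable (Y i) := fun i => (hZ.comp (hα i)).neg
  have hYb : ∀ i, ∀ᵐ ω ∂P, Y i ω ∈ Set.Icc (-R) R := by
    intro i
    have h1 : ∀ᵐ a ∂(P.map (α i)), |Z a| ≤ R := by rw [hlaw i]; exact hb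
    filter_upwards [ae_of_ae_map (hα i).aemeasurable h1] with ω hω
    have := abs_le.1 hω
    exact ⟨by simp only [hY]; linarith, by simp only [hY]; linarith⟩
  have hYe : ∀ i, ∫ ω, Y i ω ∂P = -∫ a, Z a ∂Q := by
    intro i
    simp only [hY]
    rw [integral_neg, ← hlaw i, integral_map (hα i).aemeasurable hZ.aestronglyMeasurable]
  have hsub := fun i => hasSubgaussianMGF_of_mem_Icc (hYm i).aemeasurable (hYb i)
  have hind' : iIndepFun (fun i ω => Y i ω - ∫ ω, Y i ω ∂P) P :=
    hind.comp (fun i a => -Z a - ∫ ω, Y i ω ∂P) fun i => hZ.neg.sub_const _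
  have h := HasSubgaussianMGF.measure_sum_ge_le_of_iIndepFun hind' (s := Finset.univ)
    (fun i _ => hsub i) (ε := n * η) (by positivity)
  have hn' : (0 : ℝ) < n := by exact_mod_cast hn
  have hc : ∑ i : Fin n, (((‖R - -R‖₊ / 2) ^ 2 : ℝ≥0) : ℝ) = n * R ^ 2 := by
    simp only [Finset.sum_const, Finset.card_univ, Fintype.card_fin, nsmul_eq_mul]
    push_cast
    rw [sub_neg_eq_add, Real.norm_of_nonneg (by linarith)]
    ring
  have hexp : -(n * η) ^ 2 / (2 * ∑ i : Fin n, (((‖R - -R‖₊ / 2) ^ 2 : ℝ≥0) : ℝ))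
      = -(n * η ^ 2 / (2 * R ^ 2)) := by
    rw [hc]; field_simp
  push_cast at h hexp
  rw [hexp] at h
  refine le_trans (measureReal_mono fun ω hω => ?_) h
  simp only [Set.mem_ofPred_eq] at hω ⊢
  have hsum : ∑ i, (Y i ω - ∫ ω, Y i ω ∂P) = n * ∫ a, Z a ∂Q - ∑ i, Z (α i ω) := by
    rw [Finset.sum_sub_distrib, Finset.sum_congr rfl fun i _ => hYe i]
    simp [hY]
    ring
  rw [hsum]
  nlinarith

/-! ### A lower bound on the increase at a fixed dictionary -/

section FixedDictionary

variable {m p k : ℕ} {D D₀ : Matrix (Fin m) (Fin p) ℝ} {ν : Measure ℝ} {lo hi : ℝ}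

lemma IsCoeff.dotProduct_self_le {S : Finset (Fin p)} {a : Fin p → ℝ} (ha : IsCoeff S lo hi a)
    (hS : S.card = k) : a ⬝ᵥ a ≤ k * hi ^ 2 := by
  have h1 : a ⬝ᵥ a = ∑ j ∈ S, a j ^ 2 := by
    rw [dotProduct]
    refine ((Finset.sum_subset (Finset.subset_univ S) fun j _ hj => ?_).trans
      (Finset.sum_congr rfl fun j _ => rfl)).symm.trans ?_
    · rw [ha.1 j hj, mul_zero]
    · exact Finset.sum_congr rfl fun j _ => (sq _).symm
  rw [h1, ← hS, ← nsmul_eq_mul]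
  refine Finset.sum_le_card_nsmul _ _ _ fun j hj => ?_
  rw [← sq_abs (a j)]
  exact pow_le_pow_left₀ (abs_nonneg _) (ha.2 j hj).2 2

/-- `gapForm` depends on the unknown support through `M S` and `M₀ S`, so it is not directly a
function of the coefficients. The witness is `min f R` for the true increase `f`: it is measurable,
and since `-R ≤ gapForm ≤ min f R` almost surely, it is bounded by `R` and its mean dominates that
of the form. -/
lemma exists_measurable_le_lassoValue_sub [IsProbabilityMeasure ν] (hD : D ∈ dictionaries m p)
    (hD₀ : D₀ ∈ dictionaries m p) {J : PMF (Finset (Fin p))} (hJ : IsSupportLaw k J)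
    (hk1 : 1 ≤ k) {μ : ℝ} (hμ : 0 ≤ μ) (hk : k * μ ≤ 1 / 4)
    (hoff : ∀ i j, i ≠ j → |(Dᵀ * D) i j| ≤ μ) (hoff₀ : ∀ i j, i ≠ j → |(D₀ᵀ * D₀) i j| ≤ μ)
    (hsub : ∃ b : ℝ≥0, HasSubgaussianMGF id b ν) (hlo : 0 < lo)
    (hνlo : ∀ᵐ a ∂ν, lo ≤ |a|) (hνhi : ∀ᵐ a ∂ν, |a| ≤ hi)
    (hsymm : ν (Set.Ioi 0) = ν (Set.Iio 0)) {t x : ℝ} (hx : 0 ≤ x)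
    (hxt : x ^ 2 = k * hi ^ 2 * t ^ 2) (ht : frobNorm (D - D₀) = t) (hxlo : 4 * x ≤ lo)
    {e : ℝ} (he : ∀ M M₀ : Finset (Fin p) → Matrix (Fin p) (Fin p) ℝ,
      (∀ S, S.card = k → IsBlockInverse (Dᵀ * D) S μ (M S)) →
      (∀ S, S.card = k → IsBlockInverse (D₀ᵀ * D₀) S μ (M₀ S)) →
      e ≤ ∑ S, (J S).toReal *
        gapMean D D₀ (M S) (M₀ S) (2 * x) (absMoment ν) (secondMoment ν) S) :
    ∃ Z : (Fin p → ℝ) → ℝ, Measurable Z ∧ (∀ᵐ a ∂(coeffLaw J ν), |Z a| ≤ 16 * k * x ^ 2) ∧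
      e ≤ ∫ a, Z a ∂(coeffLaw J ν) ∧
      ∀ a, Z a ≤ lassoValue (2 * x) (D₀ *ᵥ a) D - lassoValue (2 * x) (D₀ *ᵥ a) D₀ := by
  have h2x : 0 ≤ 2 * x := by linarith
  have hexM : ∀ S : Finset (Fin p), ∃ M, S.card = k → IsBlockInverse (Dᵀ * D) S μ M := by
    intro S
    by_cases hS : S.card = k
    · obtain ⟨M, hM⟩ := exists_isBlockInverse hμ (by simp) (gram_apply_self hD) hoff hS.le hk
      exact ⟨M, fun _ => hM⟩
    · exact ⟨0, fun h => absurd h hS⟩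
  have hexM₀ : ∀ S : Finset (Fin p), ∃ M, S.card = k → IsBlockInverse (D₀ᵀ * D₀) S μ M := by
    intro S
    by_cases hS : S.card = k
    · obtain ⟨M, hM⟩ := exists_isBlockInverse hμ (by simp) (gram_apply_self hD₀) hoff₀ hS.le hk
      exact ⟨M, fun _ => hM⟩
    · exact ⟨0, fun h => absurd h hS⟩
  choose M hM using hexM
  choose M₀ hM₀ using hexM₀
  set R : ℝ := 16 * k * x ^ 2 with hR
  have hRR : 4 * k * (2 * x) ^ 2 = R := by rw [hR]; ring
  have hR0 : 0 ≤ R := by positivity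
  set f : (Fin p → ℝ) → ℝ := fun a =>
    lassoValue (2 * x) (D₀ *ᵥ a) D - lassoValue (2 * x) (D₀ *ᵥ a) D₀ with hf
  have hfm : Measurable f := by
    have hmul : Measurable fun a : Fin p → ℝ => D₀ *ᵥ a :=
      (Continuous.matrix_mulVec continuous_const continuous_id).measurable
    exact ((measurable_lassoValue h2x D).comp hmul).sub ((measurable_lassoValue h2x D₀).comp hmul)
  have hgap : ∀ S, S.card = k → ∀ a, IsCoeff S lo hi a →
      gapForm D D₀ (M S) (M₀ S) (2 * x) a (fun j => Real.sign (a j)) ≤ min (f a) R ∧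
      |min (f a) R| ≤ R := by
    intro S hS a ha
    have hs : ∀ j, |Real.sign (a j)| ≤ 1 := fun j => abs_realSign_le _
    have hwl : ((D - D₀) *ᵥ a) ⬝ᵥ ((D - D₀) *ᵥ a) ≤ (2 * x / 2) ^ 2 := by
      refine (mulVec_sq_le_frobNorm _ _).trans ?_
      rw [ht, mul_div_cancel_left₀ x two_ne_zero, hxt]
      have := mul_le_mul_of_nonneg_left (ha.dotProduct_self_le hS) (sq_nonneg t)
      linarith
    have h1 := gapForm_le_lassoValue_sub (D₀ := D₀) hD (hM S hS) (hM₀ S hS) hμ hS.le hk hoff h2x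
      ha.1 hs (fun j hj => realSign_mul_self_of_ne (abs_pos.1 (hlo.trans_le (ha.2 j hj).1)))
      (fun j => realSign_mul_eq_abs _) (fun j hj => by linarith [(ha.2 j hj).1]) hwl
    have h2 := abs_gapForm_le hD (hM S hS) (hM₀ S hS) hμ hS.le hk1 hk h2x hs hwl
    rw [hRR, abs_le] at h2
    have h3 := le_min h1 h2.2
    refine ⟨h3, abs_le.2 ⟨h2.1.trans h3, min_le_right _ _⟩⟩
  refine ⟨fun a => min (f a) R, hfm.min measurable_const, ?_, ?_, fun a => min_le_left _ _⟩
  · filter_upwards [ae_isCoeff_coeffLaw hJ hνlo hνhi] with a ⟨S, hS, ha⟩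
    exact (hgap S hS a ha).2
  · refine (he M M₀ hM hM₀).trans (sum_le_integral_coeffLaw (hfm.min measurable_const)
      (R := R) (fun S hS => ?_) fun S hS => ?_)
    · filter_upwards [ae_isCoeff_condLaw hνlo hνhi S] with a ha
      exact (hgap S (hJ.card_eq S hS) a ha).2
    · have hg := integral_gapForm (D := D) (D₀ := D₀) hsub hlo hνlo hνhi hsymm (M S) (M₀ S)
        (2 * x) S
      rw [← hg.2]
      have hae : ∀ᵐ a ∂(condLaw ν S), IsCoeff S lo hi a := ae_isCoeff_condLaw hνlo hνhi S
      refine integral_mono_ae hg.1 (Integrable.of_bound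
        (hfm.min measurable_const).aestronglyMeasurable R ?_) ?_
      · filter_upwards [hae] with a ha using (hgap S (hJ.card_eq S hS) a ha).2
      · filter_upwards [hae] with a ha using (hgap S (hJ.card_eq S hS) a ha).1

end FixedDictionary

/-! ### Nets of dictionaries -/

lemma abs_apply_le_one {m p : ℕ} {D : Matrix (Fin m) (Fin p) ℝ} (hD : D ∈ dictionaries m p)
    (i : Fin m) (j : Fin p) : |D i j| ≤ 1 := by
  have h1 : D i j ^ 2 ≤ 1 := (hD j) ▸
    Finset.single_le_sum (f := fun i => D i j ^ 2) (fun _ _ => sq_nonneg _) (Finset.mem_univ i)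
  exact (sq_le_one_iff_abs_le_one _).1 h1

/-- Dictionaries are grouped by the integer parts of `N * D i j`, each one of `2 N + 1` values. One
representative is taken inside `A` from each nonempty class, so the net stays on the sphere. -/
lemma exists_finset_net {m p : ℕ} {A : Set (Matrix (Fin m) (Fin p) ℝ)}
    (hA : A ⊆ dictionaries m p) {N : ℕ} (hN : 0 < N) :
    ∃ T : Finset (Matrix (Fin m) (Fin p) ℝ), (∀ D ∈ T, D ∈ A) ∧
      T.card ≤ (2 * N + 1) ^ (m * p) ∧
      ∀ D ∈ A, ∃ D' ∈ T, ∀ i j, |D i j - D' i j| ≤ 1 / N := by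
  classical
  set r : Matrix (Fin m) (Fin p) ℝ → Fin m × Fin p → ℤ := fun D q => ⌊(N : ℝ) * D q.1 q.2⌋ with hr
  have hN' : (0 : ℝ) < N := by exact_mod_cast hN
  set B : Finset (Fin m × Fin p → ℤ) :=
    Fintype.piFinset fun _ => Finset.Icc (-(N : ℤ)) N with hB
  have hrB : ∀ D ∈ A, r D ∈ B := by
    intro D hD
    rw [hB, Fintype.mem_piFinset]
    intro q
    have h := abs_le.1 (abs_apply_le_one (hA hD) q.1 q.2)
    rw [Finset.mem_Icc]
    constructor
    · rw [Int.le_floor]; push_cast; nlinarith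
    · have : ((⌊(N : ℝ) * D q.1 q.2⌋ : ℤ) : ℝ) ≤ ((N : ℤ) : ℝ) := by
        refine (Int.floor_le _).trans ?_
        push_cast; nlinarith
      exact_mod_cast this
  refine ⟨(B.filter fun g => g ∈ r '' A).image (Function.invFunOn r A), ?_, ?_, ?_⟩
  · intro D hD
    obtain ⟨g, hg, rfl⟩ := Finset.mem_image.1 hD
    exact Function.invFunOn_mem (Finset.mem_filter.1 hg).2
  · refine Finset.card_image_le.trans ((Finset.card_filter_le _ _).trans (le_of_eq ?_))
    rw [hB, Fintype.card_piFinset]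
    simp only [Int.card_Icc, Finset.prod_const, Finset.card_univ, Fintype.card_prod,
      Fintype.card_fin]
    congr 1
    omega
  · intro D hD
    have hmem : r D ∈ r '' A := ⟨D, hD, rfl⟩
    refine ⟨Function.invFunOn r A (r D), Finset.mem_image.2 ⟨r D, Finset.mem_filter.2
      ⟨hrB D hD, hmem⟩, rfl⟩, fun i j => ?_⟩
    have heq : r (Function.invFunOn r A (r D)) (i, j) = r D (i, j) := by
      rw [Function.invFunOn_eq hmem]
    have := Int.abs_sub_lt_one_of_floor_eq_floor heq.symm
    rw [← mul_sub, abs_mul, abs_of_pos hN'] at this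
    rw [le_div_iff₀ hN']
    linarith

/-! ### From fixed dictionaries to the sphere -/

/-- Half of the mean increase `e` is given up to the deviation at the points of the net, the other
half to passing from a dictionary to its neighbour in the net. The signals are bounded only almost
surely, hence the additional null set. -/
lemma measure_not_forall_sphere_le {m p n k : ℕ} (hn : 0 < n)
    {D₀ : Matrix (Fin m) (Fin p) ℝ} (hD₀ : D₀ ∈ dictionaries m p)
    {A : Set (Matrix (Fin m) (Fin p) ℝ)} (hA : A ⊆ dictionaries m p)
    {J : PMF (Finset (Fin p))} (hJ : IsSupportLaw k J) {ν : Measure ℝ} {lo hi : ℝ}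
    (hνlo : ∀ᵐ a ∂ν, lo ≤ |a|) (hνhi : ∀ᵐ a ∂ν, |a| ≤ hi) [IsProbabilityMeasure ν]
    {Ω : Type*} [MeasurableSpace Ω] {P : Measure Ω} [IsProbabilityMeasure P]
    {α : Fin n → Ω → Fin p → ℝ} (hα : ∀ i, Measurable (α i)) (hind : iIndepFun α P)
    (hlaw : ∀ i, P.map (α i) = coeffLaw J ν) {lam R e V : ℝ} {N : ℕ} (hN : 0 < N)
    (hlam : 0 < lam) (hR : 0 < R) (he : 0 ≤ e) (hV : p * (k * hi ^ 2) = V) (hV0 : 0 < V)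
    (hlip : m * ((1 / 2) * (1 / N * (V / lam)) * (2 * Real.sqrt (2 * V) + 1 / N * (V / lam)))
      ≤ e / 2)
    (hZ : ∀ D ∈ A, ∃ Z : (Fin p → ℝ) → ℝ, Measurable Z ∧
      (∀ᵐ a ∂(coeffLaw J ν), |Z a| ≤ R) ∧ e ≤ ∫ a, Z a ∂(coeffLaw J ν) ∧
      ∀ a, Z a ≤ lassoValue lam (D₀ *ᵥ a) D - lassoValue lam (D₀ *ᵥ a) D₀) :
    P {ω | ¬ ∀ D ∈ A, sparseCodingObjective lam (fun i => D₀ *ᵥ α i ω) D₀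
        < sparseCodingObjective lam (fun i => D₀ *ᵥ α i ω) D}
      ≤ ENNReal.ofReal ((2 * N + 1) ^ (m * p) * Real.exp (-(n * (e / 2) ^ 2 / (2 * R ^ 2)))) := by
  have hn' : (0 : ℝ) < n := by exact_mod_cast hn
  have hN' : (0 : ℝ) < N := by exact_mod_cast hN
  obtain ⟨T, hTA, hTc, hTnet⟩ := exists_finset_net hA hN
  have hZ' : ∀ D, ∃ Z : (Fin p → ℝ) → ℝ, D ∈ A → Measurable Z ∧
      (∀ᵐ a ∂(coeffLaw J ν), |Z a| ≤ R) ∧ e ≤ ∫ a, Z a ∂(coeffLaw J ν) ∧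
      ∀ a, Z a ≤ lassoValue lam (D₀ *ᵥ a) D - lassoValue lam (D₀ *ᵥ a) D₀ := by
    intro D
    by_cases hD : D ∈ A
    · obtain ⟨Z, h⟩ := hZ D hD
      exact ⟨Z, fun _ => h⟩
    · exact ⟨0, fun h => absurd h hD⟩
  choose Z hZ using hZ'
  set bad : Set Ω := ⋃ D ∈ T, {ω | ∑ i, Z D (α i ω) ≤ n * (e - e / 2)} with hbad
  set null : Set Ω := {ω | ¬ ∀ i, ∃ S : Finset (Fin p), S.card = k ∧ IsCoeff S lo hi (α i ω)}
    with hnull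
  have hnull0 : P null = 0 := by
    refine ae_iff.1 (ae_all_iff.2 fun i => ?_)
    have h1 : ∀ᵐ a ∂(P.map (α i)), ∃ S : Finset (Fin p), S.card = k ∧ IsCoeff S lo hi a := by
      rw [hlaw i]; exact ae_isCoeff_coeffLaw hJ hνlo hνhi
    exact ae_of_ae_map (hα i).aemeasurable h1
  have hsub : {ω | ¬ ∀ D ∈ A, sparseCodingObjective lam (fun i => D₀ *ᵥ α i ω) D₀
      < sparseCodingObjective lam (fun i => D₀ *ᵥ α i ω) D} ⊆ bad ∪ null := by
    intro ω hω
    by_contra hcon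
    rw [Set.mem_union, not_or] at hcon
    obtain ⟨h1, h2⟩ := hcon
    simp only [hnull, Set.mem_ofPred_eq, not_not] at h2
    refine hω fun D hD => ?_
    obtain ⟨D', hD'T, hDD'⟩ := hTnet D hD
    have hD'A := hTA D' hD'T
    have h3 : n * (e - e / 2) < ∑ i, Z D' (α i ω) := by
      by_contra hle
      exact h1 (Set.mem_biUnion (x := D') hD'T (not_lt.1 hle))
    have h4 : ∀ i, lassoValue lam (D₀ *ᵥ α i ω) D' ≤ lassoValue lam (D₀ *ᵥ α i ω) D + e / 2 := by
      intro i
      obtain ⟨S, hS, ha⟩ := h2 i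
      refine (lassoValue_le_add (V := V) hlam _ D D' ?_ hDD' (by positivity)).trans (by linarith)
      have h5 := mulVec_sq_le_frobNorm D₀ (α i ω)
      have h6 : frobNorm D₀ ^ 2 = p := by
        rw [← sum_colSq]
        exact (Finset.sum_congr rfl fun j _ => hD₀ j).trans (by simp)
      rw [h6] at h5
      have h7 := mul_le_mul_of_nonneg_left (ha.dotProduct_self_le hS) (Nat.cast_nonneg (α := ℝ) p)
      have h8 : ∑ r, (D₀ *ᵥ α i ω) r ^ 2 = (D₀ *ᵥ α i ω) ⬝ᵥ (D₀ *ᵥ α i ω) := by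
        simp [dotProduct, sq]
      rw [h8]
      linarith
    have h9 : ∑ i, lassoValue lam (D₀ *ᵥ α i ω) D₀ < ∑ i, lassoValue lam (D₀ *ᵥ α i ω) D := by
      have a1 : ∑ i, Z D' (α i ω) ≤ ∑ i, (lassoValue lam (D₀ *ᵥ α i ω) D + e / 2
          - lassoValue lam (D₀ *ᵥ α i ω) D₀) :=
        Finset.sum_le_sum fun i _ => by linarith [(hZ D' hD'A).2.2.2 (α i ω), h4 i]
      rw [Finset.sum_sub_distrib, Finset.sum_add_distrib, Finset.sum_const, Finset.card_univ,
        Fintype.card_fin, nsmul_eq_mul] at a1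
      linarith
    unfold sparseCodingObjective
    exact mul_lt_mul_of_pos_left h9 (by positivity)
  refine (measure_mono hsub).trans ((measure_union_le _ _).trans ?_)
  rw [hnull0, add_zero, ← ofReal_measureReal (measure_ne_top P _)]
  refine ENNReal.ofReal_le_ofReal ?_
  refine (measureReal_biUnion_finset_le _ _).trans ?_
  calc ∑ D ∈ T, P.real {ω | ∑ i, Z D (α i ω) ≤ n * (e - e / 2)}
      ≤ ∑ _D ∈ T, Real.exp (-(n * (e / 2) ^ 2 / (2 * R ^ 2))) := Finset.sum_le_sum fun D hD => by
        obtain ⟨z1, z2, z3, -⟩ := hZ D (hTA D hD)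
        exact measureReal_sum_le_exp hn hα hind hlaw z1 hR z2 z3 (by positivity)
    _ = T.card * Real.exp (-(n * (e / 2) ^ 2 / (2 * R ^ 2))) := by
        rw [Finset.sum_const, nsmul_eq_mul]
    _ ≤ _ := mul_le_mul_of_nonneg_right (by exact_mod_cast hTc) (Real.exp_pos _).le

/-! ### Consequences of the hypotheses -/

lemma moment_bounds {ν : Measure ℝ} [IsProbabilityMeasure ν] {lo hi : ℝ}
    (hνlo : ∀ᵐ a ∂ν, lo ≤ |a|) (hνhi : ∀ᵐ a ∂ν, |a| ≤ hi) :
    Integrable (fun a : ℝ => a ^ 2) ν ∧ lo ≤ absMoment ν ∧ lo ≤ hi ∧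
      absMoment ν ^ 2 ≤ secondMoment ν ∧ secondMoment ν ≤ hi * absMoment ν ∧
      absMoment ν ≤ hi := by
  have i1 : Integrable (fun a : ℝ => |a|) ν := by
    refine Integrable.of_bound (by fun_prop) hi ?_
    filter_upwards [hνhi] with a ha
    rwa [Real.norm_eq_abs, abs_abs]
  have i2 : Integrable (fun a : ℝ => a ^ 2) ν := by
    refine Integrable.of_bound (by fun_prop) (hi ^ 2) ?_
    filter_upwards [hνhi] with a ha
    rw [Real.norm_eq_abs, abs_pow]
    exact pow_le_pow_left₀ (abs_nonneg _) ha 2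
  have h1 : lo ≤ absMoment ν := by
    have := integral_mono_ae (integrable_const lo) i1 hνlo
    simpa [absMoment] using this
  have h5 : absMoment ν ≤ hi := by
    have := integral_mono_ae i1 (integrable_const hi) hνhi
    simpa [absMoment] using this
  refine ⟨i2, h1, h1.trans h5, ?_, ?_, h5⟩
  · set e := absMoment ν with he
    have h2 : 0 ≤ ∫ a, (a ^ 2 - 2 * e * |a| + e ^ 2) ∂ν := integral_nonneg fun a => by
      have : a ^ 2 - 2 * e * |a| + e ^ 2 = (|a| - e) ^ 2 := by rw [sub_sq, sq_abs]; ring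
      simp only [Pi.zero_apply, this]
      positivity
    have i3 : Integrable (fun a : ℝ => a ^ 2 - 2 * e * |a|) ν := i2.sub (i1.const_mul _)
    rw [integral_add i3 (integrable_const _),
      integral_sub i2 (i1.const_mul _), integral_const_mul] at h2
    simp only [integral_const, probReal_univ, smul_eq_mul, one_mul] at h2
    change 0 ≤ secondMoment ν - 2 * e * e + e ^ 2 at h2
    linarith
  · unfold secondMoment absMoment
    rw [← integral_const_mul]
    refine integral_mono_ae i2 (i1.const_mul hi) ?_
    filter_upwards [hνhi] with a ha
    rw [← sq_abs, sq]
    exact mul_le_mul_of_nonneg_right ha (abs_nonneg _)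

/-- Bounds on the radius and the coherence implied by the two conditions of the theorem. -/
lemma radius_bounds {k s t x q e₁ e₂ σ lo hi L μ₀ cl mn : ℝ} (hk : 1 ≤ k) (hs : 0 ≤ s)
    (hcl : 1 ≤ cl) (hlo : 0 < lo) (hloe : lo ≤ e₁) (heh : e₁ ≤ hi) (he : e₁ ^ 2 ≤ e₂)
    (he' : e₂ ≤ hi * e₁) (hσ : 0 < σ) (hσe : e₂ ≤ σ ^ 2) (hL : 1 ≤ L)
    (hq : q = e₂ / (hi * e₁)) (ht : t = 8 * cl / q * s) (hx : x = Real.sqrt k * hi * t)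
    (hmn1 : mn ≤ lo / σ) (hmn2 : mn ≤ 1 / 10 * (e₂ / (σ * e₁) / (k * L)))
    (hcoh : L * (k * Real.sqrt k) * μ₀ ≤ q / (2 * cl))
    (hsam : Real.sqrt k * s ≤ e₂ / hi ^ 2 * (1 / (9 * cl ^ 2)) * mn) :
    0 < q ∧ q ≤ 1 ∧ x ≤ 1 / cl * e₁ ∧ x ≤ 1 / cl * lo ∧
      k * Real.sqrt k * L * (μ₀ + 2 * t) ≤ 1 / cl * q ∧ k * Real.sqrt k * L * t ≤ 1 / cl := by
  have he1 : 0 < e₁ := hlo.trans_le hloe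
  have hhi : 0 < hi := he1.trans_le heh
  have he2 : 0 < e₂ := lt_of_lt_of_le (by positivity) he
  have hq0 : 0 < q := by rw [hq]; positivity
  have hq1 : q ≤ 1 := by rw [hq, div_le_one (by positivity)]; exact he'
  have hr0 : 0 < Real.sqrt k := Real.sqrt_pos.2 (by linarith)
  have hcl0 : 0 < cl := by linarith
  have he1σ : e₁ ≤ σ := abs_le_of_sq_le_sq' (he.trans hσe) hσ.le |>.2
  have ht0 : 0 ≤ t := by rw [ht]; positivity
  have hmn0 : 0 ≤ mn := by
    by_contra hneg
    push Not at hneg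
    have h1 : e₂ / hi ^ 2 * (1 / (9 * cl ^ 2)) * mn < 0 :=
      mul_neg_of_pos_of_neg (by positivity) hneg
    have h2 : 0 ≤ Real.sqrt k * s := by positivity
    linarith
  -- the basic bound on `t`
  have hkt : Real.sqrt k * t ≤ 1 / cl * (e₁ / hi) * mn := by
    have h1 : Real.sqrt k * t = 8 * cl / q * (Real.sqrt k * s) := by rw [ht]; ring
    rw [h1]
    have h2 : 8 * cl / q * (e₂ / hi ^ 2 * (1 / (9 * cl ^ 2)) * mn)
        = 8 / 9 * (1 / cl * (e₁ / hi) * mn) := by rw [hq]; field_simp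
    have h3 : 0 ≤ 1 / cl * (e₁ / hi) * mn := by positivity
    exact (mul_le_mul_of_nonneg_left hsam (by positivity)).trans (by rw [h2]; linarith)
  have hxm : x ≤ 1 / cl * e₁ * mn := by
    have h1 : x = hi * (Real.sqrt k * t) := by rw [hx]; ring
    have h2 : hi * (1 / cl * (e₁ / hi) * mn) = 1 / cl * e₁ * mn := by field_simp
    rw [h1, ← h2]
    exact mul_le_mul_of_nonneg_left hkt hhi.le
  have hloσ : lo / σ ≤ 1 := by rw [div_le_one hσ]; exact hloe.trans he1σ
  -- The second entry of the minimum contains `1 / (k L)`, which cancels the factor `k L` here.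
  have hkt2 : k * Real.sqrt k * L * t ≤ 1 / (10 * cl) * q := by
    have h1 : k * Real.sqrt k * L * t = k * L * (Real.sqrt k * t) := by ring
    have h2 : 1 / cl * (e₁ / hi) * mn
        ≤ 1 / cl * (e₁ / hi) * (1 / 10 * (e₂ / (σ * e₁) / (k * L))) :=
      mul_le_mul_of_nonneg_left hmn2 (by positivity)
    have h3 : k * L * (1 / cl * (e₁ / hi) * (1 / 10 * (e₂ / (σ * e₁) / (k * L))))
        = 1 / (10 * cl) * (e₂ / (hi * σ)) := by field_simp
    have h4 : e₂ / (hi * σ) ≤ q := by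
      rw [hq]
      gcongr
    rw [h1]
    refine (mul_le_mul_of_nonneg_left (hkt.trans h2) (by positivity)).trans ?_
    rw [h3]
    exact mul_le_mul_of_nonneg_left h4 (by positivity)
  have hc10 : 1 / (10 * cl) * q = 1 / 10 * (1 / cl * q) := by field_simp
  have hc2 : q / (2 * cl) = 1 / 2 * (1 / cl * q) := by field_simp
  have hcq : 0 < 1 / cl * q := by positivity
  have hcq1 : 1 / cl * q ≤ 1 / cl := mul_le_of_le_one_right (by positivity) hq1
  refine ⟨hq0, hq1, ?_, ?_, ?_, ?_⟩
  · refine hxm.trans (mul_le_of_le_one_right (by positivity) (hmn1.trans hloσ))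
  · refine (hxm.trans (mul_le_mul_of_nonneg_left hmn1 (by positivity))).trans ?_
    have : 1 / cl * e₁ * (lo / σ) = 1 / cl * lo * (e₁ / σ) := by ring
    rw [this]
    exact mul_le_of_le_one_right (by positivity) ((div_le_one hσ).2 he1σ)
  -- In units of `q / cl`, the coherence condition contributes one half and `2 t` one fifth.
  · rw [hc10] at hkt2
    rw [hc2] at hcoh
    linarith
  · linarith

/-- Size of the sample, of the radius and of the second moment. -/
lemma sample_bounds {k m p n s t q e₂ hi cl mn : ℝ} (hk : 1 ≤ k) (hm : 1 ≤ m) (hp : 1 ≤ p)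
    (hn : 2 ≤ n) (hcl : 1 ≤ cl) (hhi : 0 < hi) (he₂ : 0 < e₂) (hq0 : 0 < q) (hq1 : q ≤ 1)
    (hmn0 : 0 ≤ mn) (hmn : mn ≤ 1) (he : e₂ ≤ hi ^ 2)
    (hs : s ^ 2 = k * m * p ^ 3 * (Real.log n / n)) (hs0 : 0 ≤ s) (ht : t = 8 * cl / q * s)
    (hsam : Real.log n / n ≤ 1 / (k ^ 2 * m * p ^ 3) *
      (e₂ / hi ^ 2 * (1 / (9 * cl ^ 2)) * mn) ^ 2) :
    81 * cl ^ 4 * (Real.log n * (k ^ 2 * m * p ^ 3)) ≤ n * (e₂ / hi ^ 2) ^ 2 ∧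
      40 * cl ^ 4 * (k ^ 2 * m * p ^ 3) ≤ n ∧ 1 / n ≤ t ^ 2 ∧ 1 / n ≤ (e₂ / hi ^ 2) ^ 2 := by
  have hn0 : 0 < n := by linarith
  have hlog : 1 / 2 ≤ Real.log n := by
    have h1 := Real.log_two_gt_d9
    have h2 := Real.log_le_log two_pos hn
    linarith
  set G := k ^ 2 * m * p ^ 3 with hG
  have hG1 : 1 ≤ G := by
    rw [hG]
    have h1 : 1 ≤ k ^ 2 := one_le_pow₀ hk
    have h2 : 1 ≤ p ^ 3 := one_le_pow₀ hp
    nlinarith [mul_le_mul h1 hm zero_le_one (by positivity : (0 : ℝ) ≤ k ^ 2)]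
  have hε1 : e₂ / hi ^ 2 ≤ 1 := (div_le_one (by positivity)).2 he
  have hε0 : 0 < e₂ / hi ^ 2 := by positivity
  have h1 : 81 * cl ^ 4 * (Real.log n * G) ≤ n * (e₂ / hi ^ 2) ^ 2 := by
    have h2 : (e₂ / hi ^ 2 * (1 / (9 * cl ^ 2)) * mn) ^ 2
        ≤ (e₂ / hi ^ 2 * (1 / (9 * cl ^ 2))) ^ 2 :=
      pow_le_pow_left₀ (by positivity) (mul_le_of_le_one_right (by positivity) hmn) 2
    have h3 := hsam.trans (mul_le_mul_of_nonneg_left h2 (by positivity))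
    rw [div_le_iff₀ hn0] at h3
    have h4 := mul_le_mul_of_nonneg_left h3 (by positivity : 0 ≤ 81 * cl ^ 4 * G)
    have h5 : 81 * cl ^ 4 * G * (1 / G * (e₂ / hi ^ 2 * (1 / (9 * cl ^ 2))) ^ 2 * n)
        = n * (e₂ / hi ^ 2) ^ 2 := by
      field_simp; ring
    rw [h5] at h4
    linarith
  have hcl4 : 1 ≤ cl ^ 4 := one_le_pow₀ hcl
  have hε2 : (e₂ / hi ^ 2) ^ 2 ≤ 1 := pow_le_one₀ hε0.le hε1
  refine ⟨h1, ?_, ?_, ?_⟩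
  · have h2 : 81 * cl ^ 4 * (1 / 2 * G) ≤ 81 * cl ^ 4 * (Real.log n * G) := by gcongr
    have h3 : n * (e₂ / hi ^ 2) ^ 2 ≤ n := mul_le_of_le_one_right hn0.le hε2
    have h4 : 0 ≤ cl ^ 4 * G := by positivity
    linarith
  · have h2 : 8 ≤ 8 * cl / q := by rw [le_div_iff₀ hq0]; nlinarith
    have h3 : 8 * s ≤ t := by rw [ht]; exact mul_le_mul_of_nonneg_right h2 hs0
    have h4 : (8 * s) ^ 2 ≤ t ^ 2 := pow_le_pow_left₀ (by positivity) h3 2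
    have h5 : 1 ≤ k * m * p ^ 3 := by
      have h2 : 1 ≤ p ^ 3 := one_le_pow₀ hp
      nlinarith [mul_le_mul hk hm zero_le_one (by linarith : (0 : ℝ) ≤ k)]
    have h6 : 1 / 2 / n ≤ Real.log n / n := by gcongr
    have h7 : 1 * (1 / 2 / n) ≤ k * m * p ^ 3 * (Real.log n / n) :=
      mul_le_mul h5 h6 (by positivity) (by positivity)
    rw [mul_pow, hs] at h4
    have h8 : 1 / n = 2 * (1 / 2 / n) := by ring
    have h9 : 0 ≤ 1 / 2 / n := by positivity
    rw [h8]; linarith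
  · rw [div_le_iff₀ hn0]
    have h2 : 1 * (1 / 2 * 1) ≤ cl ^ 4 * (Real.log n * G) := by gcongr
    linarith

/-- The left side is the discretisation error at mesh `n⁻⁵`. After scaling, the gain contains `(e₂ /
hi²) t³ ≥ n⁻³`, and the remaining `n⁻²` absorbs `m p³ / δ`; this dictates the exponent 5. -/
lemma lip_bound {k m p n t hi e₂ δ : ℝ} (hk : 1 ≤ k) (hm : 1 ≤ m) (hp : 1 ≤ p) (hn : 2 ≤ n)
    (ht0 : 0 < t) (ht1 : t ≤ 1) (hhi : 0 < hi) (he : e₂ ≤ hi ^ 2) (he₂ : 0 < e₂) (hδ : 0 < δ)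
    (htn : 1 / n ≤ t ^ 2) (hen : 1 / n ≤ (e₂ / hi ^ 2) ^ 2) (hδn : 16 * (m * p ^ 3) ≤ δ * n ^ 2) :
    m * ((1 / 2) * (1 / n ^ 5 * (p * (k * hi ^ 2) / (2 * (Real.sqrt k * hi * t)))) *
      (2 * Real.sqrt (2 * (p * (k * hi ^ 2)))
        + 1 / n ^ 5 * (p * (k * hi ^ 2) / (2 * (Real.sqrt k * hi * t)))))
      ≤ δ / 4 * (e₂ * (k / p) * t ^ 2) / 2 := by
  have hk0 : 0 ≤ k := by linarith
  set W := Real.sqrt k * hi with hW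
  have hr0 : 0 < Real.sqrt k := Real.sqrt_pos.2 (by linarith)
  have hW0 : 0 < W := by positivity
  have hWW : k * hi ^ 2 = W ^ 2 := by rw [hW, mul_pow, Real.sq_sqrt hk0]
  have hn0 : 0 < n := by linarith
  have hm0 : 0 < m := by linarith
  have hp0 : 0 < p := by linarith
  set h := 1 / n ^ 5 with hh
  have hh0 : 0 < h := by positivity
  have e1 : p * W ^ 2 / (2 * (W * t)) = p * W / (2 * t) := by field_simp
  rw [hWW, e1]
  have hsq : Real.sqrt (2 * (p * W ^ 2)) ≤ 2 * (p * W) := by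
    refine Real.sqrt_le_iff.2 ⟨by positivity, ?_⟩
    nlinarith [mul_le_mul_of_nonneg_left hp (by positivity : 0 ≤ p * W ^ 2)]
  have hht : h ≤ 2 * t := by
    have h1 : h ≤ 1 / n := by
      rw [hh]
      refine one_div_le_one_div_of_le hn0 ?_
      exact le_self_pow₀ (by linarith) (by norm_num)
    nlinarith
  have hsm : h * (p * W / (2 * t)) ≤ p * W := by
    rw [← mul_div_assoc, div_le_iff₀ (by positivity)]
    nlinarith [mul_le_mul_of_nonneg_right hht (by positivity : 0 ≤ p * W)]
  have hstep : m * ((1 / 2) * (h * (p * W / (2 * t))) *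
      (2 * Real.sqrt (2 * (p * W ^ 2)) + h * (p * W / (2 * t))))
      ≤ m * ((1 / 2) * (h * (p * W / (2 * t))) * (5 * (p * W))) := by
    gcongr
    linarith
  refine hstep.trans ?_
  have e2 : m * ((1 / 2) * (h * (p * W / (2 * t))) * (5 * (p * W)))
      = 5 / 4 * (m * p ^ 3) * h / t * (k * hi ^ 2 / p) := by
    rw [hWW]; field_simp; ring
  have e3 : δ / 4 * (e₂ * (k / p) * t ^ 2) / 2
      = δ / 8 * (e₂ / hi ^ 2) * t ^ 2 * (k * hi ^ 2 / p) := by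
    field_simp; ring
  rw [e2, e3]
  refine mul_le_mul_of_nonneg_right ?_ (by positivity)
  rw [div_le_iff₀ ht0]
  set ε := e₂ / hi ^ 2 with hε
  have hε0 : 0 < ε := by positivity
  have hε1 : ε ≤ 1 := (div_le_one (by positivity)).2 he
  have hεn : 1 / n ≤ ε := hen.trans (by nlinarith)
  have ht3 : (1 / n) ^ 2 ≤ t ^ 2 * t := by
    have h1 : (1 / n) ^ 2 ≤ (t ^ 2) ^ 2 := pow_le_pow_left₀ (by positivity) htn 2
    nlinarith [mul_le_mul_of_nonneg_left ht1 (by positivity : 0 ≤ t ^ 2 * t)]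
  have h4 : δ / 8 * (1 / n * (1 / n) ^ 2) ≤ δ / 8 * (ε * (t ^ 2 * t)) := by gcongr
  have h5 : 5 / 4 * (m * p ^ 3) * h ≤ δ / 8 * (1 / n * (1 / n) ^ 2) := by
    have h6 : 5 / 4 * (m * p ^ 3) ≤ δ / 8 * n ^ 2 := by
      have : 0 ≤ m * p ^ 3 := by positivity
      linarith
    have h7 := mul_le_mul_of_nonneg_right h6 hh0.le
    have h8 : δ / 8 * n ^ 2 * h = δ / 8 * (1 / n * (1 / n) ^ 2) := by rw [hh]; field_simp
    linarith
  linarith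

/-- The net has at most `n^(7 m p)` points, and an exponent of `10 m p log n` leaves `n^(-3 m p)`.
Since `m p ≤ n`, the target is at least `n^(-m p)`. -/
lemma failure_bound {m p n : ℕ} {X : ℝ} (hm : 1 ≤ m) (hp : 1 ≤ p) (hn : 2 ≤ n)
    (hmp : (m : ℝ) * p ≤ n) (hX : 10 * ((m : ℝ) * p * Real.log n) ≤ X) :
    (2 * ((n ^ 5 : ℕ) : ℝ) + 1) ^ (m * p) * Real.exp (-X)
      < ((m : ℝ) * p * n / 9) ^ (-((m : ℝ) * p) / 2) := by
  have hn' : (2 : ℝ) ≤ n := by exact_mod_cast hn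
  have hm' : (1 : ℝ) ≤ m := by exact_mod_cast hm
  have hp' : (1 : ℝ) ≤ p := by exact_mod_cast hp
  have hn0 : (0 : ℝ) < n := by linarith
  have hlog : 0 < Real.log n := Real.log_pos (by linarith)
  have hd : 0 < (m : ℝ) * p := by positivity
  have h1 : (2 * ((n ^ 5 : ℕ) : ℝ) + 1) ^ (m * p) ≤ Real.exp (7 * ((m : ℝ) * p * Real.log n)) := by
    have h2 : 2 * ((n ^ 5 : ℕ) : ℝ) + 1 ≤ (n : ℝ) ^ 7 := by
      push_cast
      have h3 : (1 : ℝ) ≤ (n : ℝ) ^ 5 := one_le_pow₀ (by linarith)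
      have h4 : (n : ℝ) ^ 7 = (n : ℝ) ^ 5 * (n : ℝ) ^ 2 := by ring
      have h5 : (4 : ℝ) ≤ (n : ℝ) ^ 2 := by nlinarith
      rw [h4]
      nlinarith
    refine (pow_le_pow_left₀ (by positivity) h2 _).trans (le_of_eq ?_)
    rw [← pow_mul, ← Real.exp_log hn0, ← Real.exp_nat_mul, Real.exp_log hn0]
    congr 1
    push_cast; ring
  have h2 : (2 * ((n ^ 5 : ℕ) : ℝ) + 1) ^ (m * p) * Real.exp (-X)
      ≤ Real.exp (-(3 * ((m : ℝ) * p * Real.log n))) := by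
    refine (mul_le_mul h1 (Real.exp_le_exp.2 (neg_le_neg hX)) (Real.exp_pos _).le
      (Real.exp_pos _).le).trans (le_of_eq ?_)
    rw [← Real.exp_add]; congr 1; ring
  have h3 : Real.exp (-((m : ℝ) * p * Real.log n))
      ≤ ((m : ℝ) * p * n / 9) ^ (-((m : ℝ) * p) / 2) := by
    have h4 : Real.exp (-((m : ℝ) * p * Real.log n)) = ((n : ℝ) ^ 2) ^ (-((m : ℝ) * p) / 2) := by
      rw [Real.rpow_def_of_pos (by positivity), Real.log_pow]
      congr 1; push_cast; ring
    rw [h4]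
    refine Real.rpow_le_rpow_of_nonpos (by positivity) ?_ (by linarith)
    nlinarith
  refine h2.trans_lt (lt_of_lt_of_le (Real.exp_lt_exp.2 ?_) h3)
  have : 0 < (m : ℝ) * p * Real.log n := by positivity
  linarith

lemma derived_bounds {k L t μ q δ : ℝ} (hk : 1 ≤ k) (hL : 1 ≤ L) (hμ : 0 ≤ μ) (ht : 0 ≤ t)
    (hq1 : q ≤ 1) (hδ : 0 < δ) (h1 : k * Real.sqrt k * L * μ ≤ δ / 200 * q)
    (h2 : k * Real.sqrt k * L * t ≤ δ / 200) : k * μ ≤ δ / 200 ∧ t ≤ δ / 200 := by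
  have hr : 1 ≤ Real.sqrt k := Real.one_le_sqrt.2 hk
  have hrL : 1 ≤ Real.sqrt k * L := one_le_mul_of_one_le_of_one_le hr hL
  have hkrL : 1 ≤ k * (Real.sqrt k * L) := one_le_mul_of_one_le_of_one_le hk hrL
  have hk0 : 0 ≤ k := by linarith
  constructor
  · have h3 := mul_le_mul_of_nonneg_left hrL (mul_nonneg hk0 hμ)
    have h4 : δ / 200 * q ≤ δ / 200 := mul_le_of_le_one_right (by positivity) hq1
    linarith
  · have := mul_le_mul_of_nonneg_right hkrL ht
    linarith

lemma sample_size {k m p n δ cl : ℝ} (hk : 1 ≤ k) (hm : 1 ≤ m) (hp : 1 ≤ p) (hn : 2 ≤ n)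
    (hδ : 0 < δ) (hδ1 : δ ≤ 1) (hcl : 1 ≤ cl) (hδcl : δ * cl = 200)
    (h : 40 * cl ^ 4 * (k ^ 2 * m * p ^ 3) ≤ n) :
    16 * (m * p ^ 3) ≤ δ * n ^ 2 ∧ m * p ≤ n := by
  have hm0 : 0 < m := by linarith
  have hp0 : 0 < p := by linarith
  have hn0 : 0 < n := by linarith
  have hmp : 0 < m * p ^ 3 := by positivity
  have h1 : 200 ≤ δ * cl ^ 4 := by
    have h2 : 1 ≤ cl ^ 3 := one_le_pow₀ hcl
    have h3 : δ * cl ^ 4 = 200 * cl ^ 3 := by rw [← hδcl]; ring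
    linarith
  have hG : m * p ^ 3 ≤ k ^ 2 * m * p ^ 3 := by
    have := le_mul_of_one_le_left hmp.le (one_le_pow₀ hk : 1 ≤ k ^ 2)
    linarith
  have hGn : 8000 * (m * p ^ 3) ≤ δ * n := by
    have h2 := mul_le_mul_of_nonneg_left h hδ.le
    have h3 := mul_le_mul_of_nonneg_right h1 (by positivity : 0 ≤ 40 * (k ^ 2 * m * p ^ 3))
    linarith
  constructor
  · have h2 : δ * n ≤ δ * n ^ 2 :=
      mul_le_mul_of_nonneg_left (le_self_pow₀ (by linarith) (by norm_num)) hδ.le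
    linarith
  · have h2 : m * p ≤ m * p ^ 3 :=
      mul_le_mul_of_nonneg_left (le_self_pow₀ hp (by norm_num)) hm0.le
    have h3 : δ * n ≤ n := mul_le_of_le_one_left hn0.le hδ1
    linarith

/-- Mean and range are both proportional to `t²`, so the radius cancels. Of the `k² m p³` in the
sample condition, `k² p²` pays for the squared ratio of range to mean and `m p` for the net. -/
lemma exponent_bound {k m p n δ cl t hi e₂ : ℝ} (hk : 1 ≤ k) (hm : 1 ≤ m) (hp : 1 ≤ p)
    (hn : 2 ≤ n) (hδ : 0 < δ) (hδ1 : δ ≤ 1) (hδcl : δ * cl = 200) (ht : 0 < t) (hhi : 0 < hi)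
    (h : 81 * cl ^ 4 * (Real.log n * (k ^ 2 * m * p ^ 3)) ≤ n * (e₂ / hi ^ 2) ^ 2) :
    10 * (m * p * Real.log n)
      ≤ n * (δ / 4 * (e₂ * (k / p) * t ^ 2) / 2) ^ 2
        / (2 * (16 * k * (k * hi ^ 2 * t ^ 2)) ^ 2) := by
  have hk0 : 0 < k := by linarith
  have hm0 : 0 < m := by linarith
  have hp0 : 0 < p := by linarith
  have h1 : n * (δ / 4 * (e₂ * (k / p) * t ^ 2) / 2) ^ 2
        / (2 * (16 * k * (k * hi ^ 2 * t ^ 2)) ^ 2)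
      = δ ^ 2 / 32768 / (k ^ 2 * p ^ 2) * (n * (e₂ / hi ^ 2) ^ 2) := by
    field_simp; ring
  have h2 := mul_le_mul_of_nonneg_left h
    (by positivity : 0 ≤ δ ^ 2 / 32768 / (k ^ 2 * p ^ 2))
  have h3 : δ ^ 2 / 32768 / (k ^ 2 * p ^ 2) * (81 * cl ^ 4 * (Real.log n * (k ^ 2 * m * p ^ 3)))
      = 81 / 32768 * (δ * cl) ^ 2 * cl ^ 2 * (m * p * Real.log n) := by field_simp
  have h5 : 0 ≤ m * p * Real.log n :=
    mul_nonneg (by positivity) (Real.log_nonneg (by linarith))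
  have h6 : 200 ≤ cl := by
    have h7 : 0 ≤ cl := by
      by_contra hneg
      have := mul_neg_of_pos_of_neg hδ (not_le.1 hneg)
      linarith
    rw [← hδcl]; exact mul_le_of_le_one_left h7 hδ1
  have h7 : (200 : ℝ) ^ 2 ≤ cl ^ 2 := pow_le_pow_left₀ (by norm_num) h6 2
  rw [h1]
  refine le_trans ?_ h2
  rw [h3, hδcl]
  exact mul_le_mul_of_nonneg_right (by linarith) h5

lemma sqrt_mul_le_of_sample {k m p n s E : ℝ} (hk : 1 ≤ k) (hm : 1 ≤ m) (hp : 1 ≤ p)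
    (hE : 0 ≤ E) (hs : s ^ 2 = k * m * p ^ 3 * (Real.log n / n))
    (h : Real.log n / n ≤ 1 / (k ^ 2 * m * p ^ 3) * E ^ 2) : Real.sqrt k * s ≤ E := by
  have hk0 : 0 < k := by linarith
  have hm0 : 0 < m := by linarith
  have hp0 : 0 < p := by linarith
  refine (abs_le_of_sq_le_sq' ?_ hE).2
  rw [mul_pow, Real.sq_sqrt hk0.le, hs]
  have h1 := mul_le_mul_of_nonneg_left h (by positivity : 0 ≤ k ^ 2 * m * p ^ 3)
  rw [← mul_assoc, mul_one_div_cancel (by positivity), one_mul] at h1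
  linarith

/-- The increase of the Lasso value, on average over the signals, at a dictionary at distance `t`
from the reference dictionary. -/
lemma exists_gap_of_bounds {m p k : ℕ} {ρ : ℝ} (hρ0 : 0 < ρ) (hρ1 : ρ < 1) (hp : 2 ≤ p)
    (hkp : k ≤ p) (hk : 1 ≤ k) (hkρ : (k : ℝ) ≤ ρ * p) {D D₀ : Matrix (Fin m) (Fin p) ℝ}
    (hD : D ∈ dictionaries m p) (hD₀ : D₀ ∈ dictionaries m p) {J : PMF (Finset (Fin p))}
    (hJ : IsSupportLaw k J) {ν : Measure ℝ} [IsProbabilityMeasure ν] {lo hi t x : ℝ}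
    (hsub : ∃ b : ℝ≥0, HasSubgaussianMGF id b ν) (hlo : 0 < lo)
    (hνlo : ∀ᵐ a ∂ν, lo ≤ |a|) (hνhi : ∀ᵐ a ∂ν, |a| ≤ hi)
    (hsymm : ν (Set.Ioi 0) = ν (Set.Iio 0)) (ht : frobNorm (D₀ - D) = t) (ht0 : 0 < t)
    (hx : x = Real.sqrt k * hi * t) (hxe : x ≤ (1 - ρ) / 200 * absMoment ν)
    (hxlo : x ≤ (1 - ρ) / 200 * lo)
    (hkLμ : k * Real.sqrt k * SparseCoding.spectralNorm D₀ * (coherence D₀ + 2 * t)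
      ≤ (1 - ρ) / 200 * qParam ν hi)
    (hκ : k * (coherence D₀ + 2 * t) ≤ (1 - ρ) / 200) (htδ : t ≤ (1 - ρ) / 200) :
    ∃ Z : (Fin p → ℝ) → ℝ, Measurable Z ∧
      (∀ᵐ a ∂(coeffLaw J ν), |Z a| ≤ 16 * k * x ^ 2) ∧
      (1 - ρ) / 4 * (secondMoment ν * ((k : ℝ) / p) * t ^ 2) ≤ ∫ a, Z a ∂(coeffLaw J ν) ∧
      ∀ a, Z a ≤ lassoValue (2 * x) (D₀ *ᵥ a) D - lassoValue (2 * x) (D₀ *ᵥ a) D₀ := by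
  obtain ⟨-, hloe, hlohi, he12, -, -⟩ := moment_bounds hνlo hνhi
  have he1 : 0 < absMoment ν := hlo.trans_le hloe
  have he2 : 0 < secondMoment ν := lt_of_lt_of_le (by positivity) he12
  have hhi : 0 < hi := hlo.trans_le hlohi
  have hp0 : (0 : ℝ) < p := by exact_mod_cast (by omega : 0 < p)
  have hk1 : (1 : ℝ) ≤ k := by exact_mod_cast hk
  have hμ0 : 0 ≤ coherence D₀ + 2 * t := by have := coherence_nonneg D₀; positivity
  have hμκ := le_mul_of_one_le_left hμ0 hk1
  have hδ1 : (1 - ρ) / 200 ≤ 1 / 200 := by linarith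
  have hx0 : 0 ≤ x := by rw [hx]; positivity
  have hxt : x ^ 2 = k * hi ^ 2 * t ^ 2 := by
    rw [hx, mul_pow, mul_pow, Real.sq_sqrt (by positivity)]
  have hL : 1 ≤ SparseCoding.spectralNorm D₀ := one_le_spectralNorm hD₀ (by omega)
  rw [frobNorm_sub_comm] at ht
  have hoff₀ := abs_gram_le_coherence D₀
  have hoff := abs_gram_le hD hD₀ hoff₀
  rw [ht] at hoff
  have hxlo' : 4 * x ≤ lo := by
    have := mul_le_mul_of_nonneg_right hδ1 hlo.le
    linarith
  have ht2 : t ^ 2 ≤ (1 - ρ) / 200 := by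
    have := mul_le_mul_of_nonneg_left (htδ.trans hδ1) ht0.le
    rw [sq]; linarith
  refine exists_measurable_le_lassoValue_sub hD hD₀ hJ hk hμ0 (by linarith) hoff
    (fun i j hij => (hoff₀ i j hij).trans (by linarith)) hsub hlo hνlo hνhi hsymm hx0 hxt ht
    hxlo' fun M M₀ hM hM₀ => ?_
  refine le_trans ?_ (le_sum_gapMean hD hD₀ hJ hkp hp hk hM hM₀ hμ0
    (by linarith) hoff (mulVec_sq_le_spectralNorm D₀) ht ht0.le (by linarith)
    (by positivity) he1.le he2.le)
  refine le_mean_of_small (ρ := ρ) (a := (1 - ρ) / 200) (b := (1 - ρ) / 200)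
    (B := k * SparseCoding.spectralNorm D₀ * (coherence D₀ + 2 * t)) hp0 rfl rfl rfl
    (by positivity) hμ0 ((div_le_iff₀ hp0).2 hkρ) hρ0 hρ1 hκ
    (by linarith) ht0.le ht2 hx0 hxe he1.le he12 ?_ (by linarith) le_rfl (by linarith) le_rfl
  -- Once `hi * 𝔼[|α|] * t` is factored out, the remaining requirement is exactly `hkLμ`.
  have h1 : x * absMoment ν * (k * SparseCoding.spectralNorm D₀ * (coherence D₀ + 2 * t))
      = hi * absMoment ν * t
        * (k * Real.sqrt k * SparseCoding.spectralNorm D₀ * (coherence D₀ + 2 * t)) := by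
    rw [hx]; ring
  have h2 : (1 - ρ) / 200 * secondMoment ν * t
      = hi * absMoment ν * t * ((1 - ρ) / 200 * qParam ν hi) := by
    rw [qParam]; field_simp
  rw [h1, h2]
  exact mul_le_mul_of_nonneg_left hkLμ (by positivity)

end SparseCoding

/-! ### Choice of the constants and proof of the theorem -/

theorem mainTheorem4 (ρ : ℝ) (hρ0 : 0 < ρ) (hρ1 : ρ < 1) :
    ∃ c₀ c₁ cl c : ℝ, 0 < c₀ ∧ 0 < c₁ ∧ 0 < cl ∧ 0 < c ∧
      ∀ (m p n k : ℕ), 2 ≤ n → 1 ≤ k → (k : ℝ) ≤ ρ * p →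
      -- the reference dictionary
      ∀ D₀ ∈ SparseCoding.dictionaries m p,
      -- the law of the support
      ∀ J : PMF (Finset (Fin p)), SparseCoding.IsSupportLaw k J →
      -- the law of the nonzero coefficients
      ∀ (ν : Measure ℝ) [IsProbabilityMeasure ν] (lo hi : ℝ),
        (∃ b : ℝ≥0, HasSubgaussianMGF id b ν) →
        0 < lo → (∀ᵐ a ∂ν, lo ≤ |a|) → (∀ᵐ a ∂ν, |a| ≤ hi) →
        ν (Set.Ioi 0) = ν (Set.Iio 0) →
      -- the coherence condition
      SparseCoding.spectralNorm D₀ * (k : ℝ) ^ (3 / 2 : ℝ) * SparseCoding.coherence D₀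
        ≤ 1 / (c₀ * cl) * SparseCoding.qParam ν hi →
      -- the sample complexity condition
      Real.log n / n ≤ 1 / ((k : ℝ) ^ 2 * m * (p : ℝ) ^ 3) *
        (SparseCoding.secondMoment ν / hi ^ 2 * (1 / (9 * c₁ * cl ^ 2)) *
          min (lo / SparseCoding.subGaussianParam ν)
            (1 / (5 * c₀) * (SparseCoding.bigQParam ν / (k * SparseCoding.spectralNorm D₀)))) ^ 2 →
      -- the independent coefficient vectors of the `n` noiseless signals `D₀ *ᵥ α i ω`
      ∀ {Ω : Type*} [MeasurableSpace Ω] (P : Measure Ω) [IsProbabilityMeasure P]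
        (α : Fin n → Ω → Fin p → ℝ), (∀ i, Measurable (α i)) → iIndepFun α P →
        (∀ i, P.map (α i) = SparseCoding.coeffLaw J ν) →
      ∀ t lam : ℝ, t = SparseCoding.radius c₁ cl m p n k ν hi →
        lam = c * (Real.sqrt k * hi * t) →
        P {ω | ¬ ∃ D ∈ SparseCoding.dictionaries m p,
            SparseCoding.frobNorm (D₀ - D) < t ∧
            IsLocalMinOn
              (SparseCoding.sparseCodingObjective lam (fun i => D₀ *ᵥ α i ω))
              (SparseCoding.dictionaries m p) D}
          < ENNReal.ofReal (((m : ℝ) * p * n / 9) ^ (-((m : ℝ) * p) / 2)) := by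
  obtain ⟨δ, hδ⟩ : ∃ δ, δ = 1 - ρ := ⟨_, rfl⟩
  have hδ0 : 0 < δ := by linarith
  have hδ1 : δ ≤ 1 := by linarith
  obtain ⟨cl, hcl⟩ : ∃ cl, cl = 200 / δ := ⟨_, rfl⟩
  have hδcl : δ * cl = 200 := by rw [hcl]; field_simp
  have hclδ : 1 / cl = δ / 200 := by rw [hcl]; field_simp
  have hcl1 : 1 ≤ cl := by rw [hcl, le_div_iff₀ hδ0]; linarith
  have hcl0 : 0 < cl := by linarith
  -- `1 / cl` is the tolerance `(1 - ρ) / 200` of `le_mean_of_small`. The last constant is 2 because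
  -- `lam = 2 * x`, and `c₀ = 2` leaves half of the coherence budget to the radius.
  refine ⟨2, 1, cl, 2, two_pos, one_pos, hcl0, two_pos, ?_⟩
  intro m p n k hn hk hkρ D₀ hD₀ J hJ ν _ lo hi hsub hlo hνlo hνhi hsymm hcoh hsam
    Ω _ P _ α hα hind hlaw t lam ht hlam
  have hn' : (2 : ℝ) ≤ n := by exact_mod_cast hn
  have hn0 : (0 : ℝ) < n := by linarith
  have hk' : (1 : ℝ) ≤ k := by exact_mod_cast hk
  have hp0 : 0 < p := by
    rcases Nat.eq_zero_or_pos p with h | h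
    · subst h; simp at hkρ; omega
    · exact h
  have hp0' : (0 : ℝ) < p := by exact_mod_cast hp0
  -- With `k ≥ 1` this forces `p ≥ 2`, so that the pair probabilities have a nonzero denominator.
  have hkp : k < p := by
    have : (k : ℝ) < p := hkρ.trans_lt (mul_lt_of_lt_one_left hp0' hρ1)
    exact_mod_cast this
  have hp1' : (1 : ℝ) ≤ p := by exact_mod_cast hp0
  have hm : 1 ≤ m := by
    rcases Nat.eq_zero_or_pos m with h | h
    · subst h
      have := hD₀ ⟨0, hp0⟩
      simp at this
    · exact h
  have hm' : (1 : ℝ) ≤ m := by exact_mod_cast hm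
  obtain ⟨hi2, hloe, hlohi, he12, he2h, he1h⟩ := SparseCoding.moment_bounds hνlo hνhi
  have hσ := SparseCoding.secondMoment_le_sq_subGaussianParam hsub hi2
  have hσ0 : 0 ≤ SparseCoding.subGaussianParam ν := NNReal.coe_nonneg _
  have he1 : 0 < SparseCoding.absMoment ν := hlo.trans_le hloe
  have he2 : 0 < SparseCoding.secondMoment ν := lt_of_lt_of_le (by positivity) he12
  have hhi : 0 < hi := hlo.trans_le hlohi
  have hσ1 : 0 < SparseCoding.subGaussianParam ν := by
    refine hσ0.lt_of_ne fun h => ?_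
    rw [← h] at hσ
    linarith
  have hloσ : lo ≤ SparseCoding.subGaussianParam ν :=
    hloe.trans (abs_le_of_sq_le_sq' (he12.trans hσ) hσ0).2
  have he2hi : SparseCoding.secondMoment ν ≤ hi ^ 2 :=
    he2h.trans (by rw [sq]; exact mul_le_mul_of_nonneg_left he1h hhi.le)
  have hL : 1 ≤ SparseCoding.spectralNorm D₀ := SparseCoding.one_le_spectralNorm hD₀ hp0
  simp only [SparseCoding.bigQParam, mul_one] at hsam
  obtain ⟨mn, hmn⟩ : ∃ mn, mn = min (lo / SparseCoding.subGaussianParam ν) (1 / (5 * 2) *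
    (SparseCoding.secondMoment ν / (SparseCoding.subGaussianParam ν * SparseCoding.absMoment ν) /
      (k * SparseCoding.spectralNorm D₀))) := ⟨_, rfl⟩
  rw [← hmn] at hsam
  have hmn0 : 0 ≤ mn := by rw [hmn]; exact le_min (by positivity) (by positivity)
  have hmn1 : mn ≤ lo / SparseCoding.subGaussianParam ν := hmn.trans_le (min_le_left _ _)
  have hmn2 := hmn.trans_le (min_le_right _ _)
  norm_num only at hmn2
  have hmnle : mn ≤ 1 := hmn1.trans ((div_le_one hσ1).2 hloσ)
  have hlogn : 0 ≤ Real.log n / n := div_nonneg (Real.log_nonneg (by linarith)) hn0.le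
  have hss := Real.sq_sqrt (by positivity : 0 ≤ (k : ℝ) * m * (p : ℝ) ^ 3 * (Real.log n / n))
  have hs0 := Real.sqrt_nonneg ((k : ℝ) * m * (p : ℝ) ^ 3 * (Real.log n / n))
  rw [SparseCoding.radius, mul_one] at ht
  have hk32 : (k : ℝ) ^ (3 / 2 : ℝ) = k * Real.sqrt k := by
    rw [Real.sqrt_eq_rpow, ← Real.rpow_one_add' (by positivity) (by norm_num)]
    norm_num
  rw [hk32] at hcoh
  have hsam' := SparseCoding.sqrt_mul_le_of_sample hk' hm' hp1' (by positivity) hss hsam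
  obtain ⟨x, hx⟩ : ∃ x, x = Real.sqrt k * hi * t := ⟨_, rfl⟩
  obtain ⟨hq0, hq1, hxe, hxlo, hkLμ, hkLt⟩ := SparseCoding.radius_bounds hk' hs0 hcl1 hlo hloe he1h
    he12 he2h hσ1 hσ hL rfl ht hx hmn1 hmn2 (hcoh.trans (le_of_eq (by rw [SparseCoding.qParam]; ring)))
    hsam'
  obtain ⟨hs1, hs2, hs3, hs4⟩ := SparseCoding.sample_bounds hk' hm' hp1' hn' hcl1 hhi he2 hq0 hq1
    hmn0 hmnle he2hi hss hs0 ht hsam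
  rw [hclδ] at hxe hxlo hkLμ hkLt
  have ht0 : 0 < t := by
    have h1 : 0 ≤ t := by rw [ht, SparseCoding.qParam]; positivity
    refine h1.lt_of_ne fun h => ?_
    rw [← h, zero_pow two_ne_zero] at hs3
    exact absurd hs3 (not_le.2 (by positivity))
  have hx0 : 0 < x := by
    have : 0 < Real.sqrt k := Real.sqrt_pos.2 (by linarith)
    rw [hx]; positivity
  have hc0 := SparseCoding.coherence_nonneg D₀
  obtain ⟨hκ, htδ⟩ := SparseCoding.derived_bounds hk' hL
    (by positivity : 0 ≤ SparseCoding.coherence D₀ + 2 * t) ht0.le hq1 hδ0 hkLμ hkLt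
  have hxt : x ^ 2 = k * hi ^ 2 * t ^ 2 := by
    rw [hx, mul_pow, mul_pow, Real.sq_sqrt (by positivity)]
  obtain ⟨hδn, hmpn⟩ := SparseCoding.sample_size hk' hm' hp1' hn' hδ0 hδ1 hcl1 hδcl hs2
  have hlip := SparseCoding.lip_bound hk' hm' hp1' hn' ht0 (by linarith) hhi he2hi he2 hδ0 hs3 hs4
    hδn
  have hX := SparseCoding.exponent_bound hk' hm' hp1' hn' hδ0 hδ1 hδcl ht0 hhi hs1
  rw [← hxt] at hX
  rw [← hx, ← Nat.cast_pow] at hlip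
  have hfail := SparseCoding.failure_bound hm hp0 hn hmpn hX
  rw [← hx] at hlam
  subst hlam
  have hZ : ∀ D ∈ {D | D ∈ SparseCoding.dictionaries m p ∧ SparseCoding.frobNorm (D₀ - D) = t}, _ :=
    fun D hD => SparseCoding.exists_gap_of_bounds hρ0 hρ1 (by omega) hkp.le hk hkρ hD.1 hD₀ hJ hsub
      hlo hνlo hνhi hsymm hD.2 ht0 hx (by rwa [← hδ]) (by rwa [← hδ]) (by rw [← hδ]; exact hkLμ)
      (by rwa [← hδ]) (by rwa [← hδ])
  rw [← hδ] at hZ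
  have hk0 : (0 : ℝ) < k := by linarith
  have hmain := SparseCoding.measure_not_forall_sphere_le (P := P) (by omega : 0 < n) hD₀
    (fun D hD => hD.1) hJ hνlo hνhi hα hind hlaw (N := n ^ 5) (by positivity)
    (by positivity) (by positivity) (by positivity) rfl (by positivity) hlip hZ
  refine lt_of_le_of_lt ((measure_mono ?_).trans hmain)
    ((ENNReal.ofReal_lt_ofReal_iff (lt_of_le_of_lt (by positivity) hfail)).2 hfail)
  intro ω hω hall
  exact hω (SparseCoding.exists_isLocalMinOn_of_sphere
    (SparseCoding.continuous_sparseCodingObjective (by positivity) _) hD₀ ht0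
    fun D hD hDt => hall D ⟨hD, hDt⟩)
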